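/- \textbf{Setting.} Let $m\ge 1$, $\varepsilon>0$, and let $Z_1,\dots,Z_m$ be i.i.d. random variables with the Laplace density $\frac{1}{2b}e^{-|z|/b}$ or the Gumbel density $\frac1b e^{-(z/b+e^{-z/b})}$, where $b=1/\varepsilon$. Let $D$ be the array of the tuples $(i,Z_i)$, $i\in[m]$, sorted in descending order by $Z_i$, and let $\mathrm{inv}(i)$ be the position in $D$ of the tuple of item $i$. The $n$-th \emph{sorted access} to $D$ returns $D[n]$; a \emph{random access} with item $i$ returns $D[\mathrm{inv}(i)]=(i,Z_i)$. An \emph{access strategy} issues requests one after the other, each being a sorted access or a random access with some item, chosen as a measurable function of the answers received so far, with at most $m$ sorted accesses in total. \textbf{Machine model.} Programs are finite and independent of $m$ and $\varepsilon$. They act on words, i.e. integers below $(m+2)^c$ for a constant $c$ (so of $O(\log m)$ bits), and on real numbers, both in registers and in indirectly addressed memory. At unit cost a program can do each of the following: word arithmetic ($+,-,\cdot$, integer division and remainder, modulo the word bound), exact real arithmetic ($+,-,\cdot,/,\exp,\log,\sqrt{\ }$), conversion of a word to a real, a comparison, a memory access, the generation of a uniform element of $\{0,\dots,n-1\}$ for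 a word $n\ge1$, or the generation of a uniform real number in $[0,1]$. \textbf{Theorem.} For each of the two kinds of noise there are an oracle $\mathcal A_{oracle}$ (one program that is run at every sorted access and one that is run at every random access, with common memory that is kept between accesses) and constants $c, C$ such that the following holds for all $m\ge1$, all $\varepsilon>0$ and every access strategy. \begin{itemize} \item Nothing is generated in advance: before the first access the memory contains only $m$ and $\varepsilon$, and is zero elsewhere. \item For every $t$, the expected time that $\mathcal A_{oracle}$ takes to answer the $t$-th access is at most $C\cdot\max\{1,\log\log m\}$ (where $\log\log 1$ is read as $0$), hence $O(\log\log m)$. \item For every $t$, the sequence of the first $t$ tuples returned by $\mathcal A_{oracle}$ has the same joint distribution as the sequence of the first $t$ tuples that the same strategy receives when the accesses are answered from the array $D$ generated and sorted in advance. \end{itemize} -/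

import Mathlib

open MeasureTheory
open scoped ENNReal NNReal

noncomputable section

namespace NoiseOracle

/-! ## A randomized machine: word RAM for integers, real RAM for reals

Integer registers and integer memory cells hold words, i.e. integers below the word bound `W`; every
integer operation is reduced modulo `W`.  Real registers and real memory cells hold real numbers.
There is no conversion from reals to words.  Every instruction, every test and every sequencing step
costs one unit of time. -/

/-- Binary operations on words. -/
inductive WordOp
  | add | sub | mul | div | mod

/-- The value of a word operation, before reduction modulo the word bound
(subtraction is truncated at `0`). -/
def WordOp.eval : WordOp → ℕ → ℕ → ℕ
  | .add, a, b => a + b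
  | .sub, a, b => a - b
  | .mul, a, b => a * b
  | .div, a, b => a / b
  | .mod, a, b => a % b

/-- Binary operations on reals. -/
inductive RealOp
  | add | sub | mul | div

def RealOp.eval : RealOp → ℝ → ℝ → ℝ
  | .add, x, y => x + y
  | .sub, x, y => x - y
  | .mul, x, y => x * y
  | .div, x, y => x / y

/-- Elementary functions on reals. -/
inductive RealFun
  | exp | log | sqrt

def RealFun.eval : RealFun → ℝ → ℝ
  | .exp, x => Real.exp x
  | .log, x => Real.log x
  | .sqrt, x => Real.sqrt x

/-- Instructions; the natural number arguments are register names, except for the second argument of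
`const`, which is a constant. -/
inductive Instr
  /-- word register `d` receives the constant `n` -/
  | const (d n : ℕ)
  /-- word register `d` receives the result of `o` on the word registers `a`, `b` -/
  | word (o : WordOp) (d a b : ℕ)
  /-- word register `d` receives the word memory cell whose address is in word register `a` -/
  | load (d a : ℕ)
  /-- the word memory cell whose address is in word register `a` receives word register `s` -/
  | store (a s : ℕ)
  /-- word register `d` receives a uniformly random element of `{0, …, n - 1}`, where `n ≥ 1` is the
  content of word register `a` -/
  | randWord (d a : ℕ)
  /-- real register `d` receives the content of word register `a` -/
  | cast (d a : ℕ)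
  /-- real register `d` receives the result of `o` on the real registers `a`, `b` -/
  | real (o : RealOp) (d a b : ℕ)
  /-- real register `d` receives the value of `f` at real register `a` -/
  | realFun (f : RealFun) (d a : ℕ)
  /-- real register `d` receives the real memory cell whose address is in word register `a` -/
  | loadReal (d a : ℕ)
  /-- the real memory cell whose address is in word register `a` receives real register `s` -/
  | storeReal (a s : ℕ)
  /-- real register `d` receives a uniformly random element of `[0, 1]` -/
  | randReal (d : ℕ)

/-- Tests on two word registers or on two real registers. -/
inductive Test
  | wordEq (a b : ℕ)
  | wordLt (a b : ℕ)
  | realLt (a b : ℕ)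

/-- Programs.  A program is a finite object that does not depend on the size of the input. -/
inductive Prog
  | instr (i : Instr)
  | seq (p q : Prog)
  | ite (b : Test) (p q : Prog)
  | loop (b : Test) (p : Prog)

/-- The storage of the machine. -/
structure Store where
  wordReg : ℕ → ℕ
  realReg : ℕ → ℝ
  wordMem : ℕ → ℕ
  realMem : ℕ → ℝ

def Store.setWord (s : Store) (d v : ℕ) : Store :=
  { s with wordReg := Function.update s.wordReg d v }

def Store.setReal (s : Store) (d : ℕ) (v : ℝ) : Store :=
  { s with realReg := Function.update s.realReg d v }

/-- The effect of an instruction on the store, with word bound `W`.  The number `u` is the uniform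
random number of the current time step; `⌊u * n⌋` is uniform on `{0, …, n - 1}` (the minimum only
matters for `u = 1`). -/
def Instr.exec (W : ℕ) (u : unitInterval) (s : Store) : Instr → Store
  | .const d n => s.setWord d (n % W)
  | .word o d a b => s.setWord d (o.eval (s.wordReg a) (s.wordReg b) % W)
  | .load d a => s.setWord d (s.wordMem (s.wordReg a))
  | .store a r => { s with wordMem := Function.update s.wordMem (s.wordReg a) (s.wordReg r) }
  | .randWord d a =>
      s.setWord d (min ⌊(u : ℝ) * (s.wordReg a : ℝ)⌋₊ (s.wordReg a - 1))
  | .cast d a => s.setReal d (s.wordReg a : ℝ)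
  | .real o d a b => s.setReal d (o.eval (s.realReg a) (s.realReg b))
  | .realFun f d a => s.setReal d (f.eval (s.realReg a))
  | .loadReal d a => s.setReal d (s.realMem (s.wordReg a))
  | .storeReal a r => { s with realMem := Function.update s.realMem (s.wordReg a) (s.realReg r) }
  | .randReal d => s.setReal d (u : ℝ)

def Test.Holds (s : Store) : Test → Prop
  | .wordEq a b => s.wordReg a = s.wordReg b
  | .wordLt a b => s.wordReg a < s.wordReg b
  | .realLt a b => s.realReg a < s.realReg b

/-- A configuration: the programs that remain to be executed, in order, and the store.  The machine
has halted when nothing remains. -/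
structure Config where
  todo : List Prog
  store : Store

open Classical in
/-- One time step. -/
def step (W : ℕ) (u : unitInterval) : Config → Config
  | ⟨[], s⟩ => ⟨[], s⟩
  | ⟨.instr i :: k, s⟩ => ⟨k, i.exec W u s⟩
  | ⟨.seq p q :: k, s⟩ => ⟨p :: q :: k, s⟩
  | ⟨.ite b p q :: k, s⟩ => if b.Holds s then ⟨p :: k, s⟩ else ⟨q :: k, s⟩
  | ⟨.loop b p :: k, s⟩ => if b.Holds s then ⟨p :: .loop b p :: k, s⟩ else ⟨k, s⟩

/-- The configuration after `n` time steps; time step `n` may use the random number `u n`. -/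
def run (W : ℕ) (u : ℕ → unitInterval) (c : Config) : ℕ → Config
  | 0 => c
  | n + 1 => step W (u n) (run W u c n)

/-- The number of time steps until the machine halts (`⊤` if it never does). -/
def haltTime (W : ℕ) (u : ℕ → unitInterval) (c : Config) : ℕ∞ :=
  ⨅ (n : ℕ) (_ : (run W u c n).todo = []), (n : ℕ∞)

/-! ## Accesses and access strategies -/

/-- A request to the list of noisy tuples of `m` items: the next sorted access, or a random access to
the item `i`. -/
inductive Query (m : ℕ)
  | sorted
  | random (i : Fin m)
  deriving DecidableEq

/-- The answer to a request: an item (as a natural number) and its noise value. -/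
abbrev Answer := ℕ × ℝ

/-- The number of sorted accesses among the first `t` requests, for the rule `next` which determines
each request from the answers to the previous ones, when the answers are `h`. -/
def sortedCount {m : ℕ} (next : (t : ℕ) → (Fin t → Answer) → Query m) (t : ℕ)
    (h : Fin t → Answer) : ℕ :=
  (Finset.univ.filter fun s : Fin t =>
    next s (fun i => h (Fin.castLE s.isLt.le i)) = Query.sorted).card

/-- An adaptive access strategy: every request is a measurable function of the answers to the previous
requests.  There are only `m` tuples, so at most `m` sorted accesses are made. -/
structure Strategy (m : ℕ) where
  next : (t : ℕ) → (Fin t → Answer) → Query m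
  measurable_next : ∀ t q, MeasurableSet (next t ⁻¹' {q})
  sorted_lt : ∀ t h, next t h = Query.sorted → sortedCount next t h < m

/-! ## The list that is generated and sorted in advance -/

/-- The two kinds of noise. -/
inductive Noise
  | laplace
  | gumbel

/-- The density of the Laplace, resp. Gumbel, distribution with scale `b`. -/
def Noise.density : Noise → ℝ → ℝ → ℝ
  | .laplace, b, z => 1 / (2 * b) * Real.exp (-(|z| / b))
  | .gumbel, b, z => 1 / b * Real.exp (-(z / b + Real.exp (-(z / b))))

/-- The noise distribution with scale `b`. -/
def Noise.law (N : Noise) (b : ℝ) : Measure ℝ :=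
  volume.withDensity fun z => ENNReal.ofReal (N.density b z)

/-- The law of the noise values `Z_i` of the `m` items: independent, with scale `1 / ε`. -/
def noiseLaw (N : Noise) (m : ℕ) (ε : ℝ) : Measure (Fin m → ℝ) :=
  Measure.pi fun _ => N.law (1 / ε)

/-- The permutation that sorts the items by descending noise value. -/
def sortPerm {m : ℕ} (z : Fin m → ℝ) : Equiv.Perm (Fin m) :=
  Tuple.sort fun i => -z i

/-- The array of the tuples `(i, z i)`, sorted by descending noise value. -/
def sortedArray {m : ℕ} (z : Fin m → ℝ) (j : Fin m) : Fin m × ℝ :=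
  (sortPerm z j, z (sortPerm z j))

/-- The inverted index: the position of the tuple of item `i` in the sorted array. -/
def invertedIndex {m : ℕ} (z : Fin m → ℝ) (i : Fin m) : Fin m :=
  (sortPerm z).symm i

/-- The answer that is read off the sorted array, when `n` sorted accesses have been made before
(the value for `n ≥ m` is irrelevant). -/
def tableAnswer {m : ℕ} (z : Fin m → ℝ) (n : ℕ) : Query m → Answer
  | .sorted =>
      if hn : n < m then (((sortedArray z ⟨n, hn⟩).1 : ℕ), (sortedArray z ⟨n, hn⟩).2) else (0, 0)
  | .random i =>
      (((sortedArray z (invertedIndex z i)).1 : ℕ), (sortedArray z (invertedIndex z i)).2)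

/-- The first `t` answers that the strategy `σ` receives from the sorted array. -/
def tableTranscript {m : ℕ} (σ : Strategy m) (z : Fin m → ℝ) : (t : ℕ) → Fin t → Answer
  | 0 => Fin.elim0
  | t + 1 =>
      let h := tableTranscript σ z t
      Fin.snoc (α := fun _ => Answer) h (tableAnswer z (sortedCount σ.next t h) (σ.next t h))

/-! ## Answering the accesses by a program -/

/-- An oracle: a program that is run at each sorted access and one that is run at each random access.
The storage is kept between accesses. -/
structure Oracle where
  onSorted : Prog
  onRandom : Prog

/-- The store before the first access: word register 1 holds the number `m` of items, real register 1
holds `ε`, and everything else is zero.  In particular no noise has been generated. -/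
def initStore (m : ℕ) (ε : ℝ) : Store where
  wordReg := Function.update (fun _ => 0) 1 m
  realReg := Function.update (fun _ => 0) 1 ε
  wordMem := fun _ => 0
  realMem := fun _ => 0

/-- The configuration at the beginning of an access; the item of a random access is passed in word
register 0. -/
def Oracle.start {m : ℕ} (A : Oracle) (s : Store) : Query m → Config
  | .sorted => ⟨[A.onSorted], s⟩
  | .random i => ⟨[A.onRandom], s.setWord 0 i⟩

/-- The store when the program of an access has halted. -/
def Oracle.result {m : ℕ} (A : Oracle) (W : ℕ) (u : ℕ → unitInterval) (s : Store) (q : Query m) :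
    Store :=
  (run W u (A.start s q) (haltTime W u (A.start s q)).toNat).store

/-- The answer to an access is passed in word register 0 and real register 0. -/
def Store.answer (s : Store) : Answer := (s.wordReg 0, s.realReg 0)

/-- The random numbers: `ω t n` is for time step `n` of access `t`. -/
abbrev Randomness := ℕ → ℕ → unitInterval

/-- The random numbers are independent and uniform on `[0, 1]`. -/
def randomnessLaw : Measure Randomness :=
  Measure.infinitePi fun _ : ℕ => Measure.infinitePi fun _ : ℕ => (volume : Measure unitInterval)

/-- The store after the first `t` accesses of the strategy `σ`, and the answers to them. -/
def Oracle.session {m : ℕ} (A : Oracle) (W : ℕ) (ε : ℝ) (σ : Strategy m) (ω : Randomness) :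
    (t : ℕ) → Store × (Fin t → Answer)
  | 0 => (initStore m ε, Fin.elim0)
  | t + 1 =>
      let p := A.session W ε σ ω t
      let s := A.result W (ω t) p.1 (σ.next t p.2)
      (s, Fin.snoc (α := fun _ => Answer) p.2 s.answer)

/-- The first `t` answers that the strategy `σ` receives from the oracle. -/
def Oracle.transcript {m : ℕ} (A : Oracle) (W : ℕ) (ε : ℝ) (σ : Strategy m) (t : ℕ)
    (ω : Randomness) : Fin t → Answer :=
  (A.session W ε σ ω t).2

/-- The time that the oracle takes for the access number `t` (counted from `0`) of the strategy. -/
def Oracle.accessTime {m : ℕ} (A : Oracle) (W : ℕ) (ε : ℝ) (σ : Strategy m) (t : ℕ)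
    (ω : Randomness) : ℕ∞ :=
  haltTime W (ω t)
    (A.start (A.session W ε σ ω t).1 (σ.next t (A.session W ε σ ω t).2))

end NoiseOracle

end

/-! Write L = 2 ^ `logExp m`, the least power of two with log m ≤ L, and B = `buckets m` = ⌊m / L⌋.
If keys y_i are independent and uniform on [0, B], then quantile(y_i / B) / ε are i.i.d. noise
values with the required law (`noiseLaw_eq_map`); the quantile is strictly increasing on (0, 1), so
sorting by noise is sorting by key. The unit intervals [b, b + 1] are the buckets.

Keys are generated lazily. A threshold τ is kept such that, given the history, the unknown keys are
independent and uniform on [0, τ]. A random access to an unknown item samples its key there. A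
sorted access draws V = τ U^(1/k), distributed as the largest of the k unknown keys, and goes down
from the bucket of τ to the first bucket b that holds a known key not yet returned or satisfies b ≤
V. If V < b, only the fact that all unknown keys lie below b is used: τ becomes b and V is
forgotten. Otherwise V is given to a uniformly random unknown item and τ becomes V. In both cases
the largest unreturned key of bucket b is the next one in the sorted order. Forgetting V is harmless
because uniform keys conditioned to lie below b are again uniform below b; `lintegral_maxKey_scaled`
is the exact statement.

Conditional laws are avoided by completing the store: `compl m s x` fills in each unknown key as τ
x_i with fresh uniform x_i. One access, averaged over its random numbers, does not change the law of
the completion (`Ready.lintegral_result`). Moreover the answer is the one that the table of the keys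
completed after the access gives, almost surely (`Ready.step`, `ae_nice_session`). By induction the
answers and the completed keys have jointly the law of the table transcript and of i.i.d. uniform
keys (`lintegral_session`); forgetting the keys proves the claim on distributions.

The time is also bounded through the completed keys (`timeBound`). Each bucket has a tournament tree
with at most as many slots as there are completed keys in the bucket, so an update costs the
logarithm of a load; and the buckets passed over between the two ends of a scan contain no completed
key at all. Whatever the strategy does, the keys completed after an access are i.i.d. uniform
(`lintegral_session_compl`), which leaves a balls-into-bins estimate. As m / B ≥ L ≥ log m, the
expected number of empty buckets is at most B exp(-m / B) ≤ 1. As m / B ≤ 2 L, an exponential moment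
and a union bound over the buckets give expected logarithm of the maximal load at most `logExp m` +
5, which is O(log log m).

The machine imposes three devices. The memory cannot be set up in advance, so permutations are
stored relative to the identity and trees so that zeros mean empty. Reals cannot be rounded to
words, so the bucket of a sampled key is drawn first, as a word, and the bucket of V is found by the
scan. Finally all random numbers of an access are drawn at its beginning, at times fixed by the
store, and the rest is deterministic; hence they are independent coordinates of the random sequence.
-/

noncomputable section

namespace NoiseOracle

/-! ## Big-step execution -/

/-- The program `p`, started at time `n` in the store `s`, ends at time `n'` in the store `s'`. -/
def Exec (W : ℕ) (u : ℕ → unitInterval) (p : Prog) (n : ℕ) (s : Store) (n' : ℕ) (s' : Store) :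
    Prop :=
  n ≤ n' ∧ ∀ k c, run W u c n = ⟨p :: k, s⟩ → run W u c n' = ⟨k, s'⟩

section Exec

variable {W : ℕ} {u : ℕ → unitInterval} {n n₁ n' : ℕ} {s s₁ s' : Store} {p q : Prog} {b : Test}

theorem Exec.instr (i : Instr) (n : ℕ) (s : Store) :
    Exec W u (.instr i) n s (n + 1) (i.exec W (u n) s) :=
  ⟨by omega, fun k c h => by rw [run, h, step]⟩

theorem Exec.seq (h₁ : Exec W u p (n + 1) s n₁ s₁) (h₂ : Exec W u q n₁ s₁ n' s') :
    Exec W u (.seq p q) n s n' s' :=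
  ⟨by have := h₁.1; have := h₂.1; omega,
    fun k c h => h₂.2 _ _ (h₁.2 _ _ (by rw [run, h, step]))⟩

theorem Exec.ite_true (hb : b.Holds s) (h : Exec W u p (n + 1) s n' s') :
    Exec W u (.ite b p q) n s n' s' :=
  ⟨by have := h.1; omega, fun k c hc => h.2 _ _ (by rw [run, hc, step, if_pos hb])⟩

theorem Exec.ite_false (hb : ¬ b.Holds s) (h : Exec W u q (n + 1) s n' s') :
    Exec W u (.ite b p q) n s n' s' :=
  ⟨by have := h.1; omega, fun k c hc => h.2 _ _ (by rw [run, hc, step, if_neg hb])⟩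

theorem Exec.loop_true (hb : b.Holds s) (h₁ : Exec W u p (n + 1) s n₁ s₁)
    (h₂ : Exec W u (.loop b p) n₁ s₁ n' s') : Exec W u (.loop b p) n s n' s' :=
  ⟨by have := h₁.1; have := h₂.1; omega,
    fun k c hc => h₂.2 _ _ (h₁.2 _ _ (by rw [run, hc, step, if_pos hb]))⟩

theorem Exec.loop_false (hb : ¬ b.Holds s) : Exec W u (.loop b p) n s (n + 1) s :=
  ⟨by omega, fun k c hc => by rw [run, hc, step, if_neg hb]⟩

end Exec

theorem run_of_halted {W : ℕ} {u : ℕ → unitInterval} {c : Config} {n : ℕ}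
    (h : (run W u c n).todo = []) (k : ℕ) : run W u c (n + k) = run W u c n := by
  induction k with
  | zero => rfl
  | succ k ih =>
    rw [← add_assoc, run, ih]
    revert h
    generalize run W u c n = d
    rcases d with ⟨t, s⟩
    rintro rfl
    rfl

theorem haltTime_le_of_halted {W : ℕ} {u : ℕ → unitInterval} {c : Config} {n : ℕ}
    (h : (run W u c n).todo = []) : haltTime W u c ≤ n :=
  iInf₂_le (f := fun (n : ℕ) (_ : (run W u c n).todo = []) => (n : ℕ∞)) n h

/-- A halted machine stays as it is, so the store at the first halting time can be read off at any
later time; executions only supply some time at which the machine has halted. -/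
theorem run_haltTime {W : ℕ} {u : ℕ → unitInterval} {c : Config} {n : ℕ}
    (h : (run W u c n).todo = []) : run W u c (haltTime W u c).toNat = run W u c n := by
  classical
  have hex : ∃ n, (run W u c n).todo = [] := ⟨n, h⟩
  have h1 : haltTime W u c = (Nat.find hex : ℕ) := by
    refine le_antisymm (haltTime_le_of_halted (Nat.find_spec hex)) ?_
    refine le_iInf₂ fun k hk => ?_
    exact_mod_cast Nat.find_min' hex hk
  rw [h1, ENat.toNat_natCast]
  obtain ⟨k, hk⟩ := Nat.exists_eq_add_of_le (Nat.find_min' hex h)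
  rw [hk, run_of_halted (Nat.find_spec hex)]

theorem Exec.haltTime_le {W : ℕ} {u : ℕ → unitInterval} {p : Prog} {s s' : Store} {n' : ℕ}
    (h : Exec W u p 0 s n' s') : haltTime W u ⟨[p], s⟩ ≤ n' :=
  haltTime_le_of_halted (by rw [h.2 [] ⟨[p], s⟩ rfl])

theorem Exec.run_haltTime {W : ℕ} {u : ℕ → unitInterval} {p : Prog} {s s' : Store} {n' : ℕ}
    (h : Exec W u p 0 s n' s') :
    (run W u ⟨[p], s⟩ (haltTime W u ⟨[p], s⟩).toNat).store = s' := by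
  have h1 := h.2 [] ⟨[p], s⟩ rfl
  rw [NoiseOracle.run_haltTime (n := n') (by rw [h1]), h1]

/-! ## Execution up to scratch registers -/

/-- The stores agree except possibly in the registers with numbers `≥ 20`. -/
structure Sim (s t : Store) : Prop where
  wordReg : ∀ r < 20, t.wordReg r = s.wordReg r
  realReg : ∀ r < 20, t.realReg r = s.realReg r
  wordMem : t.wordMem = s.wordMem
  realMem : t.realMem = s.realMem

theorem Sim.refl (s : Store) : Sim s s := ⟨fun _ _ => rfl, fun _ _ => rfl, rfl, rfl⟩

/-- Execution where the scratch registers of the initial and of the final store do not matter. -/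
def ExecS (W : ℕ) (u : ℕ → unitInterval) (p : Prog) (n : ℕ) (s : Store) (n' : ℕ) (s' : Store) :
    Prop :=
  ∀ t, Sim s t → ∃ t', Sim s' t' ∧ Exec W u p n t n' t'

/-- The registers of a test are not scratch registers. -/
def Test.ok : Test → Bool
  | .wordEq a b => a < 20 && b < 20
  | .wordLt a b => a < 20 && b < 20
  | .realLt a b => a < 20 && b < 20

theorem Sim.holds_iff {s t : Store} (h : Sim s t) {b : Test} (hb : b.ok = true) :
    b.Holds t ↔ b.Holds s := by
  cases b <;> simp only [Test.ok, Bool.and_eq_true, decide_eq_true_eq] at hb <;>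
    simp only [Test.Holds]
  · rw [h.wordReg _ hb.1, h.wordReg _ hb.2]
  · rw [h.wordReg _ hb.1, h.wordReg _ hb.2]
  · rw [h.realReg _ hb.1, h.realReg _ hb.2]

section ExecS

variable {W : ℕ} {u : ℕ → unitInterval} {n n₁ n' : ℕ} {s s₁ s' : Store} {p q : Prog} {b : Test}

theorem ExecS.seq (h₁ : ExecS W u p (n + 1) s n₁ s₁) (h₂ : ExecS W u q n₁ s₁ n' s') :
    ExecS W u (.seq p q) n s n' s' := fun t ht => by
  obtain ⟨t₁, ht₁, e₁⟩ := h₁ t ht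
  obtain ⟨t₂, ht₂, e₂⟩ := h₂ t₁ ht₁
  exact ⟨t₂, ht₂, e₁.seq e₂⟩

theorem ExecS.ite_true (hb : b.Holds s) (h : ExecS W u p (n + 1) s n' s')
    (hok : b.ok = true := by rfl) : ExecS W u (.ite b p q) n s n' s' := fun t ht => by
  obtain ⟨t₁, ht₁, e₁⟩ := h t ht
  exact ⟨t₁, ht₁, e₁.ite_true ((ht.holds_iff hok).2 hb)⟩

theorem ExecS.ite_false (hb : ¬ b.Holds s) (h : ExecS W u q (n + 1) s n' s')
    (hok : b.ok = true := by rfl) : ExecS W u (.ite b p q) n s n' s' := fun t ht => by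
  obtain ⟨t₁, ht₁, e₁⟩ := h t ht
  exact ⟨t₁, ht₁, e₁.ite_false (fun h => hb ((ht.holds_iff hok).1 h))⟩

theorem ExecS.loop_true (hb : b.Holds s) (h₁ : ExecS W u p (n + 1) s n₁ s₁)
    (h₂ : ExecS W u (.loop b p) n₁ s₁ n' s') (hok : b.ok = true := by rfl) :
    ExecS W u (.loop b p) n s n' s' := fun t ht => by
  obtain ⟨t₁, ht₁, e₁⟩ := h₁ t ht
  obtain ⟨t₂, ht₂, e₂⟩ := h₂ t₁ ht₁
  exact ⟨t₂, ht₂, e₁.loop_true ((ht.holds_iff hok).2 hb) e₂⟩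

theorem ExecS.loop_false (hb : ¬ b.Holds s) (hok : b.ok = true := by rfl) :
    ExecS W u (.loop b p) n s (n + 1) s := fun t ht =>
  ⟨t, ht, Exec.loop_false (fun h => hb ((ht.holds_iff hok).1 h))⟩

end ExecS

/-! ## Expressions -/

/-- Expressions for words. -/
inductive WExp
  | reg (r : ℕ)
  | const (n : ℕ)
  | op (o : WordOp) (a b : WExp)
  | load (a : WExp)

namespace WExp

def ok : WExp → Bool
  | reg r => r < 20
  | const _ => true
  | op _ a b => a.ok && b.ok
  | load a => a.ok

/-- The value of an expression. -/
def eval (W : ℕ) (s : Store) : WExp → ℕ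
  -- A register is copied by adding it to zero, which reduces modulo `W`.
  | reg r => s.wordReg r % W
  | const n => n % W
  | op o a b => o.eval (a.eval W s) (b.eval W s) % W
  | load a => s.wordMem (a.eval W s)

/-- A program that stores the value of an expression in register `d`, using the registers from `d`
onwards. -/
def compile : WExp → ℕ → Prog
  | reg r, d => .seq (.instr (.const d 0)) (.instr (.word .add d d r))
  | const n, d => .instr (.const d n)
  | op o a b, d => .seq (a.compile d) (.seq (b.compile (d + 1)) (.instr (.word o d d (d + 1))))
  | load a, d => .seq (a.compile d) (.instr (.load d d))

def cost : WExp → ℕ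
  | reg _ => 3
  | const _ => 1
  | op _ a b => a.cost + b.cost + 3
  | load a => a.cost + 2

theorem eval_congr {W : ℕ} {s t : Store} : ∀ {e : WExp}, e.ok = true →
    (∀ r < 20, t.wordReg r = s.wordReg r) → t.wordMem = s.wordMem → e.eval W t = e.eval W s
  | reg r, h, h1, _ => by simp only [ok, decide_eq_true_eq] at h; simp only [eval, h1 r h]
  | const n, _, _, _ => rfl
  | op o a b, h, h1, h2 => by
    simp only [ok, Bool.and_eq_true] at h
    simp only [eval, eval_congr h.1 h1 h2, eval_congr h.2 h1 h2]
  | load a, h, h1, h2 => by simp only [eval, eval_congr (e := a) h h1 h2, h2]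

/-- The registers from `d` on act as a stack: the code for the second operand leaves everything
below `d + 1` alone, so the first value survives, and `20 ≤ d` protects the registers that
expressions may mention. -/
theorem exec_compile {W : ℕ} {u : ℕ → unitInterval} : ∀ {e : WExp}, e.ok = true → ∀ (d n : ℕ)
    (s : Store), 20 ≤ d → ∃ s', Exec W u (e.compile d) n s (n + e.cost) s' ∧
      s'.wordReg d = e.eval W s ∧ (∀ r < d, s'.wordReg r = s.wordReg r) ∧
      s'.realReg = s.realReg ∧ s'.wordMem = s.wordMem ∧ s'.realMem = s.realMem
  | reg r, h, d, n, s, hd => by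
    simp only [ok, decide_eq_true_eq] at h
    refine ⟨_, (Exec.instr _ _ _).seq (Exec.instr _ _ _), ?_, ?_, rfl, rfl, rfl⟩
    · have : r ≠ d := by omega
      simp [Instr.exec, Store.setWord, eval, WordOp.eval, this]
    · intro x hx
      have : x ≠ d := by omega
      simp [Instr.exec, Store.setWord, this]
  | const k, h, d, n, s, hd => by
    refine ⟨_, Exec.instr _ _ _, ?_, ?_, rfl, rfl, rfl⟩
    · simp [Instr.exec, Store.setWord, eval]
    · intro x hx
      have : x ≠ d := by omega
      simp [Instr.exec, Store.setWord, this]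
  | op o a b, h, d, n, s, hd => by
    simp only [ok, Bool.and_eq_true] at h
    obtain ⟨s₁, e₁, v₁, r₁, x₁, m₁, y₁⟩ := exec_compile (W := W) (u := u) h.1 d (n + 1) s hd
    obtain ⟨s₂, e₂, v₂, r₂, x₂, m₂, y₂⟩ :=
      exec_compile (W := W) (u := u) h.2 (d + 1) (n + 1 + a.cost + 1) s₁ (by omega)
    have e := e₁.seq (e₂.seq (Exec.instr (.word o d d (d + 1)) _ _))
    rw [show n + 1 + a.cost + 1 + b.cost + 1 = n + (op o a b).cost by simp only [cost]; omega] at e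
    refine ⟨_, e, ?_, ?_, by rw [← x₁, ← x₂]; rfl, by rw [← m₁, ← m₂]; rfl,
      by rw [← y₁, ← y₂]; rfl⟩
    · simp only [Instr.exec, Store.setWord, Function.update_self, eval]
      rw [r₂ d (by omega), v₁, v₂, eval_congr h.2 (fun r hr => r₁ r (by omega)) m₁]
    · intro x hx
      have : x ≠ d := by omega
      simp only [Instr.exec, Store.setWord, Function.update_of_ne this]
      rw [r₂ x (by omega), r₁ x hx]
  | load a, h, d, n, s, hd => by
    obtain ⟨s₁, e₁, v₁, r₁, x₁, m₁, y₁⟩ := exec_compile (W := W) (u := u) (e := a) h d (n + 1) s hd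
    have e := e₁.seq (Exec.instr (.load d d) _ _)
    rw [show n + 1 + a.cost + 1 = n + (load a).cost by simp only [cost]; omega] at e
    refine ⟨_, e, ?_, ?_, by rw [← x₁]; rfl, by rw [← m₁]; rfl, by rw [← y₁]; rfl⟩
    · simp only [Instr.exec, Store.setWord, Function.update_self, eval]
      rw [v₁, m₁]
    · intro x hx
      have : x ≠ d := by omega
      simp only [Instr.exec, Store.setWord, Function.update_of_ne this]
      rw [r₁ x hx]

end WExp

/-- Expressions for reals. -/
inductive RExp
  | reg (r : ℕ)
  | cast (e : WExp)
  | op (o : RealOp) (a b : RExp)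
  | app (f : RealFun) (a : RExp)
  | load (e : WExp)

namespace RExp

def ok : RExp → Bool
  | reg r => r < 20
  | cast e => e.ok
  | op _ a b => a.ok && b.ok
  | app _ a => a.ok
  | load e => e.ok

/-- The value of an expression. -/
def eval (W : ℕ) (s : Store) : RExp → ℝ
  | reg r => s.realReg r
  | cast e => (e.eval W s : ℝ)
  | op o a b => o.eval (a.eval W s) (b.eval W s)
  | app f a => f.eval (a.eval W s)
  | load e => s.realMem (e.eval W s)

/-- A program that stores the value of an expression in the real register `d`, using the word
registers from `w` onwards and the real registers from `d` onwards. -/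
def compile (w : ℕ) : RExp → ℕ → Prog
  | reg r, d => .seq (.instr (.const w 0)) (.seq (.instr (.cast d w)) (.instr (.real .add d d r)))
  | cast e, d => .seq (e.compile w) (.instr (.cast d w))
  | op o a b, d => .seq (a.compile w d) (.seq (b.compile w (d + 1)) (.instr (.real o d d (d + 1))))
  | app f a, d => .seq (a.compile w d) (.instr (.realFun f d d))
  | load e, d => .seq (e.compile w) (.instr (.loadReal d w))

def cost : RExp → ℕ
  | reg _ => 5
  | cast e => e.cost + 2
  | op _ a b => a.cost + b.cost + 3
  | app _ a => a.cost + 2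
  | load e => e.cost + 2

theorem eval_congr {W : ℕ} {s t : Store} : ∀ {e : RExp}, e.ok = true →
    (∀ r < 20, t.wordReg r = s.wordReg r) → (∀ r < 20, t.realReg r = s.realReg r) →
    t.wordMem = s.wordMem → t.realMem = s.realMem → e.eval W t = e.eval W s
  | reg r, h, _, h1, _, _ => by simp only [ok, decide_eq_true_eq] at h; simp only [eval, h1 r h]
  | cast e, h, h1, _, h3, _ => by simp only [eval, WExp.eval_congr (e := e) h h1 h3]
  | op o a b, h, h1, h2, h3, h4 => by
    simp only [ok, Bool.and_eq_true] at h
    simp only [eval, eval_congr h.1 h1 h2 h3 h4, eval_congr h.2 h1 h2 h3 h4]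
  | app f a, h, h1, h2, h3, h4 => by simp only [eval, eval_congr (e := a) h h1 h2 h3 h4]
  | load e, h, h1, _, h3, h4 => by simp only [eval, WExp.eval_congr (e := e) h h1 h3, h4]

theorem exec_compile {W : ℕ} {u : ℕ → unitInterval} {w : ℕ} (hw : 20 ≤ w) : ∀ {e : RExp},
    e.ok = true → ∀ (d n : ℕ) (s : Store), 20 ≤ d →
      ∃ s', Exec W u (e.compile w d) n s (n + e.cost) s' ∧
      s'.realReg d = e.eval W s ∧ (∀ r < d, s'.realReg r = s.realReg r) ∧
      (∀ r < w, s'.wordReg r = s.wordReg r) ∧ s'.wordMem = s.wordMem ∧ s'.realMem = s.realMem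
  | reg r, h, d, n, s, hd => by
    simp only [ok, decide_eq_true_eq] at h
    refine ⟨_, (Exec.instr _ _ _).seq ((Exec.instr _ _ _).seq (Exec.instr _ _ _)),
      ?_, ?_, ?_, rfl, rfl⟩
    · have : r ≠ d := by omega
      simp [Instr.exec, Store.setWord, Store.setReal, eval, RealOp.eval, this]
    · intro x hx
      have : x ≠ d := by omega
      simp [Instr.exec, Store.setWord, Store.setReal, this]
    · intro x hx
      have : x ≠ w := by omega
      simp [Instr.exec, Store.setWord, Store.setReal, this]
  | cast e, h, d, n, s, hd => by
    obtain ⟨s₁, e₁, v₁, r₁, x₁, m₁, y₁⟩ := WExp.exec_compile (W := W) (u := u) (e := e) h w (n + 1) s hw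
    have e' := e₁.seq (Exec.instr (.cast d w) _ _)
    rw [show n + 1 + e.cost + 1 = n + (cast e).cost by simp only [cost]; omega] at e'
    refine ⟨_, e', ?_, ?_, r₁, by rw [← m₁]; rfl, by rw [← y₁]; rfl⟩
    · simp only [Instr.exec, Store.setReal, Function.update_self, eval]
      rw [v₁]
    · intro x hx
      have : x ≠ d := by omega
      simp only [Instr.exec, Store.setReal, Function.update_of_ne this, x₁]
  | op o a b, h, d, n, s, hd => by
    simp only [ok, Bool.and_eq_true] at h
    obtain ⟨s₁, e₁, v₁, r₁, x₁, m₁, y₁⟩ := exec_compile (W := W) (u := u) hw h.1 d (n + 1) s hd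
    obtain ⟨s₂, e₂, v₂, r₂, x₂, m₂, y₂⟩ :=
      exec_compile (W := W) (u := u) hw h.2 (d + 1) (n + 1 + a.cost + 1) s₁ (by omega)
    have e := e₁.seq (e₂.seq (Exec.instr (.real o d d (d + 1)) _ _))
    rw [show n + 1 + a.cost + 1 + b.cost + 1 = n + (op o a b).cost by simp only [cost]; omega] at e
    refine ⟨_, e, ?_, ?_, fun r hr => by rw [← x₁ r hr, ← x₂ r hr]; rfl, by rw [← m₁, ← m₂]; rfl,
      by rw [← y₁, ← y₂]; rfl⟩
    · simp only [Instr.exec, Store.setReal, Function.update_self, eval]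
      rw [r₂ d (by omega), v₁, v₂, eval_congr h.2 (fun r hr => x₁ r (by omega))
        (fun r hr => r₁ r (by omega)) m₁ y₁]
    · intro x hx
      have : x ≠ d := by omega
      simp only [Instr.exec, Store.setReal, Function.update_of_ne this]
      rw [r₂ x (by omega), r₁ x hx]
  | app f a, h, d, n, s, hd => by
    obtain ⟨s₁, e₁, v₁, r₁, x₁, m₁, y₁⟩ := exec_compile (W := W) (u := u) (e := a) hw h d (n + 1) s hd
    have e := e₁.seq (Exec.instr (.realFun f d d) _ _)
    rw [show n + 1 + a.cost + 1 = n + (app f a).cost by simp only [cost]; omega] at e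
    refine ⟨_, e, ?_, ?_, fun r hr => by rw [← x₁ r hr]; rfl, by rw [← m₁]; rfl,
      by rw [← y₁]; rfl⟩
    · simp only [Instr.exec, Store.setReal, Function.update_self, eval]
      rw [v₁]
    · intro x hx
      have : x ≠ d := by omega
      simp only [Instr.exec, Store.setReal, Function.update_of_ne this]
      rw [r₁ x hx]
  | load e, h, d, n, s, hd => by
    obtain ⟨s₁, e₁, v₁, r₁, x₁, m₁, y₁⟩ := WExp.exec_compile (W := W) (u := u) (e := e) h w (n + 1) s hw
    have e' := e₁.seq (Exec.instr (.loadReal d w) _ _)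
    rw [show n + 1 + e.cost + 1 = n + (load e).cost by simp only [cost]; omega] at e'
    refine ⟨_, e', ?_, ?_, r₁, by rw [← m₁]; rfl, by rw [← y₁]; rfl⟩
    · simp only [Instr.exec, Store.setReal, Function.update_self, eval]
      rw [v₁, y₁]
    · intro x hx
      have : x ≠ d := by omega
      simp only [Instr.exec, Store.setReal, Function.update_of_ne this, x₁]

end RExp

/-! ## Assignments -/

/-- There is no move instruction; the value is copied by adding a scratch register that holds zero.
-/
def setW (r : ℕ) (e : WExp) : Prog :=
  .seq (e.compile 20) (.seq (.instr (.const 21 0)) (.instr (.word .add r 20 21)))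

def setR (r : ℕ) (e : RExp) : Prog :=
  .seq (e.compile 20 20)
    (.seq (.instr (.const 20 0)) (.seq (.instr (.cast 21 20)) (.instr (.real .add r 20 21))))

def stW (a e : WExp) : Prog :=
  .seq (a.compile 20) (.seq (e.compile 21) (.instr (.store 20 21)))

def stR (a : WExp) (e : RExp) : Prog :=
  .seq (a.compile 20) (.seq (e.compile 21 20) (.instr (.storeReal 20 20)))

/-- The effect of writing a word to the memory. -/
def Store.putWord (s : Store) (a v : ℕ) : Store :=
  { s with wordMem := Function.update s.wordMem a v }

/-- The effect of writing a real number to the memory. -/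
def Store.putReal (s : Store) (a : ℕ) (v : ℝ) : Store :=
  { s with realMem := Function.update s.realMem a v }

section Assign

variable {W : ℕ} {u : ℕ → unitInterval} {n : ℕ} {s : Store}

/-- `v < W` is needed because the final copy reduces modulo `W`, whereas a loaded memory cell is not
reduced. -/
theorem execS_setW {r v : ℕ} {e : WExp} (hv : e.eval W s = v) (hW : v < W)
    (hok : e.ok = true := by rfl) (hr : r < 20 := by norm_num) :
    ExecS W u (setW r e) n s (n + (e.cost + 4)) (s.setWord r v) := fun t ht => by
  obtain ⟨s₁, e₁, v₁, r₁, x₁, m₁, y₁⟩ := WExp.exec_compile (W := W) (u := u) hok 20 (n + 1) t le_rfl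
  have e' := e₁.seq ((Exec.instr (.const 21 0) _ _).seq (Exec.instr (.word .add r 20 21) _ _))
  rw [show n + 1 + e.cost + 1 + 1 + 1 = n + (e.cost + 4) by omega] at e'
  refine ⟨_, ⟨?_, ?_, ?_, ?_⟩, e'⟩
  · intro x hx
    by_cases hxr : x = r
    · subst hxr
      simp [Instr.exec, Store.setWord, WordOp.eval, v₁,
        WExp.eval_congr hok ht.wordReg ht.wordMem, hv, Nat.mod_eq_of_lt hW]
    · have : x ≠ 21 := by omega
      simp only [Instr.exec, Store.setWord, Function.update_of_ne hxr, Function.update_of_ne this]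
      rw [r₁ x hx, ht.wordReg x hx]
  · intro x hx
    simp only [Instr.exec, Store.setWord, x₁, ht.realReg x hx]
  · simp only [Instr.exec, Store.setWord, m₁, ht.wordMem]
  · simp only [Instr.exec, Store.setWord, y₁, ht.realMem]

theorem execS_setR {r : ℕ} {v : ℝ} {e : RExp} (hv : e.eval W s = v)
    (hok : e.ok = true := by rfl) (hr : r < 20 := by norm_num) :
    ExecS W u (setR r e) n s (n + (e.cost + 6)) (s.setReal r v) := fun t ht => by
  obtain ⟨s₁, e₁, v₁, r₁, x₁, m₁, y₁⟩ :=
    RExp.exec_compile (W := W) (u := u) (w := 20) le_rfl hok 20 (n + 1) t le_rfl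
  have e' := e₁.seq ((Exec.instr (.const 20 0) _ _).seq ((Exec.instr (.cast 21 20) _ _).seq
    (Exec.instr (.real .add r 20 21) _ _)))
  rw [show n + 1 + e.cost + 1 + 1 + 1 + 1 + 1 = n + (e.cost + 6) by omega] at e'
  refine ⟨_, ⟨?_, ?_, ?_, ?_⟩, e'⟩
  · intro x hx
    have : x ≠ 20 := by omega
    simp only [Instr.exec, Store.setWord, Store.setReal, Function.update_of_ne this]
    rw [x₁ x hx, ht.wordReg x hx]
  · intro x hx
    by_cases hxr : x = r
    · subst hxr
      simp [Instr.exec, Store.setWord, Store.setReal, RealOp.eval, v₁,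
        RExp.eval_congr hok ht.wordReg ht.realReg ht.wordMem ht.realMem, hv]
    · have : x ≠ 21 := by omega
      simp only [Instr.exec, Store.setWord, Store.setReal, Function.update_of_ne hxr,
        Function.update_of_ne this]
      rw [r₁ x hx, ht.realReg x hx]
  · simp only [Instr.exec, Store.setWord, Store.setReal, m₁, ht.wordMem]
  · simp only [Instr.exec, Store.setWord, Store.setReal, y₁, ht.realMem]

theorem execS_stW {a v : ℕ} {ea e : WExp} (ha : ea.eval W s = a) (hv : e.eval W s = v)
    (hoka : ea.ok = true := by rfl) (hok : e.ok = true := by rfl) :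
    ExecS W u (stW ea e) n s (n + (ea.cost + e.cost + 3)) (s.putWord a v) := fun t ht => by
  obtain ⟨s₁, e₁, v₁, r₁, x₁, m₁, y₁⟩ := WExp.exec_compile (W := W) (u := u) hoka 20 (n + 1) t le_rfl
  obtain ⟨s₂, e₂, v₂, r₂, x₂, m₂, y₂⟩ := WExp.exec_compile (W := W) (u := u) hok 21
    (n + 1 + ea.cost + 1) s₁ (by omega)
  have e' := e₁.seq (e₂.seq (Exec.instr (.store 20 21) _ _))
  rw [show n + 1 + ea.cost + 1 + e.cost + 1 = n + (ea.cost + e.cost + 3) by omega] at e'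
  refine ⟨_, ⟨?_, ?_, ?_, ?_⟩, e'⟩
  · intro x hx
    simp only [Instr.exec, Store.putWord]
    rw [r₂ x (by omega), r₁ x hx, ht.wordReg x hx]
  · intro x hx
    simp only [Instr.exec, Store.putWord, x₂, x₁, ht.realReg x hx]
  · simp only [Instr.exec, Store.putWord, m₂, m₁, ht.wordMem, v₂, r₂ 20 (by omega), v₁]
    rw [WExp.eval_congr hok r₁ m₁, WExp.eval_congr hoka ht.wordReg ht.wordMem,
      WExp.eval_congr hok ht.wordReg ht.wordMem, ha, hv]
  · simp only [Instr.exec, Store.putWord, y₂, y₁, ht.realMem]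

theorem execS_stR {a : ℕ} {v : ℝ} {ea : WExp} {e : RExp} (ha : ea.eval W s = a)
    (hv : e.eval W s = v) (hoka : ea.ok = true := by rfl) (hok : e.ok = true := by rfl) :
    ExecS W u (stR ea e) n s (n + (ea.cost + e.cost + 3)) (s.putReal a v) := fun t ht => by
  obtain ⟨s₁, e₁, v₁, r₁, x₁, m₁, y₁⟩ := WExp.exec_compile (W := W) (u := u) hoka 20 (n + 1) t le_rfl
  obtain ⟨s₂, e₂, v₂, r₂, x₂, m₂, y₂⟩ := RExp.exec_compile (W := W) (u := u) (w := 21) (by omega) hok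
    20 (n + 1 + ea.cost + 1) s₁ (by omega)
  have e' := e₁.seq (e₂.seq (Exec.instr (.storeReal 20 20) _ _))
  rw [show n + 1 + ea.cost + 1 + e.cost + 1 = n + (ea.cost + e.cost + 3) by omega] at e'
  refine ⟨_, ⟨?_, ?_, ?_, ?_⟩, e'⟩
  · intro x hx
    simp only [Instr.exec, Store.putReal]
    rw [x₂ x (by omega), r₁ x hx, ht.wordReg x hx]
  · intro x hx
    simp only [Instr.exec, Store.putReal]
    rw [r₂ x (by omega), x₁, ht.realReg x hx]
  · simp only [Instr.exec, Store.putReal, m₂, m₁, ht.wordMem]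
  · simp only [Instr.exec, Store.putReal, y₂, y₁, ht.realMem, v₂, x₂ 20 (by omega), v₁]
    rw [RExp.eval_congr hok r₁ (fun r _ => by rw [x₁]) m₁ y₁,
      WExp.eval_congr hoka ht.wordReg ht.wordMem,
      RExp.eval_congr hok ht.wordReg ht.realReg ht.wordMem ht.realMem, ha, hv]

theorem execS_randReal {r : ℕ} :
    ExecS W u (.instr (.randReal r)) n s (n + 1) (s.setReal r (u n)) := fun t ht => by
  refine ⟨_, ?_, Exec.instr _ _ _⟩
  refine ⟨ht.wordReg, ?_, ht.wordMem, ht.realMem⟩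
  intro x hx
  by_cases hxr : x = r
  · subst hxr; simp [Instr.exec, Store.setReal]
  · simp only [Instr.exec, Store.setReal, Function.update_of_ne hxr, ht.realReg x hx]

/-- The value of the instruction `randWord` for the bound `k` and the uniform number `x`. -/
def randIndex (x : unitInterval) (k : ℕ) : ℕ := min ⌊(x : ℝ) * (k : ℝ)⌋₊ (k - 1)

theorem execS_randWord {r a : ℕ} (ha : a < 20 := by norm_num) :
    ExecS W u (.instr (.randWord r a)) n s (n + 1)
      (s.setWord r (randIndex (u n) (s.wordReg a))) := fun t ht => by
  refine ⟨_, ?_, Exec.instr _ _ _⟩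
  refine ⟨?_, ht.realReg, ht.wordMem, ht.realMem⟩
  intro x hx
  by_cases hxr : x = r
  · subst hxr; simp [Instr.exec, Store.setWord, randIndex, ht.wordReg a ha]
  · simp only [Instr.exec, Store.setWord, Function.update_of_ne hxr, ht.wordReg x hx]

end Assign

/-! ## Deterministic program parts -/

/-- The program takes the store `s` to the store `s'` in a time that is at most `k` and does not depend
on the random numbers. -/
def ExecD (W : ℕ) (p : Prog) (s : Store) (k : ℕ) (s' : Store) : Prop :=
  ∃ d ≤ k, ∀ u n, ExecS W u p n s (n + d) s'

def nop : Prog := .instr (.const 20 0)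

/-- Sequential composition. -/
def block : List Prog → Prog
  | [] => nop
  | p :: l => .seq p (block l)

section ExecD

variable {W k k₁ k₂ : ℕ} {s s₁ s' : Store} {p q : Prog} {b : Test}

theorem ExecD.mono (h : ExecD W p s k₁ s') (hk : k₁ ≤ k) : ExecD W p s k s' := by
  obtain ⟨d, hd, h⟩ := h
  exact ⟨d, hd.trans hk, h⟩

theorem ExecD.seq (h₁ : ExecD W p s k₁ s₁) (h₂ : ExecD W q s₁ k₂ s') :
    ExecD W (.seq p q) s (k₁ + k₂ + 1) s' := by
  obtain ⟨d₁, hd₁, h₁⟩ := h₁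
  obtain ⟨d₂, hd₂, h₂⟩ := h₂
  refine ⟨1 + d₁ + d₂, by omega, fun u n => ?_⟩
  have := (h₁ u (n + 1)).seq (h₂ u _)
  rwa [show n + 1 + d₁ + d₂ = n + (1 + d₁ + d₂) by omega] at this

theorem ExecD.cons {l : List Prog} (h₁ : ExecD W p s k₁ s₁) (h₂ : ExecD W (block l) s₁ k₂ s') :
    ExecD W (block (p :: l)) s (k₁ + k₂ + 1) s' := h₁.seq h₂

theorem ExecD.ite_true (hb : b.Holds s) (h : ExecD W p s k s') (hok : b.ok = true := by rfl) :
    ExecD W (.ite b p q) s (k + 1) s' := by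
  obtain ⟨d, hd, h⟩ := h
  refine ⟨1 + d, by omega, fun u n => ?_⟩
  have := ExecS.ite_true (q := q) hb (h u (n + 1)) hok
  rwa [show n + 1 + d = n + (1 + d) by omega] at this

theorem ExecD.ite_false (hb : ¬ b.Holds s) (h : ExecD W q s k s') (hok : b.ok = true := by rfl) :
    ExecD W (.ite b p q) s (k + 1) s' := by
  obtain ⟨d, hd, h⟩ := h
  refine ⟨1 + d, by omega, fun u n => ?_⟩
  have := ExecS.ite_false (p := p) hb (h u (n + 1)) hok
  rwa [show n + 1 + d = n + (1 + d) by omega] at this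

theorem ExecD.loop_true (hb : b.Holds s) (h₁ : ExecD W p s k₁ s₁)
    (h₂ : ExecD W (.loop b p) s₁ k₂ s') (hok : b.ok = true := by rfl) :
    ExecD W (.loop b p) s (k₁ + k₂ + 1) s' := by
  obtain ⟨d₁, hd₁, h₁⟩ := h₁
  obtain ⟨d₂, hd₂, h₂⟩ := h₂
  refine ⟨1 + d₁ + d₂, by omega, fun u n => ?_⟩
  have := ExecS.loop_true hb (h₁ u (n + 1)) (h₂ u _) hok
  rwa [show n + 1 + d₁ + d₂ = n + (1 + d₁ + d₂) by omega] at this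

theorem ExecD.loop_false (hb : ¬ b.Holds s) (hok : b.ok = true := by rfl) :
    ExecD W (.loop b p) s 1 s :=
  ⟨1, le_rfl, fun _ _ => ExecS.loop_false hb hok⟩

theorem execD_nop : ExecD W nop s 1 s := by
  refine ⟨1, le_rfl, fun u n t ht => ⟨_, ?_, Exec.instr _ _ _⟩⟩
  refine ⟨fun r hr => ?_, ht.realReg, ht.wordMem, ht.realMem⟩
  have : r ≠ 20 := by omega
  simp [Instr.exec, Store.setWord, this, ht.wordReg r hr]

theorem execD_nil : ExecD W (block []) s 1 s := execD_nop

theorem execD_setW {r v : ℕ} {e : WExp} (hv : e.eval W s = v) (hW : v < W)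
    (hok : e.ok = true := by rfl) (hr : r < 20 := by norm_num) :
    ExecD W (setW r e) s (e.cost + 4) (s.setWord r v) :=
  ⟨_, le_rfl, fun _ _ => execS_setW hv hW hok hr⟩

theorem execD_setR {r : ℕ} {v : ℝ} {e : RExp} (hv : e.eval W s = v)
    (hok : e.ok = true := by rfl) (hr : r < 20 := by norm_num) :
    ExecD W (setR r e) s (e.cost + 6) (s.setReal r v) :=
  ⟨_, le_rfl, fun _ _ => execS_setR hv hok hr⟩

theorem execD_stW {a v : ℕ} {ea e : WExp} (ha : ea.eval W s = a) (hv : e.eval W s = v)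
    (hoka : ea.ok = true := by rfl) (hok : e.ok = true := by rfl) :
    ExecD W (stW ea e) s (ea.cost + e.cost + 3) (s.putWord a v) :=
  ⟨_, le_rfl, fun _ _ => execS_stW ha hv hoka hok⟩

theorem execD_stR {a : ℕ} {v : ℝ} {ea : WExp} {e : RExp} (ha : ea.eval W s = a)
    (hv : e.eval W s = v) (hoka : ea.ok = true := by rfl) (hok : e.ok = true := by rfl) :
    ExecD W (stR ea e) s (ea.cost + e.cost + 3) (s.putReal a v) :=
  ⟨_, le_rfl, fun _ _ => execS_stR ha hv hoka hok⟩

end ExecD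

/-! ## Tournament trees -/

/-- The winner at node `q` of level `l` of the tournament tree with leaves `lf`; the labels are
compared by their keys `X`. -/
def best (X : ℕ → ℝ) (lf : ℕ → ℕ) : ℕ → ℕ → ℕ
  | 0, q => lf q
  | l + 1, q =>
    if X (best X lf l (2 * q)) < X (best X lf l (2 * q + 1)) then best X lf l (2 * q + 1)
    else best X lf l (2 * q)

section Best

variable {X X' : ℕ → ℝ} {lf : ℕ → ℕ}

/-- Only the keys of labels that occur at leaves matter. Hence the key of an item that is in no tree
can be written without invalidating any tree. -/
theorem best_congr (h : ∀ s, X' (lf s) = X (lf s)) : ∀ l q,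
    best X' lf l q = best X lf l q ∧ ∃ s, best X lf l q = lf s
  | 0, q => ⟨rfl, q, rfl⟩
  | l + 1, q => by
    obtain ⟨h1, s1, e1⟩ := best_congr h l (2 * q)
    obtain ⟨h2, s2, e2⟩ := best_congr h l (2 * q + 1)
    constructor
    · simp only [best, h1, h2, e1, e2, h]
    · simp only [best]
      split_ifs
      exacts [⟨s2, e2⟩, ⟨s1, e1⟩]

theorem exists_best_eq (l q : ℕ) : ∃ s, best X lf l q = lf s :=
  (best_congr (fun _ => rfl) l q).2

/-- This is why nodes that were never written are already correct in zeroed memory. -/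
theorem best_eq_zero : ∀ {l q : ℕ}, (∀ s, q * 2 ^ l ≤ s → lf s = 0) → best X lf l q = 0
  | 0, q, h => h q (by simp)
  | l + 1, q, h => by
    have h1 : best X lf l (2 * q) = 0 := best_eq_zero fun s hs => h s (by rw [pow_succ]; linarith)
    have h2 : best X lf l (2 * q + 1) = 0 := best_eq_zero fun s hs => h s (by
      rw [pow_succ]; nlinarith [Nat.zero_le (2 ^ l)])
    simp [best, h1, h2]

/-- The condition `s / 2 ^ l = q` says that leaf `s` lies below the node; each level of the tree
halves the index. -/
theorem key_le_key_best : ∀ {l q s : ℕ}, s / 2 ^ l = q → X (lf s) ≤ X (best X lf l q)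
  | 0, q, s, h => by simp at h; simp [best, h]
  | l + 1, q, s, h => by
    rw [pow_succ, ← Nat.div_div_eq_div_mul] at h
    have h3 : s / 2 ^ l = 2 * q ∨ s / 2 ^ l = 2 * q + 1 := by omega
    simp only [best]
    rcases h3 with h3 | h3
    · have := key_le_key_best h3
      split_ifs with hc <;> linarith
    · have := key_le_key_best h3
      split_ifs with hc <;> linarith

/-- A leaf is visible only from its ancestors `sl / 2 ^ l`, so an update has to rewrite a single
path. -/
theorem best_update_of_ne {sl v : ℕ} : ∀ {l q : ℕ}, q ≠ sl / 2 ^ l →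
    best X (Function.update lf sl v) l q = best X lf l q
  | 0, q, h => by simp at h; simp [best, Function.update_of_ne h]
  | l + 1, q, h => by
    rw [pow_succ, ← Nat.div_div_eq_div_mul] at h
    have h1 : 2 * q ≠ sl / 2 ^ l := by omega
    have h2 : 2 * q + 1 ≠ sl / 2 ^ l := by omega
    simp only [best, best_update_of_ne h1, best_update_of_ne h2]

end Best

/-- Halving drops one binary digit. The update loop halves the index of the last slot until it is
zero, so the number of its rounds is the height of the tree. -/
theorem size_div_two {w : ℕ} (hw : 0 < w) : Nat.size (w / 2) + 1 = Nat.size w := by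
  have h1 : w < 2 ^ Nat.size w := Nat.lt_size_self w
  have h3 : 0 < Nat.size w := Nat.size_pos.2 hw
  apply le_antisymm
  · have : Nat.size (w / 2) ≤ Nat.size w - 1 := by
      rw [Nat.size_le]
      obtain ⟨k, hk⟩ := Nat.exists_eq_add_of_lt h3
      rw [hk] at h1 ⊢
      simp only [zero_add, Nat.add_sub_cancel, pow_succ] at h1 ⊢
      omega
    omega
  · rw [Nat.size_le, pow_succ]
    have := Nat.lt_size_self (w / 2)
    omega

/-! ## Programs -/

section StoreSimp

variable (s : Store) (d a v r : ℕ) (x : ℝ)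

@[simp] theorem setWord_wordReg :
    (s.setWord d v).wordReg r = if r = d then v else s.wordReg r := by
  simp [Store.setWord, Function.update_apply]
@[simp] theorem setWord_realReg : (s.setWord d v).realReg = s.realReg := rfl
@[simp] theorem setWord_wordMem : (s.setWord d v).wordMem = s.wordMem := rfl
@[simp] theorem setWord_realMem : (s.setWord d v).realMem = s.realMem := rfl
@[simp] theorem setReal_wordReg : (s.setReal d x).wordReg = s.wordReg := rfl
@[simp] theorem setReal_realReg :
    (s.setReal d x).realReg r = if r = d then x else s.realReg r := by
  simp [Store.setReal, Function.update_apply]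
@[simp] theorem setReal_wordMem : (s.setReal d x).wordMem = s.wordMem := rfl
@[simp] theorem setReal_realMem : (s.setReal d x).realMem = s.realMem := rfl
@[simp] theorem putWord_wordReg : (s.putWord a v).wordReg = s.wordReg := rfl
@[simp] theorem putWord_realReg : (s.putWord a v).realReg = s.realReg := rfl
@[simp] theorem putWord_wordMem :
    (s.putWord a v).wordMem = Function.update s.wordMem a v := rfl
@[simp] theorem putWord_realMem : (s.putWord a v).realMem = s.realMem := rfl
@[simp] theorem putReal_wordReg : (s.putReal a x).wordReg = s.wordReg := rfl
@[simp] theorem putReal_realReg : (s.putReal a x).realReg = s.realReg := rfl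
@[simp] theorem putReal_wordMem : (s.putReal a x).wordMem = s.wordMem := rfl
@[simp] theorem putReal_realMem :
    (s.putReal a x).realMem = Function.update s.realMem a x := rfl

end StoreSimp

/-! ### Values of word expressions and the layout of the memory -/

namespace WExp

abbrev add (a b : WExp) : WExp := .op .add a b
abbrev sub (a b : WExp) : WExp := .op .sub a b
abbrev mul (a b : WExp) : WExp := .op .mul a b
abbrev div (a b : WExp) : WExp := .op .div a b
abbrev mod (a b : WExp) : WExp := .op .mod a b

section Eval

variable {W : ℕ} {s : Store} {a b : WExp} {x y v r : ℕ}

theorem eval_reg (h : s.wordReg r = v) (hv : v < W) : (reg r).eval W s = v := by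
  rw [eval, h, Nat.mod_eq_of_lt hv]
theorem eval_const (h : v < W) : (const v).eval W s = v := by rw [eval, Nat.mod_eq_of_lt h]
theorem eval_add (ha : a.eval W s = x) (hb : b.eval W s = y) (h : x + y < W) :
    (add a b).eval W s = x + y := by rw [eval, ha, hb, WordOp.eval, Nat.mod_eq_of_lt h]
theorem eval_sub (ha : a.eval W s = x) (hb : b.eval W s = y) (h : x < W) :
    (sub a b).eval W s = x - y := by
  rw [eval, ha, hb, WordOp.eval, Nat.mod_eq_of_lt (by omega)]
theorem eval_mul (ha : a.eval W s = x) (hb : b.eval W s = y) (h : x * y < W) :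
    (mul a b).eval W s = x * y := by rw [eval, ha, hb, WordOp.eval, Nat.mod_eq_of_lt h]
theorem eval_div (ha : a.eval W s = x) (hb : b.eval W s = y) (h : x < W) :
    (div a b).eval W s = x / y := by
  rw [eval, ha, hb, WordOp.eval, Nat.mod_eq_of_lt (lt_of_le_of_lt (Nat.div_le_self _ _) h)]
theorem eval_mod (ha : a.eval W s = x) (hb : b.eval W s = y) (h : x < W) :
    (mod a b).eval W s = x % y := by
  rw [eval, ha, hb, WordOp.eval, Nat.mod_eq_of_lt (lt_of_le_of_lt (Nat.mod_le _ _) h)]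
theorem eval_load (ha : a.eval W s = x) (h : s.wordMem x = v) : (load a).eval W s = v := by
  rw [eval, ha, h]

end Eval

/-- The address of node `q` of level `l` of the tree of bucket `b` (register 5 holds `K`). -/
def node (b l q : WExp) : WExp :=
  mul (const 8) (add (mul (add (mul b (reg 5)) l) (reg 5)) q)

/-- The address of entry `x` of the array number `t`. -/
def entry (t : ℕ) (x : WExp) : WExp := add (mul (const 8) x) (const t)

end WExp

/-- Word addresses divisible by 8 hold the tree nodes, in mixed radix with base `K`. The other
residues hold arrays: 1 and 2 the permutation of the items and its inverse, 3 the slot of an item, 4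
the number of slots used in a bucket, 5 the label at the root of a bucket. -/
def nodeAddr (K b l q : ℕ) : ℕ := 8 * ((b * K + l) * K + q)

theorem nodeAddr_inj {K b l q b' l' q' : ℕ} (hl : l < K) (hq : q < K) (hl' : l' < K) (hq' : q' < K)
    (h : nodeAddr K b l q = nodeAddr K b' l' q') : b = b' ∧ l = l' ∧ q = q' := by
  have h1 : (b * K + l) * K + q = (b' * K + l') * K + q' := by unfold nodeAddr at h; omega
  have hK : 0 < K := by omega
  have key : ∀ {x y x' y' : ℕ}, y < K → y' < K → x * K + y = x' * K + y' → x = x' ∧ y = y' := by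
    intro x y x' y' hy hy' e
    have h2 : (x * K + y) / K = (x' * K + y') / K := by rw [e]
    have h3 : (x * K + y) % K = (x' * K + y') % K := by rw [e]
    rw [mul_comm x, mul_comm x', Nat.mul_add_div hK, Nat.mul_add_div hK, Nat.div_eq_of_lt hy,
      Nat.div_eq_of_lt hy'] at h2
    rw [mul_comm x, mul_comm x', Nat.mul_add_mod, Nat.mul_add_mod, Nat.mod_eq_of_lt hy,
      Nat.mod_eq_of_lt hy'] at h3
    exact ⟨by omega, h3⟩
  obtain ⟨h2, h3⟩ := key hq hq' h1
  obtain ⟨h4, h5⟩ := key hl hl' h2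
  exact ⟨h4, h5, h3⟩

theorem nodeAddr_ne_entry {K b l q x t : ℕ} (ht : 0 < t) (ht' : t < 8) :
    nodeAddr K b l q ≠ 8 * x + t := by unfold nodeAddr; omega

/-- The word bound is large enough for the addresses. -/
structure Big (m K W : ℕ) : Prop where
  hK : K = m + 2
  hm : 1 ≤ m
  hW : 8 * (K * K * K) + 8 ≤ W

theorem Big.lt {m K W v : ℕ} (h : Big m K W) (hv : v < 8 * K + 8) : v < W := by
  have := h.hW
  have h3 : 1 ≤ K := by rw [h.hK]; omega
  nlinarith [Nat.mul_le_mul h3 h3, Nat.mul_le_mul (Nat.mul_le_mul h3 h3) (le_refl K)]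

theorem Big.eval_node {m K W : ℕ} (h : Big m K W) {s : Store} {eb el eq : WExp} {b l q : ℕ}
    (h5 : s.wordReg 5 = K) (hb : eb.eval W s = b) (hl : el.eval W s = l) (hq : eq.eval W s = q)
    (hbK : b < K) (hlK : l < K) (hqK : q < K) :
    (WExp.node eb el eq).eval W s = nodeAddr K b l q := by
  have hW := h.hW
  have h1 : b * K + l < K * K := by nlinarith
  have h2 : (b * K + l) * K + q < K * K * K := by nlinarith
  have h3 : K * K ≤ K * K * K := by nlinarith
  have h5' : (WExp.reg 5).eval W s = K := WExp.eval_reg h5 (h.lt (by omega))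
  refine WExp.eval_mul (WExp.eval_const (by omega)) (WExp.eval_add (WExp.eval_mul (WExp.eval_add
    (WExp.eval_mul hb h5' ?_) hl ?_) h5' ?_) hq ?_) ?_ <;> omega

theorem Big.eval_entry {m K W : ℕ} (h : Big m K W) {s : Store} {t : ℕ} {e : WExp} {x : ℕ}
    (hx : e.eval W s = x) (hxK : x < K) (ht : t < 8) :
    (WExp.entry t e).eval W s = 8 * x + t :=
  WExp.eval_add (WExp.eval_mul (WExp.eval_const (h.lt (by omega))) hx (h.lt (by omega)))
    (WExp.eval_const (h.lt (by omega))) (h.lt (by omega))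

/-! ### Updating one path of a tournament tree -/

open WExp in
/-- One step of `fixTree`. -/
def fixBody : Prog :=
  block [
    setW 12 (div (reg 12) (const 2)),
    setW 14 (div (reg 14) (const 2)),
    setW 15 (load (node (reg 10) (reg 13) (mul (const 2) (reg 14)))),
    setW 16 (load (node (reg 10) (reg 13) (add (mul (const 2) (reg 14)) (const 1)))),
    setW 13 (add (reg 13) (const 1)),
    setR 6 (RExp.load (reg 15)),
    setR 7 (RExp.load (reg 16)),
    .ite (.realLt 6 7) (setW 15 (reg 16)) nop,
    stW (node (reg 10) (reg 13) (reg 14)) (reg 15)]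

open WExp in
/-- Put the label in register 15 into the leaf number (register 11) of the tree of the bucket
(register 10) and update the tree. -/
def fixTree : Prog :=
  block [
    stW (node (reg 10) (const 0) (reg 11)) (reg 15),
    setW 12 (sub (load (entry 4 (reg 10))) (const 1)),
    setW 13 (const 0),
    setW 14 (reg 11),
    .loop (.wordLt 18 12) fixBody,
    stW (entry 5 (reg 10)) (reg 15)]

/-- The stores agree outside the memory and the registers that `fixTree` uses. -/
structure TreeFrame (s s' : Store) : Prop where
  wordReg : ∀ r, (r < 12 ∨ 17 ≤ r) → s'.wordReg r = s.wordReg r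
  realReg : ∀ r, (r < 6 ∨ 8 ≤ r) → s'.realReg r = s.realReg r
  realMem : s'.realMem = s.realMem

theorem TreeFrame.trans {s s' s'' : Store} (h : TreeFrame s s') (h' : TreeFrame s' s'') :
    TreeFrame s s'' :=
  ⟨fun r hr => (h'.wordReg r hr).trans (h.wordReg r hr),
   fun r hr => (h'.realReg r hr).trans (h.realReg r hr), h'.realMem.trans h.realMem⟩

section Fix

variable {m K W : ℕ}

/-- Of the two children one has just been rewritten and the other is its sibling. Which is which
depends on the parity of `q`, so both are read from the memory. -/
theorem exec_fixBody (hB : Big m K W) {s : Store} {b l q w a c : ℕ}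
    (h5 : s.wordReg 5 = K) (h10 : s.wordReg 10 = b) (h12 : s.wordReg 12 = w)
    (h13 : s.wordReg 13 = l) (h14 : s.wordReg 14 = q)
    (hb : b < K) (hl : l + 1 < K) (hq : 2 * (q / 2) + 1 < K) (hw : w < K)
    (ha : s.wordMem (nodeAddr K b l (2 * (q / 2))) = a)
    (hc : s.wordMem (nodeAddr K b l (2 * (q / 2) + 1)) = c) (haK : a < K) (hcK : c < K) :
    ∃ s', ExecD W fixBody s 200 s' ∧ TreeFrame s s' ∧
      s'.wordReg 12 = w / 2 ∧ s'.wordReg 13 = l + 1 ∧ s'.wordReg 14 = q / 2 ∧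
      s'.wordReg 15 = (if s.realMem a < s.realMem c then c else a) ∧
      s'.wordMem = Function.update s.wordMem (nodeAddr K b (l + 1) (q / 2))
        (if s.realMem a < s.realMem c then c else a) := by
  have hlt : ∀ {v}, v < K → v < W := fun hv => hB.lt (by omega)
  have h2 : 2 < W := hB.lt (by omega)
  set s₁ := s.setWord 12 (w / 2) with hs₁
  set s₂ := s₁.setWord 14 (q / 2) with hs₂
  set s₃ := s₂.setWord 15 a with hs₃
  set s₄ := s₃.setWord 16 c with hs₄
  set s₅ := s₄.setWord 13 (l + 1) with hs₅
  set s₆ := s₅.setReal 6 (s.realMem a) with hs₆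
  set s₇ := s₆.setReal 7 (s.realMem c) with hs₇
  set d := if s.realMem a < s.realMem c then c else a with hd
  set s₈ := if s.realMem a < s.realMem c then s₇.setWord 15 c else s₇ with hs₈
  have f8 : s₈.wordReg 15 = d ∧ (∀ r, r ≠ 15 → s₈.wordReg r = s₇.wordReg r) ∧
      s₈.wordMem = s.wordMem ∧ s₈.realReg = s₇.realReg ∧ s₈.realMem = s.realMem := by
    rw [hs₈, hd]
    split_ifs
    · refine ⟨by simp, fun r hr => by simp [hr], rfl, rfl, rfl⟩
    · refine ⟨by simp [hs₇, hs₆, hs₅, hs₄, hs₃], fun r hr => rfl, rfl, rfl, rfl⟩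
  have hdK : d < K := by rw [hd]; split_ifs <;> assumption
  have e₁ : ExecD W _ s _ s₁ := execD_setW (r := 12)
    (WExp.eval_div (WExp.eval_reg h12 (hlt hw)) (WExp.eval_const h2) (hlt hw)) (hlt (by omega))
  have e₂ : ExecD W _ s₁ _ s₂ := execD_setW (r := 14)
    (WExp.eval_div (WExp.eval_reg (r := 14) (by simp [hs₁, h14]) (hB.lt (by omega)))
      (WExp.eval_const h2) (hB.lt (by omega)))
    (hlt (by omega))
  have hmul : (WExp.mul (.const 2) (.reg 14)).eval W s₂ = 2 * (q / 2) :=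
    WExp.eval_mul (WExp.eval_const h2) (WExp.eval_reg (by simp [hs₂]) (hlt (by omega)))
      (hlt (by omega))
  have hmul' : (WExp.mul (.const 2) (.reg 14)).eval W s₃ = 2 * (q / 2) :=
    WExp.eval_mul (WExp.eval_const h2) (WExp.eval_reg (by simp [hs₃, hs₂]) (hlt (by omega)))
      (hlt (by omega))
  have e₃ : ExecD W _ s₂ _ s₃ := execD_setW (r := 15)
    (WExp.eval_load (hB.eval_node (by simp [hs₂, hs₁, h5])
      (WExp.eval_reg (r := 10) (by simp [hs₂, hs₁, h10]) (hlt hb))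
      (WExp.eval_reg (r := 13) (v := l) (by simp [hs₂, hs₁, h13]) (hlt (by omega)))
      hmul hb (by omega) (by omega)) (by simpa [hs₂, hs₁] using ha)) (hlt haK)
  have e₄ : ExecD W _ s₃ _ s₄ := execD_setW (r := 16)
    (WExp.eval_load (hB.eval_node (by simp [hs₃, hs₂, hs₁, h5])
      (WExp.eval_reg (r := 10) (by simp [hs₃, hs₂, hs₁, h10]) (hlt hb))
      (WExp.eval_reg (r := 13) (v := l) (by simp [hs₃, hs₂, hs₁, h13]) (hlt (by omega)))
      (WExp.eval_add hmul' (WExp.eval_const (hB.lt (by omega))) (hlt hq))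
      hb (by omega) hq) (by simpa [hs₃, hs₂, hs₁] using hc)) (hlt hcK)
  have e₅ : ExecD W _ s₄ _ s₅ := execD_setW (r := 13)
    (WExp.eval_add (WExp.eval_reg (r := 13) (by simp [hs₄, hs₃, hs₂, hs₁, h13]) (hlt (by omega)))
      (WExp.eval_const (hB.lt (by omega))) (hlt hl)) (hlt hl)
  have e₆ : ExecD W (setR 6 (RExp.load (.reg 15))) s₅ _ s₆ := execD_setR (by
    rw [RExp.eval, WExp.eval_reg (v := a) (by simp [hs₅, hs₄, hs₃]) (hlt haK)]; rfl)
  have e₇ : ExecD W (setR 7 (RExp.load (.reg 16))) s₆ _ s₇ := execD_setR (by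
    rw [RExp.eval, WExp.eval_reg (v := c) (by simp [hs₆, hs₅, hs₄]) (hlt hcK)]; rfl)
  have e₈ : ExecD W (.ite (.realLt 6 7) (setW 15 (.reg 16)) nop) s₇ 10 s₈ := by
    by_cases hlt' : s.realMem a < s.realMem c
    · refine (ExecD.ite_true (by simp [Test.Holds, hs₇, hs₆, hlt']) ?_).mono (k₁ := 7 + 1)
        (by norm_num)
      rw [hs₈, if_pos hlt']
      exact execD_setW (WExp.eval_reg (by simp [hs₇, hs₆, hs₅, hs₄]) (hlt hcK)) (hlt hcK)
    · refine (ExecD.ite_false (by simpa [Test.Holds, hs₇, hs₆] using hlt') ?_).mono (k₁ := 1 + 1)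
        (by norm_num)
      rw [hs₈, if_neg hlt']
      exact execD_nop
  have e₉ : ExecD W _ s₈ _ (s₈.putWord (nodeAddr K b (l + 1) (q / 2)) d) :=
    execD_stW (hB.eval_node (eb := .reg 10) (el := .reg 13) (eq := .reg 14)
      (by rw [f8.2.1 _ (by norm_num)]; simp [hs₇, hs₆, hs₅, hs₄, hs₃, hs₂, hs₁, h5])
      (WExp.eval_reg (by rw [f8.2.1 _ (by norm_num)]; simp [hs₇, hs₆, hs₅, hs₄, hs₃, hs₂, hs₁, h10])
        (hlt hb))
      (WExp.eval_reg (by rw [f8.2.1 _ (by norm_num)]; simp [hs₇, hs₆, hs₅]) (hlt hl))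
      (WExp.eval_reg (by rw [f8.2.1 _ (by norm_num)]; simp [hs₇, hs₆, hs₅, hs₄, hs₃, hs₂])
        (hlt (by omega)))
      hb hl (by omega)) (WExp.eval_reg (r := 15) f8.1 (hlt hdK))
  refine ⟨_, (e₁.cons (e₂.cons (e₃.cons (e₄.cons (e₅.cons (e₆.cons (e₇.cons
    (e₈.cons (e₉.cons execD_nil))))))))).mono (by simp [WExp.cost, RExp.cost, WExp.node]),
    ⟨?_, ?_, ?_⟩, ?_, ?_, ?_, ?_, ?_⟩
  · intro r hr
    rw [putWord_wordReg, f8.2.1 _ (by omega)]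
    have : r ≠ 12 ∧ r ≠ 13 ∧ r ≠ 14 ∧ r ≠ 15 ∧ r ≠ 16 := by omega
    simp [hs₇, hs₆, hs₅, hs₄, hs₃, hs₂, hs₁, this]
  · intro r hr
    rw [putWord_realReg, f8.2.2.2.1]
    have : r ≠ 6 ∧ r ≠ 7 := by omega
    simp [hs₇, hs₆, hs₅, hs₄, hs₃, hs₂, hs₁, this]
  · rw [putWord_realMem, f8.2.2.2.2]
  · rw [putWord_wordReg, f8.2.1 _ (by norm_num)]; simp [hs₇, hs₆, hs₅, hs₄, hs₃, hs₂, hs₁]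
  · rw [putWord_wordReg, f8.2.1 _ (by norm_num)]; simp [hs₇, hs₆, hs₅]
  · rw [putWord_wordReg, f8.2.1 _ (by norm_num)]; simp [hs₇, hs₆, hs₅, hs₄, hs₃, hs₂]
  · rw [putWord_wordReg, f8.1]
  · rw [putWord_wordMem, f8.2.2.1]

/-- The tree of bucket `b` in the memory `mem` is the tournament tree with leaves `lf`. -/
structure TreeOK (K : ℕ) (X : ℕ → ℝ) (mem : ℕ → ℕ) (b : ℕ) (lf : ℕ → ℕ) : Prop where
  leaf_zero : ∀ s, mem (8 * b + 4) ≤ s → lf s = 0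
  -- Above the current height only node 0 has used slots below it. It is excluded here and is
  -- written when the height reaches its level.
  node : ∀ l < K, ∀ q < K, l ≤ Nat.size (mem (8 * b + 4) - 1) ∨ 1 ≤ q →
    mem (nodeAddr K b l q) = best X lf l q
  root : mem (8 * b + 5) = best X lf (Nat.size (mem (8 * b + 4) - 1)) 0

/-- Loop invariant: nodes off the path of `sl` are correct for the new leaves throughout, nodes on
the path up to the level in register 13. The height may exceed `h₀` by one, since only children, one
level lower, are read; this covers the insertion that makes the tree grow. -/
theorem exec_fixLoop (hB : Big m K W) {b sl cnt h₀ : ℕ} {X : ℕ → ℝ} {lf : ℕ → ℕ}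
    (hb : b < K) (hsl : sl < cnt) (hcnt : cnt ≤ m) (hlf : ∀ s, lf s < K)
    (hh : Nat.size (cnt - 1) ≤ h₀ + 1) : ∀ (j : ℕ) (s : Store),
    s.wordReg 5 = K → s.wordReg 10 = b → s.wordReg 18 = 0 → s.realMem = X →
    s.wordReg 13 + j = Nat.size (cnt - 1) → s.wordReg 12 = (cnt - 1) / 2 ^ s.wordReg 13 →
    Nat.size (s.wordReg 12) = j →
    s.wordReg 14 = sl / 2 ^ s.wordReg 13 →
    s.wordReg 15 = best X lf (s.wordReg 13) (s.wordReg 14) →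
    (∀ l < K, ∀ q < K, l ≤ h₀ ∨ 1 ≤ q → q ≠ sl / 2 ^ l →
      s.wordMem (nodeAddr K b l q) = best X lf l q) →
    (∀ l ≤ s.wordReg 13, s.wordMem (nodeAddr K b l (sl / 2 ^ l)) = best X lf l (sl / 2 ^ l)) →
    ∃ s', ExecD W (.loop (.wordLt 18 12) fixBody) s (201 * j + 1) s' ∧
      TreeFrame s s' ∧ s'.wordReg 15 = best X lf (Nat.size (cnt - 1)) 0 ∧
      (∀ l < K, ∀ q < K, l ≤ Nat.size (cnt - 1) ∨ 1 ≤ q →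
        s'.wordMem (nodeAddr K b l q) = best X lf l q) ∧
      (∀ a, (∀ l < K, ∀ q < K, a ≠ nodeAddr K b l q) → s'.wordMem a = s.wordMem a) := by
  intro j
  induction j with
  | zero =>
    intro s h5 h10 h18 hX h13 h12 hj h14 h15 H1 H2
    have hw : s.wordReg 12 = 0 := Nat.size_eq_zero.1 hj
    have h13' : s.wordReg 13 = Nat.size (cnt - 1) := by omega
    have hzero : ∀ l, Nat.size (cnt - 1) ≤ l → sl / 2 ^ l = 0 := fun l hl =>
      Nat.div_eq_of_lt (lt_of_le_of_lt (by omega) (Nat.size_le.1 hl))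
    refine ⟨_, ExecD.loop_false (by simp [Test.Holds, hw]),
      ⟨fun _ _ => rfl, fun _ _ => rfl, rfl⟩, ?_, ?_, fun _ _ => rfl⟩
    · rw [h15, h14, h13', hzero _ le_rfl]
    · intro l hl q hq hlq
      by_cases hp : q = sl / 2 ^ l
      · have hl' : l ≤ Nat.size (cnt - 1) := by
          by_contra hcon
          rw [hzero l (by omega)] at hp
          omega
        rw [hp]
        exact H2 l (by omega)
      · refine H1 l hl q hq ?_ hp
        by_contra hcon
        have : l = Nat.size (cnt - 1) := by omega
        rw [this, hzero _ le_rfl] at hp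
        omega
  | succ j ih =>
    intro s h5 h10 h18 hX h13 h12 hj h14 h15 H1 H2
    have hw : 0 < s.wordReg 12 := Nat.size_pos.1 (by omega)
    have hK := hB.hK
    set l := s.wordReg 13 with hl
    have hsz : Nat.size (cnt - 1) ≤ cnt - 1 := by
      rw [Nat.size_le]; exact Nat.lt_two_pow_self
    have hq : sl / 2 ^ l ≤ sl := Nat.div_le_self _ _
    have hwl : s.wordReg 12 ≤ cnt - 1 := h12 ▸ Nat.div_le_self _ _
    have hdiv : sl / 2 ^ (l + 1) = sl / 2 ^ l / 2 := by rw [pow_succ, Nat.div_div_eq_div_mul]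
    have hchild : ∀ q, q = 2 * (sl / 2 ^ l / 2) ∨ q = 2 * (sl / 2 ^ l / 2) + 1 →
        s.wordMem (nodeAddr K b l q) = best X lf l q := by
      intro q hq'
      by_cases hp : q = sl / 2 ^ l
      · rw [hp]; exact H2 l le_rfl
      · exact H1 l (by omega) q (by omega) (Or.inl (by omega)) hp
    have hbK : ∀ l q, best X lf l q < K := fun l q => by
      obtain ⟨s, hs⟩ := exists_best_eq (X := X) (lf := lf) l q
      rw [hs]; exact hlf s
    obtain ⟨s₁, e₁, f₁, g12, g13, g14, g15, gm⟩ := exec_fixBody hB h5 h10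
      rfl hl.symm h14 hb (by omega) (by omega) (by omega) (hchild _ (Or.inl rfl))
      (hchild _ (Or.inr rfl)) (hbK _ _) (hbK _ _)
    rw [hX] at g15 gm
    rw [← hdiv] at g14 g15 gm
    have hbest : (if X (best X lf l (2 * (sl / 2 ^ (l + 1)))) <
        X (best X lf l (2 * (sl / 2 ^ (l + 1)) + 1)) then best X lf l (2 * (sl / 2 ^ (l + 1)) + 1)
        else best X lf l (2 * (sl / 2 ^ (l + 1)))) = best X lf (l + 1) (sl / 2 ^ (l + 1)) := rfl
    rw [hbest] at g15 gm
    have hq1 : sl / 2 ^ (l + 1) < K := by omega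
    obtain ⟨s', e', f', k15, kn, kf⟩ := ih s₁ (by rw [f₁.wordReg _ (by omega), h5])
      (by rw [f₁.wordReg _ (by omega), h10]) (by rw [f₁.wordReg _ (by omega), h18])
      (by rw [f₁.realMem, hX]) (by omega) (by rw [g12, g13, h12, pow_succ, Nat.div_div_eq_div_mul])
      (by have := size_div_two hw; rw [g12]; omega) (by rw [g14, g13]) (by rw [g15, g13, g14])
      (by
        intro l' hl' q hq' hlq hp
        rw [gm, Function.update_of_ne, H1 l' hl' q hq' hlq hp]
        intro e
        obtain ⟨-, rfl, e'⟩ := nodeAddr_inj hl' hq' (by omega) hq1 e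
        exact hp e')
      (by
        intro l' hl'
        rw [g13] at hl'
        rw [gm]
        by_cases he : l' = l + 1
        · subst he; rw [Function.update_self]
        · rw [Function.update_of_ne, H2 l' (by omega)]
          intro e
          exact he (nodeAddr_inj (by omega) (lt_of_le_of_lt (Nat.div_le_self _ _) (by omega))
            (by omega) hq1 e).2.1)
    refine ⟨s', (ExecD.loop_true (by simp [Test.Holds, h18, hw]) e₁ e').mono (by omega),
      f₁.trans f', k15, kn, fun a ha => ?_⟩
    rw [kf a ha, gm, Function.update_of_ne (ha _ (by omega) _ hq1)]

theorem exec_fixTree (hB : Big m K W) {b sl v cnt h₀ : ℕ} {X : ℕ → ℝ} {lf : ℕ → ℕ} {s : Store}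
    (h5 : s.wordReg 5 = K) (h10 : s.wordReg 10 = b) (h11 : s.wordReg 11 = sl)
    (h15 : s.wordReg 15 = v) (h18 : s.wordReg 18 = 0) (hX : s.realMem = X)
    (hmem : s.wordMem (8 * b + 4) = cnt) (hb : b < K) (hsl : sl < cnt) (hcnt : cnt ≤ m)
    (hv : v < K) (hlf : ∀ s, lf s < K) (hlf0 : ∀ s, cnt ≤ s → lf s = 0)
    (hh : Nat.size (cnt - 1) ≤ h₀ + 1)
    (hnode : ∀ l < K, ∀ q < K, l ≤ h₀ ∨ 1 ≤ q → s.wordMem (nodeAddr K b l q) = best X lf l q) :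
    ∃ s', ExecD W fixTree s (200 + 201 * Nat.size (cnt - 1)) s' ∧
      TreeFrame s s' ∧ TreeOK K X s'.wordMem b (Function.update lf sl v) ∧
      (∀ a, (∀ l < K, ∀ q < K, a ≠ nodeAddr K b l q) → a ≠ 8 * b + 5 →
        s'.wordMem a = s.wordMem a) := by
  have hlt : ∀ {v}, v < K → v < W := fun hv => hB.lt (by omega)
  have hK := hB.hK
  set lf' := Function.update lf sl v with hlf'
  have hlf'K : ∀ s, lf' s < K := fun s => by
    rw [hlf', Function.update_apply]; split_ifs; exacts [hv, hlf s]
  have hbK : ∀ l q, best X lf' l q < K := fun l q => by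
    obtain ⟨s, hs⟩ := exists_best_eq (X := X) (lf := lf') l q
    rw [hs]; exact hlf'K s
  set s₁ := s.putWord (nodeAddr K b 0 sl) v with hs₁
  set s₂ := s₁.setWord 12 (cnt - 1) with hs₂
  set s₃ := s₂.setWord 13 0 with hs₃
  set s₄ := s₃.setWord 14 sl with hs₄
  have e₁ : ExecD W _ s _ s₁ := execD_stW (hB.eval_node h5 (WExp.eval_reg h10 (hlt hb))
    (WExp.eval_const (hlt (by omega))) (WExp.eval_reg h11 (hlt (by omega))) hb (by omega)
    (by omega)) (WExp.eval_reg h15 (hlt hv))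
  have hm₁ : s₁.wordMem (8 * b + 4) = cnt := by
    rw [hs₁, putWord_wordMem, Function.update_of_ne, hmem]
    exact (nodeAddr_ne_entry (by norm_num) (by norm_num)).symm
  have e₂ : ExecD W _ s₁ _ s₂ := execD_setW (r := 12) (WExp.eval_sub
    (WExp.eval_load (hB.eval_entry (WExp.eval_reg (r := 10) (by simp [hs₁, h10]) (hlt hb)) hb
      (t := 4) (by norm_num)) hm₁) (WExp.eval_const (hlt (by omega))) (hlt (by omega)))
      (hlt (by omega))
  have e₃ : ExecD W _ s₂ _ s₃ := execD_setW (r := 13)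
    (WExp.eval_const (hlt (by omega))) (hlt (by omega))
  have e₄ : ExecD W _ s₃ _ s₄ := execD_setW (r := 14)
    (WExp.eval_reg (r := 11) (by simp [hs₃, hs₂, hs₁, h11]) (hlt (by omega))) (hlt (by omega))
  have hm₄ : s₄.wordMem = Function.update s.wordMem (nodeAddr K b 0 sl) v := rfl
  obtain ⟨s₅, e₅, f₅, k15, kn, kf⟩ := exec_fixLoop hB (X := X) (lf := lf') hb hsl
    hcnt hlf'K hh (Nat.size (cnt - 1)) s₄ (by simp [hs₄, hs₃, hs₂, hs₁, h5])
    (by simp [hs₄, hs₃, hs₂, hs₁, h10]) (by simp [hs₄, hs₃, hs₂, hs₁, h18])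
    (by simp [hs₄, hs₃, hs₂, hs₁, hX]) (by simp [hs₄, hs₃]) (by simp [hs₄, hs₃, hs₂])
    (by simp [hs₄, hs₃, hs₂]) (by simp [hs₄, hs₃]) (by simp [hs₄, hs₃, hs₂, hs₁, best, hlf', h15])
    (by
      intro l hl q hq hlq hp
      rw [hm₄, Function.update_of_ne, hnode l hl q hq hlq, hlf', best_update_of_ne hp]
      intro e
      obtain ⟨-, rfl, e'⟩ := nodeAddr_inj hl hq (by omega) (by omega) e
      simp [e'] at hp)
    (by
      intro l hl
      have : l = 0 := by simpa [hs₄, hs₃] using hl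
      subst this
      rw [hm₄]
      simp [best, hlf'])
  have f₄ : TreeFrame s s₄ := ⟨fun r hr => by
    have : r ≠ 12 ∧ r ≠ 13 ∧ r ≠ 14 := by omega
    simp [hs₄, hs₃, hs₂, hs₁, this], fun r hr => rfl, rfl⟩
  have f := f₄.trans f₅
  have e₆ : ExecD W _ s₅ _ (s₅.putWord (8 * b + 5) (best X lf' (Nat.size (cnt - 1)) 0)) :=
    execD_stW (hB.eval_entry (WExp.eval_reg (r := 10) (by rw [f.wordReg _ (by omega), h10]) (hlt hb))
      hb (t := 5) (by norm_num)) (WExp.eval_reg (r := 15) k15 (hlt (hbK _ _)))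
  have hcnt' : (s₅.putWord (8 * b + 5) (best X lf' (Nat.size (cnt - 1)) 0)).wordMem (8 * b + 4)
      = cnt := by
    rw [putWord_wordMem, Function.update_of_ne (by omega),
      kf _ (fun l _ q _ => (nodeAddr_ne_entry (by norm_num) (by norm_num)).symm), hm₄,
      Function.update_of_ne, hmem]
    exact (nodeAddr_ne_entry (by norm_num) (by norm_num)).symm
  refine ⟨_, (e₁.cons (e₂.cons (e₃.cons (e₄.cons (e₅.cons (e₆.cons execD_nil)))))).mono
    (by simp [WExp.cost, WExp.node, WExp.entry]; omega),
    f.trans ⟨fun _ _ => rfl, fun _ _ => rfl, rfl⟩, ⟨?_, ?_, ?_⟩, ?_⟩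
  · intro x hx
    rw [hcnt'] at hx
    rw [hlf', Function.update_of_ne (by omega), hlf0 x hx]
  · intro l hl q hq hlq
    rw [hcnt'] at hlq
    rw [putWord_wordMem, Function.update_of_ne (nodeAddr_ne_entry (by norm_num) (by norm_num)),
      kn l hl q hq hlq]
  · rw [hcnt', putWord_wordMem, Function.update_self]
  · intro a ha ha'
    rw [putWord_wordMem, Function.update_of_ne ha', kf a ha, hm₄,
      Function.update_of_ne (ha _ (by omega) _ (by omega))]

end Fix

/-! ## The invariant -/

/-- The exponent of the power of two that replaces `log m`. -/
def logExp (m : ℕ) : ℕ := Nat.clog 2 ⌈Real.log m⌉₊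

/-- The number of buckets. -/
def buckets (m : ℕ) : ℕ := m / 2 ^ logExp m

/-- The item at position `x` of the permutation of the items that is stored in `mem`. -/
def permP (m : ℕ) (mem : ℕ → ℕ) (x : ℕ) : ℕ := (mem (8 * x + 1) + x) % m

/-- The position of item `i`. -/
def permQ (m : ℕ) (mem : ℕ → ℕ) (i : ℕ) : ℕ := (mem (8 * i + 2) + i) % m

/-- The raw entries of the stored permutation are small. -/
def RawLt (m : ℕ) (mem : ℕ → ℕ) : Prop := ∀ x, mem (8 * x + 1) < m ∧ mem (8 * x + 2) < m

/-- The noise of item `i` has been generated. -/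
abbrev Known (m : ℕ) (s : Store) (i : ℕ) : Prop := permQ m s.wordMem i < s.wordReg 4

/-- The invariant of the data structure; `ret` is the set of the items that were returned by sorted
accesses, `bk i` is the bucket of item `i`, and `lf b` are the leaves of the tree of bucket `b`. -/
structure Core (m : ℕ) (s : Store) (ret : Finset ℕ) (bk : ℕ → ℕ) (lf : ℕ → ℕ → ℕ) : Prop where
  reg1 : s.wordReg 1 = m
  reg2 : s.wordReg 2 = buckets m
  reg5 : s.wordReg 5 = m + 2
  reg18 : s.wordReg 18 = 0
  reg4 : s.wordReg 4 ≤ m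
  -- Label 0 marks an empty leaf, and item `i` has label `i + 1`; the sentinel key -1 loses against
  -- every genuine key, since those are nonnegative.
  key0 : s.realMem 0 = -1
  raw : RawLt m s.wordMem
  QP : ∀ x < m, permQ m s.wordMem (permP m s.wordMem x) = x
  PQ : ∀ i < m, permP m s.wordMem (permQ m s.wordMem i) = i
  bk_lt : ∀ i < m, Known m s i → bk i < buckets m
  -- Both bounds are weak: a key on a boundary may be filed in either of the adjacent buckets.
  le_key : ∀ i < m, Known m s i → (bk i : ℝ) ≤ s.realMem (i + 1)
  key_le : ∀ i < m, Known m s i → s.realMem (i + 1) ≤ bk i + 1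
  ret_known : ∀ i ∈ ret, i < m ∧ Known m s i
  ret_key : ∀ i ∈ ret, ∀ j < m, Known m s j → j ∉ ret → s.realMem (j + 1) ≤ s.realMem (i + 1)
  slot_lt : ∀ j < m, Known m s j → j ∉ ret → s.wordMem (8 * j + 3) < s.wordMem (8 * bk j + 4)
  leaf_slot : ∀ j < m, Known m s j → j ∉ ret → lf (bk j) (s.wordMem (8 * j + 3)) = j + 1
  leaf : ∀ b < buckets m, ∀ t, lf b t = 0 ∨ ∃ i < m, lf b t = i + 1 ∧ Known m s i ∧ i ∉ ret ∧
    bk i = b ∧ s.wordMem (8 * i + 3) = t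
  tree : ∀ b < buckets m, TreeOK (m + 2) s.realMem s.wordMem b (lf b)
  -- The slots of returned items are not reused, so returned items are counted as well.
  cnt : ∀ b < buckets m, s.wordMem (8 * b + 4) ≤
    ((Finset.range m).filter fun i => Known m s i ∧ bk i = b).card

/-- The stores agree in the part that the invariant is about. -/
structure CoreEq (s s' : Store) : Prop where
  reg1 : s'.wordReg 1 = s.wordReg 1
  reg2 : s'.wordReg 2 = s.wordReg 2
  reg4 : s'.wordReg 4 = s.wordReg 4
  reg5 : s'.wordReg 5 = s.wordReg 5
  reg18 : s'.wordReg 18 = s.wordReg 18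
  wordMem : s'.wordMem = s.wordMem
  realMem : s'.realMem = s.realMem

theorem Core.congr {m : ℕ} {s s' : Store} {ret : Finset ℕ} {bk : ℕ → ℕ} {lf : ℕ → ℕ → ℕ}
    (h : Core m s ret bk lf) (e : CoreEq s s') : Core m s' ret bk lf := by
  have hK : ∀ i, Known m s' i ↔ Known m s i := fun i => by rw [Known, Known, e.wordMem, e.reg4]
  exact
    { reg1 := e.reg1.trans h.reg1
      reg2 := e.reg2.trans h.reg2
      reg5 := e.reg5.trans h.reg5
      reg18 := e.reg18.trans h.reg18
      reg4 := e.reg4.trans_le h.reg4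
      key0 := by rw [e.realMem, h.key0]
      raw := by rw [e.wordMem]; exact h.raw
      QP := by rw [e.wordMem]; exact h.QP
      PQ := by rw [e.wordMem]; exact h.PQ
      bk_lt := by simpa only [hK] using h.bk_lt
      le_key := by simpa only [hK, e.realMem] using h.le_key
      key_le := by simpa only [hK, e.realMem] using h.key_le
      ret_known := by simpa only [hK] using h.ret_known
      ret_key := by simpa only [hK, e.realMem] using h.ret_key
      slot_lt := by simpa only [hK, e.wordMem] using h.slot_lt
      leaf_slot := by simpa only [hK, e.wordMem] using h.leaf_slot
      leaf := by simpa only [hK, e.wordMem] using h.leaf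
      tree := by rw [e.wordMem, e.realMem]; exact h.tree
      cnt := by simpa only [hK, e.wordMem] using h.cnt }

theorem permP_lt {m : ℕ} (hm : 0 < m) (mem : ℕ → ℕ) (x : ℕ) : permP m mem x < m :=
  Nat.mod_lt _ hm

theorem permQ_lt {m : ℕ} (hm : 0 < m) (mem : ℕ → ℕ) (x : ℕ) : permQ m mem x < m :=
  Nat.mod_lt _ hm

/-- The value that represents `v` in the entry `x` of the stored permutation. -/
def encode (m v x : ℕ) : ℕ := (v + m - x) % m

/-- Entries are stored relative to their own index modulo `m`, so that zeroed memory represents the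
identity permutation and no initialization is needed. -/
theorem decode_encode {m v x : ℕ} (hv : v < m) (hx : x < m) : (encode m v x + x) % m = v := by
  rw [encode, Nat.mod_add_mod, show v + m - x + x = v + m by omega, Nat.add_mod_right,
    Nat.mod_eq_of_lt hv]

section Roots

variable {m : ℕ} {s : Store} {ret : Finset ℕ} {bk : ℕ → ℕ} {lf : ℕ → ℕ → ℕ}

theorem Core.leaf_lt (h : Core m s ret bk lf) {b : ℕ} (hb : b < buckets m) (t : ℕ) :
    lf b t < m + 2 := by
  rcases h.leaf b hb t with h | ⟨i, hi, h, -⟩ <;> omega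

theorem Core.key_le_root (h : Core m s ret bk lf) {j : ℕ} (hj : j < m) (hjk : Known m s j)
    (hjr : j ∉ ret) : s.realMem (j + 1) ≤ s.realMem (s.wordMem (8 * bk j + 5)) := by
  have hb := h.bk_lt j hj hjk
  rw [(h.tree _ hb).root, ← h.leaf_slot j hj hjk hjr]
  refine key_le_key_best (Nat.div_eq_of_lt ?_)
  have h1 := h.slot_lt j hj hjk hjr
  have h2 := Nat.lt_size_self (s.wordMem (8 * bk j + 4) - 1)
  omega

/-- An unreturned key is nonnegative and beats the sentinel. The scan of a sorted access can
therefore recognize an exhausted bucket by its root label alone. -/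
theorem Core.root_ne_zero (h : Core m s ret bk lf) {j : ℕ} (hj : j < m) (hjk : Known m s j)
    (hjr : j ∉ ret) : s.wordMem (8 * bk j + 5) ≠ 0 := fun h0 => by
  have h1 := h.key_le_root hj hjk hjr
  rw [h0, h.key0] at h1
  have h2 := h.le_key j hj hjk
  have : (0 : ℝ) ≤ bk j := Nat.cast_nonneg _
  linarith

theorem Core.root_item (h : Core m s ret bk lf) {b : ℕ} (hb : b < buckets m)
    (h0 : s.wordMem (8 * b + 5) ≠ 0) : ∃ i < m, s.wordMem (8 * b + 5) = i + 1 ∧ Known m s i ∧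
      i ∉ ret ∧ bk i = b := by
  obtain ⟨t, ht⟩ := exists_best_eq (X := s.realMem) (lf := lf b)
    (Nat.size (s.wordMem (8 * b + 4) - 1)) 0
  rw [← (h.tree b hb).root] at ht
  rcases h.leaf b hb t with h1 | ⟨i, hi, h1, h2, h3, h4, -⟩
  · exact absurd (ht.trans h1) h0
  · exact ⟨i, hi, ht.trans h1, h2, h3, h4⟩

end Roots

theorem buckets_le (m : ℕ) : buckets m ≤ m := Nat.div_le_self _ _

/-! ## Inserting an item -/

open WExp in
/-- Insert the item in register 8, which has position (register 9) in the permutation, with the key in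
real register 5, into the bucket with number (register 10). -/
def insertProg : Prog :=
  block [
    setW 15 (mod (add (load (entry 1 (reg 4))) (reg 4)) (reg 1)),
    stW (entry 1 (reg 9)) (mod (sub (add (reg 15) (reg 1)) (reg 9)) (reg 1)),
    stW (entry 2 (reg 15)) (mod (sub (add (reg 9) (reg 1)) (reg 15)) (reg 1)),
    stW (entry 1 (reg 4)) (mod (sub (add (reg 8) (reg 1)) (reg 4)) (reg 1)),
    stW (entry 2 (reg 8)) (mod (sub (add (reg 4) (reg 1)) (reg 8)) (reg 1)),
    setW 4 (add (reg 4) (const 1)),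
    stR (add (reg 8) (const 1)) (RExp.reg 5),
    setW 11 (load (entry 4 (reg 10))),
    stW (entry 3 (reg 8)) (reg 11),
    stW (entry 4 (reg 10)) (add (reg 11) (const 1)),
    setW 15 (add (reg 8) (const 1)),
    fixTree]

section Insert

variable {m W : ℕ} {s : Store} {ret : Finset ℕ} {bk : ℕ → ℕ}
  {lf : ℕ → ℕ → ℕ}

/-- The word memory before the call of `fixTree` in `insertProg`. -/
def insertMem (m : ℕ) (s : Store) (i p b : ℕ) : ℕ → ℕ :=
  let i' := permP m s.wordMem (s.wordReg 4)
  let m₁ := Function.update s.wordMem (8 * p + 1) (encode m i' p)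
  let m₂ := Function.update m₁ (8 * i' + 2) (encode m p i')
  let m₃ := Function.update m₂ (8 * s.wordReg 4 + 1) (encode m i (s.wordReg 4))
  let m₄ := Function.update m₃ (8 * i + 2) (encode m (s.wordReg 4) i)
  let m₅ := Function.update m₄ (8 * i + 3) (s.wordMem (8 * b + 4))
  Function.update m₅ (8 * b + 4) (s.wordMem (8 * b + 4) + 1)

/-- This covers the straight-line part; the effect of `fixTree` from the store reached is passed in
as `hfix`, so the bookkeeping and the tree update can be verified separately. -/
theorem exec_insertProg (hB : Big m (m + 2) W) {i p b : ℕ}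
    (h1 : s.wordReg 1 = m) (h4 : s.wordReg 4 < m) (h5 : s.wordReg 5 = m + 2)
    (h8 : s.wordReg 8 = i) (h9 : s.wordReg 9 = p) (h10 : s.wordReg 10 = b)
    (hraw : RawLt m s.wordMem)
    (hi : i < m) (hp : p < m) (hb : b < m) (hcnt : s.wordMem (8 * b + 4) < m) {k : ℕ}
    {R : Store → Prop}
    (hfix : ∀ s₁, (∀ r, r ≠ 4 → r ≠ 11 → r ≠ 15 → s₁.wordReg r = s.wordReg r) →
      s₁.wordReg 4 = s.wordReg 4 + 1 → s₁.wordReg 11 = s.wordMem (8 * b + 4) →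
      s₁.wordReg 15 = i + 1 → s₁.realReg = s.realReg →
      s₁.realMem = Function.update s.realMem (i + 1) (s.realReg 5) →
      s₁.wordMem = insertMem m s i p b → ∃ s', ExecD W fixTree s₁ k s' ∧ R s') :
    ∃ s', ExecD W insertProg s (k + 500) s' ∧ R s' := by
  have hlt : ∀ {v}, v < m + 2 → v < W := fun hv => hB.lt (by omega)
  have hlt' : ∀ {v}, v < 2 * m + 2 → v < W := fun hv => hB.lt (by omega)
  have hm := hB.hm
  set r := s.wordReg 4 with hr
  set i' := permP m s.wordMem r with hi'
  have hi'm : i' < m := permP_lt (by omega) _ _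
  have henc : ∀ v x, encode m v x < m := fun v x => Nat.mod_lt _ (by omega)
  have hencode : ∀ {t : Store} {a c : WExp} {v x : ℕ}, a.eval W t = v → c.eval W t = x →
      t.wordReg 1 = m → v < m → x < m →
      (WExp.mod (WExp.sub (WExp.add a (.reg 1)) c) (.reg 1)).eval W t = encode m v x :=
    fun {t a c v x} ha hc ht hv hx => WExp.eval_mod (WExp.eval_sub (WExp.eval_add ha
      (WExp.eval_reg ht (hlt (by omega))) (hlt' (by omega))) hc (hlt' (by omega)))
      (WExp.eval_reg ht (hlt (by omega))) (hlt' (by omega))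
  set s₁ := s.setWord 15 i' with hs₁
  set s₂ := s₁.putWord (8 * p + 1) (encode m i' p) with hs₂
  set s₃ := s₂.putWord (8 * i' + 2) (encode m p i') with hs₃
  set s₄ := s₃.putWord (8 * r + 1) (encode m i r) with hs₄
  set s₅ := s₄.putWord (8 * i + 2) (encode m r i) with hs₅
  set s₆ := s₅.setWord 4 (r + 1) with hs₆
  set s₇ := s₆.putReal (i + 1) (s.realReg 5) with hs₇
  set s₈ := s₇.setWord 11 (s.wordMem (8 * b + 4)) with hs₈
  set s₉ := s₈.putWord (8 * i + 3) (s.wordMem (8 * b + 4)) with hs₉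
  set s₁₀ := s₉.putWord (8 * b + 4) (s.wordMem (8 * b + 4) + 1) with hs₁₀
  set s₁₁ := s₁₀.setWord 15 (i + 1) with hs₁₁
  have e₁ : ExecD W _ s _ s₁ := execD_setW (r := 15)
    (WExp.eval_mod (WExp.eval_add (WExp.eval_load (hB.eval_entry (t := 1)
      (WExp.eval_reg (r := 4) hr.symm (hlt (by omega))) (by omega) (by norm_num)) rfl)
      (WExp.eval_reg (r := 4) hr.symm (hlt (by omega)))
      (hlt' (by have := (hraw r).1; omega))) (WExp.eval_reg h1 (hlt (by omega)))
      (hlt' (by have := (hraw r).1; omega))) (hlt (Nat.lt_add_right 2 hi'm))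
  have e₂ : ExecD W _ s₁ _ s₂ := execD_stW
    (hB.eval_entry (t := 1) (WExp.eval_reg (r := 9) (v := p) (by simp [hs₁, h9]) (hlt (by omega)))
      (by omega) (by norm_num))
    (hencode (WExp.eval_reg (r := 15) (v := i') (by simp [hs₁]) (hlt (by omega)))
      (WExp.eval_reg (r := 9) (v := p) (by simp [hs₁, h9]) (hlt (by omega)))
      (by simp [hs₁, h1]) hi'm hp)
  have e₃ : ExecD W _ s₂ _ s₃ := execD_stW
    (hB.eval_entry (t := 2) (WExp.eval_reg (r := 15) (v := i') (by simp [hs₂, hs₁])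
      (hlt (by omega))) (by omega) (by norm_num))
    (hencode (WExp.eval_reg (r := 9) (v := p) (by simp [hs₂, hs₁, h9]) (hlt (by omega)))
      (WExp.eval_reg (r := 15) (v := i') (by simp [hs₂, hs₁]) (hlt (by omega)))
      (by simp [hs₂, hs₁, h1]) hp hi'm)
  have e₄ : ExecD W _ s₃ _ s₄ := execD_stW
    (hB.eval_entry (t := 1) (WExp.eval_reg (r := 4) (v := r) (by simp [hs₃, hs₂, hs₁, hr])
      (hlt (by omega))) (by omega) (by norm_num))
    (hencode (WExp.eval_reg (r := 8) (v := i) (by simp [hs₃, hs₂, hs₁, h8]) (hlt (by omega)))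
      (WExp.eval_reg (r := 4) (v := r) (by simp [hs₃, hs₂, hs₁, hr]) (hlt (by omega)))
      (by simp [hs₃, hs₂, hs₁, h1]) hi h4)
  have e₅ : ExecD W _ s₄ _ s₅ := execD_stW
    (hB.eval_entry (t := 2) (WExp.eval_reg (r := 8) (v := i) (by simp [hs₄, hs₃, hs₂, hs₁, h8])
      (hlt (by omega))) (by omega) (by norm_num))
    (hencode (WExp.eval_reg (r := 4) (v := r) (by simp [hs₄, hs₃, hs₂, hs₁, hr]) (hlt (by omega)))
      (WExp.eval_reg (r := 8) (v := i) (by simp [hs₄, hs₃, hs₂, hs₁, h8]) (hlt (by omega)))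
      (by simp [hs₄, hs₃, hs₂, hs₁, h1]) h4 hi)
  have e₆ : ExecD W _ s₅ _ s₆ := execD_setW (r := 4)
    (WExp.eval_add (WExp.eval_reg (r := 4) (v := r) (by simp [hs₅, hs₄, hs₃, hs₂, hs₁, hr])
      (hlt (by omega))) (WExp.eval_const (hlt (by omega))) (hlt (by omega))) (hlt (by omega))
  have e₇ : ExecD W (stR (WExp.add (.reg 8) (.const 1)) (RExp.reg 5)) s₆ _ s₇ := execD_stR
    (WExp.eval_add (WExp.eval_reg (r := 8) (v := i) (by simp [hs₆, hs₅, hs₄, hs₃, hs₂, hs₁, h8])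
      (hlt (by omega))) (WExp.eval_const (hlt (by omega))) (hlt (by omega)))
    (by simp [RExp.eval, hs₆, hs₅, hs₄, hs₃, hs₂, hs₁])
  have hm₇ : s₇.wordMem (8 * b + 4) = s.wordMem (8 * b + 4) := by
    simp only [hs₇, hs₆, hs₅, hs₄, hs₃, hs₂, hs₁, putReal_wordMem, setWord_wordMem, putWord_wordMem]
    repeat rw [Function.update_of_ne (by omega)]
  have e₈ : ExecD W _ s₇ _ s₈ := execD_setW (r := 11)
    (WExp.eval_load (hB.eval_entry (t := 4) (WExp.eval_reg (r := 10) (v := b)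
      (by simp [hs₇, hs₆, hs₅, hs₄, hs₃, hs₂, hs₁, h10]) (hlt (by omega))) (by omega)
      (by norm_num)) hm₇) (hlt (by omega))
  have e₉ : ExecD W _ s₈ _ s₉ := execD_stW
    (hB.eval_entry (t := 3) (WExp.eval_reg (r := 8) (v := i)
      (by simp [hs₈, hs₇, hs₆, hs₅, hs₄, hs₃, hs₂, hs₁, h8]) (hlt (by omega))) (by omega)
      (by norm_num)) (WExp.eval_reg (r := 11) (by simp [hs₈]) (hlt (by omega)))
  have e₁₀ : ExecD W _ s₉ _ s₁₀ := execD_stW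
    (hB.eval_entry (t := 4) (WExp.eval_reg (r := 10) (v := b)
      (by simp [hs₉, hs₈, hs₇, hs₆, hs₅, hs₄, hs₃, hs₂, hs₁, h10]) (hlt (by omega))) (by omega)
      (by norm_num)) (WExp.eval_add (WExp.eval_reg (r := 11) (by simp [hs₉, hs₈]) (hlt (by omega)))
      (WExp.eval_const (hlt (by omega))) (hlt (by omega)))
  have e₁₁ : ExecD W _ s₁₀ _ s₁₁ := execD_setW (r := 15)
    (WExp.eval_add (WExp.eval_reg (r := 8) (v := i)
      (by simp [hs₁₀, hs₉, hs₈, hs₇, hs₆, hs₅, hs₄, hs₃, hs₂, hs₁, h8]) (hlt (by omega)))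
      (WExp.eval_const (hlt (by omega))) (hlt (by omega))) (hlt (by omega))
  have hre : s₁₁.realReg = s.realReg := rfl
  obtain ⟨s', e₁₂, hR⟩ := hfix s₁₁ (fun r hr4 hr11 hr15 => by
    simp [hs₁₁, hs₁₀, hs₉, hs₈, hs₇, hs₆, hs₅, hs₄, hs₃, hs₂, hs₁, hr4, hr11, hr15])
    (by simp [hs₁₁, hs₁₀, hs₉, hs₈, hs₇, hs₆]) (by simp [hs₁₁, hs₁₀, hs₉, hs₈])
    (by simp [hs₁₁]) hre
    (by simp [hs₁₁, hs₁₀, hs₉, hs₈, hs₇, hs₆, hs₅, hs₄, hs₃, hs₂, hs₁])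
    (by simp only [hs₁₁, hs₁₀, hs₉, hs₈, hs₇, hs₆, hs₅, hs₄, hs₃, hs₂, hs₁, putReal_wordMem,
      setWord_wordMem, putWord_wordMem]; rfl)
  refine ⟨s', (e₁.cons (e₂.cons (e₃.cons (e₄.cons (e₅.cons (e₆.cons (e₇.cons (e₈.cons (e₉.cons
    (e₁₀.cons (e₁₁.cons (e₁₂.cons execD_nil)))))))))))).mono ?_, hR⟩
  simp [WExp.cost, RExp.cost, WExp.entry]
  omega

end Insert

section Insert

variable {m W : ℕ} {s : Store} {ret : Finset ℕ} {bk : ℕ → ℕ} {lf : ℕ → ℕ → ℕ}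

/-- The two writes coincide when the item already sits at the first unknown position; the later one
prevails, which fixes the order of the cases. -/
theorem insertMem_P {i p b : ℕ} (x : ℕ) : insertMem m s i p b (8 * x + 1) =
    if x = s.wordReg 4 then encode m i (s.wordReg 4)
    else if x = p then encode m (permP m s.wordMem (s.wordReg 4)) p
    else s.wordMem (8 * x + 1) := by
  simp only [insertMem]
  rw [Function.update_of_ne (by omega), Function.update_of_ne (by omega),
    Function.update_of_ne (by omega)]
  by_cases h1 : x = s.wordReg 4
  · rw [if_pos h1, h1, Function.update_self]
  · rw [if_neg h1, Function.update_of_ne (by omega), Function.update_of_ne (by omega)]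
    by_cases h2 : x = p
    · rw [if_pos h2, h2, Function.update_self]
    · rw [if_neg h2, Function.update_of_ne (by omega)]

theorem insertMem_Q {i p b : ℕ} (x : ℕ) : insertMem m s i p b (8 * x + 2) =
    if x = i then encode m (s.wordReg 4) i
    else if x = permP m s.wordMem (s.wordReg 4) then encode m p x
    else s.wordMem (8 * x + 2) := by
  simp only [insertMem]
  rw [Function.update_of_ne (by omega), Function.update_of_ne (by omega)]
  by_cases h1 : x = i
  · rw [if_pos h1, h1, Function.update_self]
  · rw [if_neg h1, Function.update_of_ne (by omega), Function.update_of_ne (by omega)]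
    by_cases h2 : x = permP m s.wordMem (s.wordReg 4)
    · rw [if_pos h2, h2, Function.update_self]
    · rw [if_neg h2, Function.update_of_ne (by omega), Function.update_of_ne (by omega)]

theorem insertMem_slot {i p b : ℕ} (x : ℕ) : insertMem m s i p b (8 * x + 3) =
    if x = i then s.wordMem (8 * b + 4) else s.wordMem (8 * x + 3) := by
  simp only [insertMem]
  rw [Function.update_of_ne (by omega)]
  by_cases h1 : x = i
  · rw [if_pos h1, h1, Function.update_self]
  · rw [if_neg h1]
    repeat rw [Function.update_of_ne (by omega)]

theorem insertMem_cnt {i p b : ℕ} (x : ℕ) : insertMem m s i p b (8 * x + 4) =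
    if x = b then s.wordMem (8 * b + 4) + 1 else s.wordMem (8 * x + 4) := by
  simp only [insertMem]
  by_cases h1 : x = b
  · rw [if_pos h1, h1, Function.update_self]
  · rw [if_neg h1]
    repeat rw [Function.update_of_ne (by omega)]

theorem insertMem_of_ne {i p b a : ℕ} (h : ∀ x t, 0 < t → t < 5 → a ≠ 8 * x + t) :
    insertMem m s i p b a = s.wordMem a := by
  simp only [insertMem]
  rw [Function.update_of_ne (h _ _ (by norm_num) (by norm_num)),
    Function.update_of_ne (h _ _ (by norm_num) (by norm_num)),
    Function.update_of_ne (h _ _ (by norm_num) (by norm_num)),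
    Function.update_of_ne (h _ _ (by norm_num) (by norm_num)),
    Function.update_of_ne (h _ _ (by norm_num) (by norm_num)),
    Function.update_of_ne (h _ _ (by norm_num) (by norm_num))]

/-- A Fisher-Yates step: the item is swapped to the first unknown position and the boundary in
register 4 moves past it, so exactly this item becomes known. It takes the first unused slot of its
bucket, whose leaf is empty, so no other leaf is disturbed. `hret` keeps the returned keys on top.
-/
theorem Core.exec_insert (hB : Big m (m + 2) W) (h : Core m s ret bk lf) {i b : ℕ} {v : ℝ}
    (h8 : s.wordReg 8 = i) (h9 : s.wordReg 9 = permQ m s.wordMem i) (h10 : s.wordReg 10 = b)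
    (hv : s.realReg 5 = v) (hi : i < m) (hik : ¬ Known m s i) (hb : b < buckets m)
    (hbv : (b : ℝ) ≤ v) (hvb : v ≤ b + 1) (hret : ∀ j ∈ ret, v ≤ s.realMem (j + 1)) :
    ∃ s', ExecD W insertProg s (700 + 201 * Nat.size (s'.wordMem (8 * b + 4))) s' ∧
      (∃ lf', Core m s' ret (Function.update bk i b) lf') ∧
      (∀ r, r ≠ 4 → (r < 11 ∨ 17 ≤ r) → s'.wordReg r = s.wordReg r) ∧
      (∀ r, (r < 6 ∨ 8 ≤ r) → s'.realReg r = s.realReg r) ∧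
      s'.wordReg 4 = s.wordReg 4 + 1 ∧
      s'.realMem = Function.update s.realMem (i + 1) v ∧
      (∀ j < m, Known m s' j ↔ Known m s j ∨ j = i) := by
  have hm := hB.hm
  have hbm : b < m := hb.trans_le (buckets_le m)
  set r := s.wordReg 4 with hr
  set p := permQ m s.wordMem i with hp
  set i' := permP m s.wordMem r with hi'
  have hpm : p < m := permQ_lt (by omega) _ _
  have hi'm : i' < m := permP_lt (by omega) _ _
  have hrp : r ≤ p := not_lt.1 hik
  have hrm : r < m := by omega
  have hPp : permP m s.wordMem p = i := h.PQ i hi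
  have hQi' : permQ m s.wordMem i' = r := h.QP r hrm
  set c := s.wordMem (8 * b + 4) with hc
  -- The item itself is not yet known, so the bucket has used fewer than `m` slots.
  have hcm : c < m := by
    refine (h.cnt b hb).trans_lt ?_
    have : ((Finset.range m).filter fun j => Known m s j ∧ bk j = b) ⊂ Finset.range m := by
      rw [Finset.filter_ssubset]
      exact ⟨i, Finset.mem_range.2 hi, fun hh => hik hh.1⟩
    simpa using Finset.card_lt_card this
  suffices hs : ∃ s', ExecD W insertProg s (200 + 201 * Nat.size c + 500) s' ∧
      (s'.wordMem (8 * b + 4) = c + 1 ∧ (∃ lf', Core m s' ret (Function.update bk i b) lf') ∧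
      (∀ r, r ≠ 4 → (r < 11 ∨ 17 ≤ r) → s'.wordReg r = s.wordReg r) ∧
      (∀ r, (r < 6 ∨ 8 ≤ r) → s'.realReg r = s.realReg r) ∧
      s'.wordReg 4 = s.wordReg 4 + 1 ∧
      s'.realMem = Function.update s.realMem (i + 1) v ∧
      (∀ j < m, Known m s' j ↔ Known m s j ∨ j = i)) by
    obtain ⟨s', e, hcnt, hrest⟩ := hs
    refine ⟨s', e.mono ?_, hrest⟩
    have : Nat.size c ≤ Nat.size (c + 1) := Nat.size_le_size (by omega)
    rw [hcnt]
    omega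
  refine exec_insertProg hB h.reg1 hrm h.reg5 h8 h9 h10 h.raw hi hpm hbm hcm ?_
  intro s₁ f4 hr4 hr11 hr15 hrr hrm₁ hmem
  have hT := h.tree b hb
  -- The label of the new item occurs in no tree, so writing its key changes no winner.
  have hlab : ∀ b < buckets m, ∀ t, lf b t ≠ i + 1 := fun b hb t ht => by
    rcases h.leaf b hb t with h0 | ⟨j, hj, h1, h2, -⟩
    · omega
    · have : j = i := by omega
      exact hik (this ▸ h2)
  have hbest : ∀ b < buckets m, ∀ l q, best s₁.realMem (lf b) l q = best s.realMem (lf b) l q :=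
    fun b hb l q => (best_congr (fun t => by
      rw [hrm₁, Function.update_of_ne (hlab b hb t)]) l q).1
  obtain ⟨s', e, f, hT', hf'⟩ := exec_fixTree (s := s₁) (b := b) (sl := c) (v := i + 1)
    (cnt := c + 1) (h₀ := Nat.size (c - 1)) (X := s₁.realMem) (lf := lf b) hB
    (by rw [f4 _ (by omega) (by omega) (by omega), h.reg5])
    (by rw [f4 _ (by omega) (by omega) (by omega), h10])
    hr11 hr15 (by rw [f4 _ (by omega) (by omega) (by omega), h.reg18]) rfl
    (by rw [hmem, insertMem_cnt, if_pos rfl]) (by omega) (by omega) (by omega) (by omega)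
    (h.leaf_lt hb) (fun t ht => hT.leaf_zero t (by omega))
    (by
      -- One more leaf raises the height by at most one.
      rw [Nat.size_le, pow_succ]
      have := Nat.lt_size_self (c - 1)
      omega)
    (by
      intro l hl q hq hlq
      rw [hbest b hb, ← hT.node l hl q hq hlq, hmem, insertMem_of_ne]
      exact fun x t ht ht' => nodeAddr_ne_entry ht (by omega))
  have hmem' : ∀ x t, 0 < t → t < 5 → s'.wordMem (8 * x + t) = insertMem m s i p b (8 * x + t) :=
    fun x t ht ht' => by
      rw [hf' _ (fun l _ q _ => (nodeAddr_ne_entry ht (by omega)).symm) (by omega), hmem]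
  have hr' : s'.wordReg 4 = r + 1 := by rw [f.wordReg 4 (by omega), hr4]
  have hX' : s'.realMem = Function.update s.realMem (i + 1) v := by rw [f.realMem, hrm₁, hv]
  have hP' : ∀ x < m, permP m s'.wordMem x = if x = r then i else if x = p then i' else
      permP m s.wordMem x := fun x hx => by
    rw [permP, hmem' x 1 (by norm_num) (by norm_num), insertMem_P]
    split_ifs with h1 h2
    · rw [h1, ← hr]; exact decode_encode hi hrm
    · rw [h2]; exact decode_encode hi'm hpm
    · rfl
  have hQ' : ∀ x < m, permQ m s'.wordMem x = if x = i then r else if x = i' then p else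
      permQ m s.wordMem x := fun x hx => by
    rw [permQ, hmem' x 2 (by norm_num) (by norm_num), insertMem_Q]
    split_ifs with h1 h2
    · rw [h1]; exact decode_encode hrm hi
    · exact decode_encode hpm hx
    · rfl
  have hK' : ∀ j < m, Known m s' j ↔ Known m s j ∨ j = i := fun j hj => by
    rw [Known, hQ' j hj, hr', Known, ← hr]
    by_cases h1 : j = i
    · simp [h1]
    · rw [if_neg h1]
      by_cases h2 : j = i'
      · rw [if_pos h2, h2, hQi']
        have : p ≠ r := fun hpr => by
          rw [hpr, ← hi'] at hPp
          exact h1 (h2.trans hPp)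
        constructor
        · intro h3; omega
        · rintro (h3 | h3)
          · omega
          · exact absurd (h2.trans h3) h1
      · rw [if_neg h2]
        have : permQ m s.wordMem j ≠ r := fun h3 => by
          have := h.PQ j hj
          rw [h3] at this
          exact h2 this.symm
        constructor
        · intro h3; left; omega
        · rintro (h3 | h3)
          · omega
          · exact absurd h3 h1
  have hslot' : ∀ j, s'.wordMem (8 * j + 3) = if j = i then c else s.wordMem (8 * j + 3) :=
    fun j => by rw [hmem' j 3 (by norm_num) (by norm_num), insertMem_slot]
  have hcnt' : ∀ b', s'.wordMem (8 * b' + 4) = if b' = b then c + 1 else s.wordMem (8 * b' + 4) :=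
    fun b' => by rw [hmem' b' 4 (by norm_num) (by norm_num), insertMem_cnt]
  have hiret : i ∉ ret := fun hh => hik (h.ret_known i hh).2
  refine ⟨s', e, by rw [hcnt', if_pos rfl], ⟨Function.update lf b (Function.update (lf b) c (i + 1)),
    ?_⟩, ?_, ?_, hr', hX', hK'⟩
  · exact
    { reg1 := by rw [f.wordReg _ (by omega), f4 _ (by omega) (by omega) (by omega), h.reg1]
      reg2 := by rw [f.wordReg _ (by omega), f4 _ (by omega) (by omega) (by omega), h.reg2]
      reg5 := by rw [f.wordReg _ (by omega), f4 _ (by omega) (by omega) (by omega), h.reg5]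
      reg18 := by rw [f.wordReg _ (by omega), f4 _ (by omega) (by omega) (by omega), h.reg18]
      reg4 := by omega
      key0 := by rw [hX', Function.update_of_ne (by omega), h.key0]
      raw := fun x => by
        have henc : ∀ v x, encode m v x < m := fun v x => Nat.mod_lt _ (by omega)
        rw [hmem' x 1 (by norm_num) (by norm_num), hmem' x 2 (by norm_num) (by norm_num),
          insertMem_P, insertMem_Q]
        constructor <;> split_ifs
        exacts [henc _ _, henc _ _, (h.raw x).1, henc _ _, henc _ _, (h.raw x).2]
      QP := by
        intro x hx
        rw [hP' x hx]
        split_ifs with h1 h2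
        · rw [hQ' i hi, if_pos rfl, h1]
        · rw [hQ' i' hi'm, if_pos rfl, h2, if_neg]
          intro h3
          rw [h3, ← hp] at hQi'
          omega
        · rw [hQ' _ (permP_lt (by omega) _ _), if_neg, if_neg, h.QP x hx]
          · intro h3
            have := h.QP x hx
            rw [h3, hQi'] at this
            exact h1 this.symm
          · intro h3
            have := h.QP x hx
            rw [h3, ← hp] at this
            exact h2 this.symm
      PQ := by
        intro x hx
        rw [hQ' x hx]
        split_ifs with h1 h2
        · rw [hP' r hrm, if_pos rfl, h1]
        · rw [hP' p hpm, if_pos rfl, h2, if_neg]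
          intro h3
          rw [h3, ← hi'] at hPp
          exact h1 (h2.trans hPp)
        · rw [hP' _ (permQ_lt (by omega) _ _), if_neg, if_neg, h.PQ x hx]
          · intro h3
            have := h.PQ x hx
            rw [h3, hPp] at this
            exact h1 this.symm
          · intro h3
            have := h.PQ x hx
            rw [h3, ← hi'] at this
            exact h2 this.symm
      bk_lt := by
        intro j hj hjk
        by_cases h1 : j = i
        · rwa [h1, Function.update_self]
        · rw [Function.update_of_ne h1]
          exact h.bk_lt j hj (((hK' j hj).1 hjk).resolve_right h1)
      le_key := by
        intro j hj hjk
        by_cases h1 : j = i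
        · rwa [h1, Function.update_self, hX', Function.update_self]
        · rw [Function.update_of_ne h1, hX', Function.update_of_ne (by omega)]
          exact h.le_key j hj (((hK' j hj).1 hjk).resolve_right h1)
      key_le := by
        intro j hj hjk
        by_cases h1 : j = i
        · rwa [h1, Function.update_self, hX', Function.update_self]
        · rw [Function.update_of_ne h1, hX', Function.update_of_ne (by omega)]
          exact h.key_le j hj (((hK' j hj).1 hjk).resolve_right h1)
      ret_known := fun j hj =>
        ⟨(h.ret_known j hj).1, (hK' j (h.ret_known j hj).1).2 (Or.inl (h.ret_known j hj).2)⟩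
      ret_key := by
        intro j hj k hk hkk hkr
        have hji : j ≠ i := fun e => hiret (e ▸ hj)
        rw [hX', Function.update_of_ne (show j + 1 ≠ i + 1 by omega)]
        by_cases h1 : k = i
        · rw [h1, Function.update_self]; exact hret j hj
        · rw [Function.update_of_ne (by omega)]
          exact h.ret_key j hj k hk (((hK' k hk).1 hkk).resolve_right h1) hkr
      slot_lt := by
        intro j hj hjk hjr
        rw [hslot', hcnt']
        by_cases h1 : j = i
        · rw [if_pos h1, h1, Function.update_self, if_pos rfl]; omega
        · rw [if_neg h1, Function.update_of_ne h1]
          have := h.slot_lt j hj (((hK' j hj).1 hjk).resolve_right h1) hjr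
          split_ifs with h2
          · rw [h2] at this; omega
          · exact this
      leaf_slot := by
        intro j hj hjk hjr
        rw [hslot']
        by_cases h1 : j = i
        · rw [if_pos h1, h1, Function.update_self, Function.update_self, Function.update_self]
        · rw [if_neg h1, Function.update_of_ne h1]
          have hjk' := ((hK' j hj).1 hjk).resolve_right h1
          have h3 := h.leaf_slot j hj hjk' hjr
          by_cases h2 : bk j = b
          · have := h.slot_lt j hj hjk' hjr
            rw [h2] at this h3 ⊢
            rw [Function.update_self, Function.update_of_ne (by omega), h3]
          · rw [Function.update_of_ne h2, h3]
      leaf := by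
        have key : ∀ b' < buckets m, ∀ t, lf b' t = 0 ∨ ∃ j < m, lf b' t = j + 1 ∧ Known m s' j ∧
            j ∉ ret ∧ Function.update bk i b j = b' ∧ s'.wordMem (8 * j + 3) = t := by
          intro b' hb' t
          rcases h.leaf b' hb' t with h0 | ⟨j, hj, h1, h2, h3, h4, h5⟩
          · exact Or.inl h0
          · have hji : j ≠ i := fun e => hik (e ▸ h2)
            exact Or.inr ⟨j, hj, h1, (hK' j hj).2 (Or.inl h2), h3,
              by rw [Function.update_of_ne hji, h4], by rw [hslot', if_neg hji, h5]⟩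
        intro b' hb' t
        by_cases hbb : b' = b
        · subst hbb
          rw [Function.update_self]
          by_cases ht : t = c
          · right
            rw [ht, Function.update_self]
            exact ⟨i, hi, rfl, (hK' i hi).2 (Or.inr rfl), hiret, by rw [Function.update_self],
              by rw [hslot', if_pos rfl]⟩
          · rw [Function.update_of_ne ht]
            exact key b' hb' t
        · rw [Function.update_of_ne hbb]
          exact key b' hb' t
      tree := by
        intro b' hb'
        by_cases hbb : b' = b
        · subst hbb
          rw [Function.update_self, f.realMem]
          exact hT'
        · rw [Function.update_of_ne hbb, f.realMem]
          have ht := h.tree b' hb'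
          have hc' := hcnt' b'
          rw [if_neg hbb] at hc'
          refine ⟨by rw [hc']; exact ht.leaf_zero, ?_, ?_⟩
          · intro l hl q hq hlq
            rw [hc'] at hlq
            rw [hbest b' hb', ← ht.node l hl q hq hlq, hf', hmem, insertMem_of_ne]
            · exact fun x t ht ht' => nodeAddr_ne_entry ht (by omega)
            · intro l' hl' q' hq' e'
              exact hbb (nodeAddr_inj hl hq hl' hq' e').1
            · exact nodeAddr_ne_entry (by norm_num) (by norm_num)
          · rw [hc', hbest b' hb', ← ht.root, hf', hmem, insertMem_of_ne]
            · intro x t ht ht'; omega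
            · exact fun l _ q _ => (nodeAddr_ne_entry (by norm_num) (by norm_num)).symm
            · omega
      cnt := by
        intro b' hb'
        rw [hcnt']
        have h1 := h.cnt b' hb'
        split_ifs with hbb
        · subst hbb
          rw [← hc] at h1
          have : insert i ((Finset.range m).filter fun j => Known m s j ∧ bk j = b') ⊆
              (Finset.range m).filter fun j => Known m s' j ∧ Function.update bk i b' j = b' := by
            intro j hj
            rw [Finset.mem_insert, Finset.mem_filter] at hj
            rw [Finset.mem_filter, Finset.mem_range]
            rcases hj with rfl | ⟨hj, hjk, hjb⟩
            · exact ⟨hi, (hK' _ hi).2 (Or.inr rfl), by rw [Function.update_self]⟩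
            · have hji : j ≠ i := fun e => hik (e ▸ hjk)
              rw [Finset.mem_range] at hj
              exact ⟨hj, (hK' j hj).2 (Or.inl hjk), by rw [Function.update_of_ne hji, hjb]⟩
          refine le_trans ?_ (Finset.card_le_card this)
          rw [Finset.card_insert_of_notMem]
          · omega
          · rw [Finset.mem_filter]
            exact fun hh => hik hh.2.1
        · refine h1.trans (Finset.card_le_card ?_)
          intro j hj
          rw [Finset.mem_filter, Finset.mem_range] at hj ⊢
          have hji : j ≠ i := fun e => hik (e ▸ hj.2.1)
          exact ⟨hj.1, (hK' j hj.1).2 (Or.inl hj.2.1), by rw [Function.update_of_ne hji, hj.2.2]⟩ }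
  · intro x hx4 hx
    rw [f.wordReg x (by omega), f4 x hx4 (by omega) (by omega)]
  · intro x hx
    rw [f.realReg x hx, hrr]

end Insert

/-! ## Extracting the maximum -/

open WExp in
/-- Remove the item with the largest key from the bucket with number (register 3) and put it into
register 8. -/
def popProg : Prog :=
  block [
    setW 10 (reg 3),
    setW 8 (sub (load (entry 5 (reg 10))) (const 1)),
    setW 11 (load (entry 3 (reg 8))),
    setW 15 (const 0),
    fixTree]

/-- Clearing the leaf of the winner removes it from the tree; the permutation is not touched, so the
item remains known. `htop` makes the winner of this one bucket the largest of all unreturned known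
keys. -/
theorem Core.exec_pop {m W : ℕ} {s : Store} {ret : Finset ℕ} {bk : ℕ → ℕ} {lf : ℕ → ℕ → ℕ}
    (hB : Big m (m + 2) W) (h : Core m s ret bk lf) {b : ℕ} (h3 : s.wordReg 3 = b)
    (hb : b < buckets m) (hroot : s.wordMem (8 * b + 5) ≠ 0)
    (htop : ∀ j < m, Known m s j → j ∉ ret → bk j ≤ b) :
    ∃ s', ExecD W popProg s (300 + 201 * Nat.size (s'.wordMem (8 * b + 4))) s' ∧
      (∃ i < m, s'.wordReg 8 = i ∧ Known m s i ∧ i ∉ ret ∧ bk i = b ∧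
        ∃ lf', Core m s' (insert i ret) bk lf') ∧
      (∀ r, r ≠ 8 → (r < 10 ∨ 17 ≤ r) → s'.wordReg r = s.wordReg r) ∧
      (∀ r, (r < 6 ∨ 8 ≤ r) → s'.realReg r = s.realReg r) ∧
      s'.realMem = s.realMem ∧
      (∀ j, permQ m s'.wordMem j = permQ m s.wordMem j) := by
  have hm := hB.hm
  have hbm : b < m := hb.trans_le (buckets_le m)
  have hlt : ∀ {v}, v < m + 2 → v < W := fun hv => hB.lt (by omega)
  obtain ⟨i, hi, hri, hik, hir, hbi⟩ := h.root_item hb hroot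
  set sl := s.wordMem (8 * i + 3) with hsl
  set c := s.wordMem (8 * b + 4) with hc
  have hslc : sl < c := by have := h.slot_lt i hi hik hir; rwa [hbi] at this
  have hcm : c ≤ m := by
    refine (h.cnt b hb).trans ?_
    simpa using Finset.card_le_card (Finset.filter_subset (fun j => Known m s j ∧ bk j = b)
      (Finset.range m))
  have hT := h.tree b hb
  set s₁ := s.setWord 10 b with hs₁
  set s₂ := s₁.setWord 8 i with hs₂
  set s₃ := s₂.setWord 11 sl with hs₃
  set s₄ := s₃.setWord 15 0 with hs₄
  have e₁ : ExecD W _ s _ s₁ := execD_setW (r := 10) (WExp.eval_reg h3 (hlt (by omega)))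
    (hlt (by omega))
  have e₂ : ExecD W (setW 8 (.sub (.load (.entry 5 (.reg 10))) (.const 1))) s₁ _ s₂ :=
    execD_setW (r := 8) (by
    rw [WExp.eval_sub (WExp.eval_load (hB.eval_entry (t := 5)
      (WExp.eval_reg (r := 10) (v := b) (by simp [hs₁]) (hlt (by omega))) (by omega) (by norm_num))
      (show s₁.wordMem (8 * b + 5) = i + 1 from hri)) (WExp.eval_const (hlt (by omega)))
      (hlt (by omega)), Nat.add_sub_cancel]) (hlt (by omega))
  have e₃ : ExecD W _ s₂ _ s₃ := execD_setW (r := 11)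
    (WExp.eval_load (hB.eval_entry (t := 3) (WExp.eval_reg (r := 8) (v := i) (by simp [hs₂])
      (hlt (by omega))) (by omega) (by norm_num)) rfl) (hlt (by omega))
  have e₄ : ExecD W _ s₃ _ s₄ := execD_setW (r := 15) (WExp.eval_const (hlt (by omega)))
    (hlt (by omega))
  obtain ⟨s', e, f, hT', hf'⟩ := exec_fixTree (s := s₄) (b := b) (sl := sl) (v := 0)
    (cnt := c) (h₀ := Nat.size (c - 1)) (X := s.realMem) (lf := lf b) hB
    (by simp [hs₄, hs₃, hs₂, hs₁, h.reg5]) (by simp [hs₄, hs₃, hs₂, hs₁]) (by simp [hs₄, hs₃])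
    (by simp [hs₄]) (by simp [hs₄, hs₃, hs₂, hs₁, h.reg18]) rfl rfl (by omega) hslc hcm (by omega)
    (h.leaf_lt hb) hT.leaf_zero (by omega) hT.node
  have f4 : ∀ r, r ≠ 8 → r ≠ 10 → r ≠ 11 → r ≠ 15 → s₄.wordReg r = s.wordReg r :=
    fun r h1 h2 h3 h4 => by simp [hs₄, hs₃, hs₂, hs₁, h1, h2, h3, h4]
  have hmem' : ∀ x t, 0 < t → t < 5 → s'.wordMem (8 * x + t) = s.wordMem (8 * x + t) :=
    fun x t ht ht' => by
      rw [hf' _ (fun l _ q _ => (nodeAddr_ne_entry ht (by omega)).symm) (by omega)]; rfl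
  have hX' : s'.realMem = s.realMem := f.realMem
  have hQ' : ∀ j, permQ m s'.wordMem j = permQ m s.wordMem j := fun j => by
    rw [permQ, hmem' j 2 (by norm_num) (by norm_num), permQ]
  have hP' : ∀ j, permP m s'.wordMem j = permP m s.wordMem j := fun j => by
    rw [permP, hmem' j 1 (by norm_num) (by norm_num), permP]
  have hr4 : s'.wordReg 4 = s.wordReg 4 := by
    rw [f.wordReg _ (by omega), f4 _ (by omega) (by omega) (by omega) (by omega)]
  have hK' : ∀ j, Known m s' j ↔ Known m s j := fun j => by rw [Known, hQ', hr4]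
  refine ⟨s', (e₁.cons (e₂.cons (e₃.cons (e₄.cons (e.cons execD_nil))))).mono ?_,
    ⟨i, hi, ?_, hik, hir, hbi, Function.update lf b (Function.update (lf b) sl 0), ?_⟩,
    ?_, ?_, hX', hQ'⟩
  · have : Nat.size (c - 1) ≤ Nat.size c := Nat.size_le_size (by omega)
    rw [hmem' b 4 (by norm_num) (by norm_num), ← hc]
    simp [WExp.cost, WExp.entry]
    omega
  · rw [f.wordReg _ (by omega)]; simp [hs₄, hs₃, hs₂]
  · exact
    { reg1 := by
        rw [f.wordReg _ (by omega), f4 _ (by omega) (by omega) (by omega) (by omega), h.reg1]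
      reg2 := by
        rw [f.wordReg _ (by omega), f4 _ (by omega) (by omega) (by omega) (by omega), h.reg2]
      reg5 := by
        rw [f.wordReg _ (by omega), f4 _ (by omega) (by omega) (by omega) (by omega), h.reg5]
      reg18 := by
        rw [f.wordReg _ (by omega), f4 _ (by omega) (by omega) (by omega) (by omega), h.reg18]
      reg4 := by rw [hr4]; exact h.reg4
      key0 := by rw [hX', h.key0]
      raw := fun x => by
        rw [hmem' x 1 (by norm_num) (by norm_num), hmem' x 2 (by norm_num) (by norm_num)]
        exact h.raw x
      QP := fun x hx => by rw [hQ', hP']; exact h.QP x hx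
      PQ := fun x hx => by rw [hQ', hP']; exact h.PQ x hx
      bk_lt := by simpa only [hK'] using h.bk_lt
      le_key := by simpa only [hK', hX'] using h.le_key
      key_le := by simpa only [hK', hX'] using h.key_le
      ret_known := by
        intro j hj
        rw [hK']
        rcases Finset.mem_insert.1 hj with rfl | hj
        · exact ⟨hi, hik⟩
        · exact h.ret_known j hj
      ret_key := by
        intro j hj k hk hkk hkr
        rw [hK'] at hkk
        rw [Finset.mem_insert, not_or] at hkr
        rw [hX']
        rcases Finset.mem_insert.1 hj with rfl | hj
        · have hkb := htop k hk hkk hkr.2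
          -- Within the bucket the root is the maximum; a key of a lower bucket is at most `b`,
          -- which is at most the popped key.
          rcases hkb.eq_or_lt with hkb | hkb
          · have := h.key_le_root hk hkk hkr.2
            rwa [hkb, hri] at this
          · have h1 := h.key_le k hk hkk
            have h2 := h.le_key j hi hik
            rw [hbi] at h2
            have h3 : (bk k : ℝ) + 1 ≤ b := by exact_mod_cast hkb
            linarith
        · exact h.ret_key j hj k hk hkk hkr.2
      slot_lt := by
        intro j hj hjk hjr
        rw [hK'] at hjk
        rw [hmem' _ 3 (by norm_num) (by norm_num), hmem' _ 4 (by norm_num) (by norm_num)]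
        exact h.slot_lt j hj hjk fun hh => hjr (Finset.mem_insert_of_mem hh)
      leaf_slot := by
        intro j hj hjk hjr
        rw [hK'] at hjk
        rw [Finset.mem_insert, not_or] at hjr
        rw [hmem' _ 3 (by norm_num) (by norm_num)]
        have h3 := h.leaf_slot j hj hjk hjr.2
        by_cases h2 : bk j = b
        · rw [h2] at h3 ⊢
          rw [Function.update_self, Function.update_of_ne, h3]
          intro h4
          have h5 := h.leaf_slot i hi hik hir
          rw [hbi, ← hsl, ← h4, h3] at h5
          exact hjr.1 (by omega)
        · rw [Function.update_of_ne h2, h3]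
      leaf := by
        intro b' hb' t
        have key : (b' = b → t ≠ sl) → (lf b' t = 0 ∨ ∃ j < m, lf b' t = j + 1 ∧ Known m s' j ∧
            j ∉ insert i ret ∧ bk j = b' ∧ s'.wordMem (8 * j + 3) = t) := by
          intro hne
          rcases h.leaf b' hb' t with h0 | ⟨j, hj, h1, h2, h3, h4, h5⟩
          · exact Or.inl h0
          · refine Or.inr ⟨j, hj, h1, (hK' j).2 h2, ?_, h4,
              by rw [hmem' _ 3 (by norm_num) (by norm_num), h5]⟩
            rw [Finset.mem_insert, not_or]
            refine ⟨?_, h3⟩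
            rintro rfl
            exact hne (h4.symm.trans hbi) h5.symm
        by_cases hbb : b' = b
        · subst hbb
          rw [Function.update_self]
          by_cases ht : t = sl
          · left; rw [ht, Function.update_self]
          · rw [Function.update_of_ne ht]
            exact key fun _ => ht
        · rw [Function.update_of_ne hbb]
          exact key fun e => absurd e hbb
      tree := by
        intro b' hb'
        by_cases hbb : b' = b
        · subst hbb
          rw [Function.update_self, hX']
          exact hT'
        · rw [Function.update_of_ne hbb, hX']
          have ht := h.tree b' hb'
          have hc' := hmem' b' 4 (by norm_num) (by norm_num)
          refine ⟨by rw [hc']; exact ht.leaf_zero, ?_, ?_⟩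
          · intro l hl q hq hlq
            rw [hc'] at hlq
            rw [← ht.node l hl q hq hlq, hf']
            · rfl
            · intro l' hl' q' hq' e'
              exact hbb (nodeAddr_inj hl hq hl' hq' e').1
            · exact nodeAddr_ne_entry (by norm_num) (by norm_num)
          · rw [hc', ← ht.root, hf']
            · rfl
            · exact fun l _ q _ => (nodeAddr_ne_entry (by norm_num) (by norm_num)).symm
            · omega
      cnt := by
        intro b' hb'
        rw [hmem' _ 4 (by norm_num) (by norm_num)]
        simpa only [hK'] using h.cnt b' hb' }
  · intro r hr8 hr
    rw [f.wordReg r (by omega), f4 r hr8 (by omega) (by omega) (by omega)]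
  · intro r hr
    rw [f.realReg r hr]; rfl

/-! ## The number of buckets -/

/-- This is the test made by `initLoop`: doubling until `Real.log m` is reached finds the exponent
without rounding a real to a word. -/
theorem logExp_le_iff {m k : ℕ} : logExp m ≤ k ↔ Real.log m ≤ 2 ^ k := by
  rw [logExp, Nat.clog_le_iff_le_pow (by norm_num), Nat.ceil_le]
  push_cast
  rfl

/-- From log (x / 2) ≤ x / 2 - 1 and log 2 ≤ 1. It ensures that a bucket size below 2 log m does not
exceed `m`, so that there is at least one bucket. -/
theorem two_mul_log_le {x : ℝ} (hx : 0 < x) : 2 * Real.log x ≤ x := by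
  have h1 : Real.log (x / 2) ≤ x / 2 - 1 := Real.log_le_sub_one_of_pos (by linarith)
  rw [Real.log_div hx.ne' (by norm_num)] at h1
  have h2 : Real.log 2 ≤ 1 := by
    have := Real.log_le_sub_one_of_pos (show (0 : ℝ) < 2 by norm_num)
    linarith
  linarith

theorem two_pow_logExp_lt {m : ℕ} (h : logExp m ≠ 0) : (2 : ℝ) ^ logExp m < 2 * Real.log m := by
  obtain ⟨k, hk⟩ := Nat.exists_eq_succ_of_ne_zero h
  have h1 : ¬ logExp m ≤ k := by omega
  rw [logExp_le_iff, not_le] at h1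
  rw [hk, pow_succ]
  linarith

theorem two_pow_logExp_le {m : ℕ} (hm : 1 ≤ m) : 2 ^ logExp m ≤ m := by
  by_cases h : logExp m = 0
  · rw [h]; simpa using hm
  · have h1 := two_pow_logExp_lt h
    have h2 := two_mul_log_le (x := m) (by exact_mod_cast hm)
    exact_mod_cast (h1.trans_le h2).le

theorem buckets_pos {m : ℕ} (hm : 1 ≤ m) : 0 < buckets m :=
  Nat.div_pos (two_pow_logExp_le hm) (by positivity)

namespace RExp

abbrev add (a b : RExp) : RExp := .op .add a b
abbrev sub (a b : RExp) : RExp := .op .sub a b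
abbrev mul (a b : RExp) : RExp := .op .mul a b
abbrev div (a b : RExp) : RExp := .op .div a b
abbrev num (n : ℕ) : RExp := .cast (.const n)

end RExp

/-! ## The programs -/

open WExp in
def initLoop : Prog :=
  .loop (.realLt 7 6) (block [
    setW 17 (add (reg 17) (reg 17)),
    setR 7 (RExp.cast (reg 17))])

open WExp in
/-- Compute the number of buckets and set up the registers. -/
def initProg : Prog :=
  block [
    setW 5 (add (reg 1) (const 2)),
    setW 17 (const 1),
    setR 6 (.app .log (.cast (reg 1))),
    setR 7 (RExp.cast (reg 17)),
    initLoop,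
    setW 2 (div (reg 1) (reg 17)),
    setW 3 (sub (reg 2) (const 1)),
    setR 2 (RExp.cast (reg 2)),
    stR (const 0) (.sub (.num 0) (.num 1))]

open WExp in
/-- The common beginning of the two programs: initialize if necessary, and draw random numbers. -/
def withDraws (l : List Prog) : Prog :=
  block (.ite (.wordEq 2 18) initProg nop :: .instr (.randReal 3) :: .instr (.randReal 4) ::
    .instr (.randWord 6 3) :: setW 17 (sub (reg 1) (reg 4)) :: .instr (.randWord 7 17) :: l)

/-- Compute the quantile of real register 6, divided by real register 1. -/
def quantileProg : Noise → Prog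
  | .laplace => block [
      setR 7 (.div (.num 1) (.num 2)),
      .ite (.realLt 6 7)
        (setR 0 (.div (.app .log (.mul (.num 2) (.reg 6))) (.reg 1)))
        (setR 0 (.div (.sub (.num 0) (.app .log (.mul (.num 2) (.sub (.num 1) (.reg 6)))))
          (.reg 1)))]
  | .gumbel =>
      setR 0 (.div (.sub (.num 0) (.app .log (.sub (.num 0) (.app .log (.reg 6))))) (.reg 1))

/-- Return the item in register 8. -/
def answerProg (N : Noise) : Prog :=
  block [
    setW 0 (.reg 8),
    setR 6 (.div (.load (.add (.reg 8) (.const 1))) (.cast (.reg 2))),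
    quantileProg N]

/-- Generate a uniform key below the threshold in real register 2, with its bucket. -/
def sampleProg : Prog :=
  block [
    setR 6 (.sub (.reg 2) (.cast (.reg 3))),
    setR 7 (.mul (.reg 3) (.reg 2)),
    .ite (.realLt 6 7)
      (block [setW 10 (.reg 6), setR 5 (.add (.cast (.reg 6)) (.reg 4))])
      (block [setW 10 (.reg 3), setR 5 (.add (.cast (.reg 3)) (.mul (.reg 4) (.reg 6)))])]

open WExp in
/-- The expression for the entry of the stored permutation at position `x`. -/
def permE (t : ℕ) (x : WExp) : WExp := mod (add (load (entry t x)) x) (reg 1)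

def randomProg (N : Noise) : Prog :=
  withDraws [
    setW 8 (.reg 0),
    setW 9 (permE 2 (.reg 8)),
    .ite (.wordLt 9 4) nop (block [sampleProg, insertProg]),
    answerProg N]

/-- A real number that exceeds real register 5 if the search for the next bucket goes on. -/
def scanE : RExp :=
  .sub (.cast (.reg 3)) (.mul (.cast (.load (.entry 5 (.reg 3)))) (.add (.cast (.reg 3)) (.num 2)))

def scanLoop : Prog :=
  .loop (.realLt 5 7) (block [setW 3 (.sub (.reg 3) (.const 1)), setR 7 scanE])

/-- Generate the largest key of the items that are not yet known, or `-1`. -/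
def maxProg : Prog :=
  .ite (.wordLt 4 1)
    (setR 5 (.mul (.reg 2) (.app .exp (.div (.app .log (.reg 3)) (.cast (.reg 17))))))
    (setR 5 (.sub (.num 0) (.num 1)))

/-- Real register 5 holds the candidate V and real register 6 the lower boundary of the bucket
reached. If V lies below, it is discarded and the boundary becomes the threshold; otherwise V
becomes the key of a random unknown item as well as the threshold. -/
def placeProg : Prog :=
  .ite (.realLt 5 6) (setR 2 (.reg 6)) (block [
    setW 9 (.add (.reg 4) (.reg 7)),
    setW 8 (permE 1 (.reg 9)),
    setW 10 (.reg 3),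
    insertProg,
    setR 2 (.reg 5)])

def sortedProg (N : Noise) : Prog :=
  withDraws [
    maxProg,
    setR 7 scanE,
    scanLoop,
    setR 6 (.cast (.reg 3)),
    placeProg,
    popProg,
    answerProg N]

/-- The oracle. -/
def oracle (N : Noise) : Oracle where
  onSorted := sortedProg N
  onRandom := randomProg N

/-! ## The invariant between the accesses -/

/-- The threshold in real register 2 lies in the bucket in word register 3. Unreturned known keys
lie in no higher bucket, and returned keys are not below the threshold, so no unknown key can
overtake a returned one. -/
structure Inv (m : ℕ) (ε : ℝ) (s : Store) (ret : Finset ℕ) (bk : ℕ → ℕ) (lf : ℕ → ℕ → ℕ) : Prop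
    extends Core m s ret bk lf where
  eps : s.realReg 1 = ε
  beta_lt : s.wordReg 3 < buckets m
  beta_le : (s.wordReg 3 : ℝ) ≤ s.realReg 2
  tau_le : s.realReg 2 ≤ s.wordReg 3 + 1
  top : ∀ j < m, Known m s j → j ∉ ret → bk j ≤ s.wordReg 3
  ret_tau : ∀ j ∈ ret, s.realReg 2 ≤ s.realMem (j + 1)

/-- Word register 0 is left free, because a random access writes its item there even before the
initialization has taken place. -/
structure Fresh (m : ℕ) (ε : ℝ) (s : Store) : Prop where
  reg1 : s.wordReg 1 = m
  reg2 : s.wordReg 2 = 0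
  reg4 : s.wordReg 4 = 0
  reg18 : s.wordReg 18 = 0
  eps : s.realReg 1 = ε
  wordMem : s.wordMem = fun _ => 0
  realMem : s.realMem = fun _ => 0

/-- The initialization is part of the first access, so the state before it needs its own
alternative. -/
def Ready (m : ℕ) (ε : ℝ) (s : Store) (ret : Finset ℕ) : Prop :=
  (Fresh m ε s ∧ ret = ∅) ∨ ∃ bk lf, Inv m ε s ret bk lf

/-- The unknown keys are uniformly distributed between `0` and this threshold. -/
def tau (m : ℕ) (s : Store) : ℝ := if s.wordReg 2 = 0 then buckets m else s.realReg 2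

/-- The bucket of the threshold. -/
def beta (m : ℕ) (s : Store) : ℕ := if s.wordReg 2 = 0 then buckets m - 1 else s.wordReg 3

/-- The quantile function for the scale `1`. -/
def Noise.quantile : Noise → ℝ → ℝ
  | .laplace, x => if x < 1 / 2 then Real.log (2 * x) else -Real.log (2 * (1 - x))
  | .gumbel, x => -Real.log (-Real.log x)

/-! ### Lazy initialization and the random draws -/

section Header

variable {m W : ℕ} {ε : ℝ} {s : Store} {ret : Finset ℕ} {bk : ℕ → ℕ} {lf : ℕ → ℕ → ℕ}

theorem Core.reg2_ne_zero (hm : 1 ≤ m) (h : Core m s ret bk lf) : s.wordReg 2 ≠ 0 := by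
  rw [h.reg2]; exact (buckets_pos hm).ne'

theorem Inv.tau_eq (hm : 1 ≤ m) (h : Inv m ε s ret bk lf) : tau m s = s.realReg 2 :=
  if_neg (h.reg2_ne_zero hm)

theorem Inv.beta_eq (hm : 1 ≤ m) (h : Inv m ε s ret bk lf) : beta m s = s.wordReg 3 :=
  if_neg (h.reg2_ne_zero hm)

theorem Inv.congr {s' : Store} (h : Inv m ε s ret bk lf) (e : CoreEq s s')
    (h1 : s'.realReg 1 = s.realReg 1) (h2 : s'.realReg 2 = s.realReg 2)
    (h3 : s'.wordReg 3 = s.wordReg 3) : Inv m ε s' ret bk lf := by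
  have hK : ∀ i, Known m s' i ↔ Known m s i := fun i => by rw [Known, Known, e.wordMem, e.reg4]
  exact
    { toCore := h.toCore.congr e
      eps := by rw [h1, h.eps]
      beta_lt := by rw [h3]; exact h.beta_lt
      beta_le := by rw [h3, h2]; exact h.beta_le
      tau_le := by rw [h3, h2]; exact h.tau_le
      top := by simpa only [hK, h3] using h.top
      ret_tau := by rw [h2, e.realMem]; exact h.ret_tau }

theorem exec_initLoop (hB : Big m (m + 2) W) : ∀ (j k : ℕ) (s : Store), k + j = logExp m →
    s.wordReg 17 = 2 ^ k → s.realReg 7 = 2 ^ k → s.realReg 6 = Real.log m →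
    ∃ s', ExecD W initLoop s (40 * j + 1) s' ∧ s'.wordReg 17 = 2 ^ logExp m ∧
      (∀ r, r ≠ 17 → s'.wordReg r = s.wordReg r) ∧ (∀ r, r ≠ 7 → s'.realReg r = s.realReg r) ∧
      s'.wordMem = s.wordMem ∧ s'.realMem = s.realMem := by
  intro j
  induction j with
  | zero =>
    intro k s hk h17 h7 h6
    refine ⟨s, ExecD.loop_false ?_, by rw [h17, ← hk, add_zero], fun _ _ => rfl, fun _ _ => rfl,
      rfl, rfl⟩
    rw [Test.Holds, h6, h7, not_lt, ← logExp_le_iff]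
    omega
  | succ j ih =>
    intro k s hk h17 h7 h6
    have hW : ∀ k ≤ logExp m, 2 ^ k < W := fun k hk => hB.lt (by
      have := Nat.pow_le_pow_right (n := 2) (by norm_num) hk
      have := two_pow_logExp_le hB.hm
      omega)
    have hk2 : 2 ^ k + 2 ^ k = 2 ^ (k + 1) := by rw [pow_succ]; omega
    set s₁ := s.setWord 17 (2 ^ (k + 1)) with hs₁
    set s₂ := s₁.setReal 7 (2 ^ (k + 1)) with hs₂
    have e17 := WExp.eval_reg h17 (hW k (by omega))
    have e₁ : ExecD W _ s _ s₁ := execD_setW (r := 17)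
      ((WExp.eval_add e17 e17 (by rw [hk2]; exact hW _ (by omega))).trans hk2) (hW _ (by omega))
    have e₂ : ExecD W (setR 7 (RExp.cast (.reg 17))) s₁ _ s₂ := execD_setR (by
      rw [RExp.eval, WExp.eval_reg (v := 2 ^ (k + 1)) (by simp [hs₁]) (hW _ (by omega))]
      push_cast; rfl)
    obtain ⟨s', e, h17', hw, hr, hwm, hrm⟩ := ih (k + 1) s₂ (by omega) (by simp [hs₂, hs₁])
      (by simp [hs₂]) (by simp [hs₂, hs₁, h6])
    refine ⟨s', (ExecD.loop_true (s₁ := s₂) ?_ (e₁.cons (e₂.cons execD_nil)) e).mono ?_, h17',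
      fun r hr' => by rw [hw r hr']; simp [hs₂, hs₁, hr'],
      fun r hr' => by rw [hr r hr']; simp [hs₂, hs₁, hr'], hwm, hrm⟩
    · rw [Test.Holds, h6, h7, ← not_le, ← logExp_le_iff]
      omega
    · simp [WExp.cost, RExp.cost]
      omega

theorem permQ_zero {i : ℕ} (hi : i < m) : permQ m (fun _ => 0) i = i := by
  simp [permQ, Nat.mod_eq_of_lt hi]

theorem permP_zero {i : ℕ} (hi : i < m) : permP m (fun _ => 0) i = i := by
  simp [permP, Nat.mod_eq_of_lt hi]

theorem Fresh.exec_init (hB : Big m (m + 2) W) (h : Fresh m ε s) :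
    ∃ s', ExecD W initProg s (200 + 40 * logExp m) s' ∧
      Inv m ε s' ∅ (fun _ => 0) (fun _ _ => 0) ∧ s'.realReg 2 = buckets m ∧
      s'.wordReg 3 = buckets m - 1 ∧ s'.wordReg 4 = 0 ∧ s'.wordReg 0 = s.wordReg 0 ∧
      s'.wordMem = s.wordMem := by
  have hm := hB.hm
  have hlt : ∀ {v}, v < m + 3 → v < W := fun hv => hB.lt (by omega)
  have hbp := buckets_pos hm
  have hbm := buckets_le m
  set s₁ := s.setWord 5 (m + 2) with hs₁
  set s₂ := s₁.setWord 17 1 with hs₂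
  set s₃ := s₂.setReal 6 (Real.log m) with hs₃
  set s₄ := s₃.setReal 7 1 with hs₄
  have e₁ : ExecD W _ s _ s₁ := execD_setW (r := 5) (WExp.eval_add (WExp.eval_reg h.reg1
    (hlt (by omega))) (WExp.eval_const (hlt (by omega))) (hlt (by omega))) (hlt (by omega))
  have e₂ : ExecD W _ s₁ _ s₂ := execD_setW (r := 17) (WExp.eval_const (hlt (by omega)))
    (hlt (by omega))
  have e₃ : ExecD W (setR 6 (.app .log (.cast (.reg 1)))) s₂ _ s₃ := execD_setR (by
    rw [RExp.eval, RExp.eval, WExp.eval_reg (v := m) (by simp [hs₂, hs₁, h.reg1]) (hlt (by omega))]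
    rfl)
  have e₄ : ExecD W (setR 7 (RExp.cast (.reg 17))) s₃ _ s₄ := execD_setR (by
    rw [RExp.eval, WExp.eval_reg (v := 1) (by simp [hs₃, hs₂]) (hlt (by omega))]
    norm_num)
  obtain ⟨s₅, e₅, h17, hw, hr, hwm, hrm⟩ := exec_initLoop hB (logExp m) 0 s₄ (by omega)
    (by simp [hs₄, hs₃, hs₂]) (by simp [hs₄]) (by simp [hs₄, hs₃])
  have hpl := two_pow_logExp_le hm
  set s₆ := s₅.setWord 2 (buckets m) with hs₆
  set s₇ := s₆.setWord 3 (buckets m - 1) with hs₇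
  set s₈ := s₇.setReal 2 (buckets m) with hs₈
  set s₉ := s₈.putReal 0 (-1) with hs₉
  have e₆ : ExecD W _ s₅ _ s₆ := execD_setW (r := 2) (WExp.eval_div (WExp.eval_reg (r := 1) (v := m)
    (by rw [hw _ (by norm_num)]; simp [hs₄, hs₃, hs₂, hs₁, h.reg1]) (hlt (by omega)))
    (WExp.eval_reg h17 (hlt (by omega))) (hlt (by omega))) (hlt (lt_of_le_of_lt hbm (by omega)))
  have e₇ : ExecD W _ s₆ _ s₇ := execD_setW (r := 3) (WExp.eval_sub (WExp.eval_reg (r := 2)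
    (by simp [hs₆]) (hlt (by omega))) (WExp.eval_const (hlt (by omega))) (hlt (by omega)))
    (hlt (by omega))
  have e₈ : ExecD W (setR 2 (RExp.cast (.reg 2))) s₇ _ s₈ := execD_setR (by
    rw [RExp.eval, WExp.eval_reg (v := buckets m) (by simp [hs₇, hs₆]) (hlt (by omega))])
  have e₉ : ExecD W (stR (.const 0) (.sub (.num 0) (.num 1))) s₈ _ s₉ := execD_stR
    (WExp.eval_const (hlt (by omega))) (by
      simp only [RExp.eval, RealOp.eval]
      rw [WExp.eval_const (hlt (by omega)), WExp.eval_const (hlt (by omega))]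
      norm_num)
  have hwm' : s₉.wordMem = fun _ => 0 := hwm.trans h.wordMem
  have hr4 : s₉.wordReg 4 = 0 := by
    simp [hs₉, hs₈, hs₇, hs₆, hw, hs₄, hs₃, hs₂, hs₁, h.reg4]
  have hK : ∀ j, ¬ Known m s₉ j := fun j hj => by rw [Known, hr4] at hj; omega
  refine ⟨s₉, (e₁.cons (e₂.cons (e₃.cons (e₄.cons (e₅.cons (e₆.cons (e₇.cons (e₈.cons
    (e₉.cons execD_nil))))))))).mono ?_, ?_, by simp [hs₉, hs₈], by simp [hs₉, hs₈, hs₇], hr4,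
    by simp [hs₉, hs₈, hs₇, hs₆, hw, hs₄, hs₃, hs₂, hs₁], hwm⟩
  · simp [WExp.cost, RExp.cost]
    omega
  exact
    { reg1 := by simp [hs₉, hs₈, hs₇, hs₆, hw, hs₄, hs₃, hs₂, hs₁, h.reg1]
      reg2 := by simp [hs₉, hs₈, hs₇, hs₆]
      reg5 := by simp [hs₉, hs₈, hs₇, hs₆, hw, hs₄, hs₃, hs₂, hs₁]
      reg18 := by simp [hs₉, hs₈, hs₇, hs₆, hw, hs₄, hs₃, hs₂, hs₁, h.reg18]
      reg4 := by omega
      key0 := by simp [hs₉]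
      raw := fun x => by rw [hwm']; constructor <;> simp <;> omega
      QP := fun x hx => by rw [hwm', permP_zero hx, permQ_zero hx]
      PQ := fun x hx => by rw [hwm', permQ_zero hx, permP_zero hx]
      bk_lt := fun i hi hk => absurd hk (hK i)
      le_key := fun i hi hk => absurd hk (hK i)
      key_le := fun i hi hk => absurd hk (hK i)
      ret_known := by simp
      ret_key := by simp
      slot_lt := fun i hi hk => absurd hk (hK i)
      leaf_slot := fun i hi hk => absurd hk (hK i)
      leaf := fun b _ t => Or.inl rfl
      -- Zeroed memory already is a family of empty trees.
      tree := fun b _ => by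
        rw [hwm']
        exact ⟨fun _ _ => rfl, fun l _ q _ _ => (best_eq_zero fun _ _ => rfl).symm,
          (best_eq_zero fun _ _ => rfl).symm⟩
      cnt := fun b _ => (congrFun hwm' _).trans_le (Nat.zero_le _)
      eps := by simp [hs₉, hs₈, hs₇, hs₆, hr, hs₄, hs₃, hs₂, hs₁, h.eps]
      beta_lt := by simp [hs₉, hs₈, hs₇]; omega
      beta_le := by simp [hs₉, hs₈, hs₇]
      tau_le := by
        simp only [hs₉, hs₈, hs₇, putReal_realReg, setReal_realReg, putReal_wordReg,
          setReal_wordReg, setWord_wordReg, if_true]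
        exact_mod_cast (show buckets m ≤ buckets m - 1 + 1 by omega)
      top := fun i hi hk => absurd hk (hK i)
      ret_tau := by simp }

theorem Ready.exec_start (hB : Big m (m + 2) W) (h : Ready m ε s ret) :
    ∃ s' bk lf, ExecD W (.ite (.wordEq 2 18) initProg nop) s (201 + 40 * logExp m) s' ∧
      Inv m ε s' ret bk lf ∧ s'.realReg 2 = tau m s ∧ s'.wordReg 3 = beta m s ∧
      s'.wordReg 4 = s.wordReg 4 ∧ s'.wordReg 0 = s.wordReg 0 ∧ s'.wordMem = s.wordMem ∧
      (∀ j, Known m s j → s'.realMem (j + 1) = s.realMem (j + 1)) := by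
  rcases h with ⟨h, rfl⟩ | ⟨bk, lf, h⟩
  · obtain ⟨s', e, hI, h2, h3, h4, h0, hm⟩ := h.exec_init hB
    refine ⟨s', _, _, (ExecD.ite_true (by rw [Test.Holds, h.reg2, h.reg18]) e).mono (by omega), hI,
      by rw [h2, tau, if_pos h.reg2], by rw [h3, beta, if_pos h.reg2], by rw [h4, h.reg4], h0, hm, ?_⟩
    intro j hj
    rw [Known, h.reg4] at hj
    omega
  · refine ⟨s, bk, lf, (ExecD.ite_false ?_ execD_nop).mono (by omega), h, (h.tau_eq hB.hm).symm,
      (h.beta_eq hB.hm).symm, rfl, rfl, rfl, fun _ _ => rfl⟩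
    rw [Test.Holds, h.reg18]
    exact h.reg2_ne_zero hB.hm

/-- The store after the random draws. -/
def drawn (m : ℕ) (s : Store) (a b c d : unitInterval) : Store :=
  ((((s.setReal 3 a).setReal 4 b).setWord 6 (randIndex c (s.wordReg 3))).setWord 17
    (m - s.wordReg 4)).setWord 7 (randIndex d (m - s.wordReg 4))

/-- `t₀` is fixed by the store, and the offsets are the time steps of the four draws; before the
last one, `setW 17` takes thirteen steps. As the remaining program is deterministic, the outcome of
an access depends on four fixed coordinates of `u` only. -/
theorem Ready.exec_withDraws (hB : Big m (m + 2) W) (h : Ready m ε s ret) (l : List Prog) :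
    ∃ s₀ bk lf t₀, Inv m ε s₀ ret bk lf ∧ s₀.realReg 2 = tau m s ∧ s₀.wordReg 3 = beta m s ∧
      s₀.wordReg 4 = s.wordReg 4 ∧ s₀.wordReg 0 = s.wordReg 0 ∧ s₀.wordMem = s.wordMem ∧
      (∀ j, Known m s j → s₀.realMem (j + 1) = s.realMem (j + 1)) ∧
      ∀ u k s', ExecD W (block l) (drawn m s₀ (u (t₀ + 1)) (u (t₀ + 3)) (u (t₀ + 5)) (u (t₀ + 21))) k s' →
        ∃ t ≤ 300 + 40 * logExp m + k, ExecS W u (withDraws l) 0 s t s' := by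
  obtain ⟨s₀, bk, lf, ⟨d, hd, e⟩, hI, h2, h3, h4, h0, hwm, hrm⟩ := h.exec_start hB
  refine ⟨s₀, bk, lf, 0 + 1 + d, hI, h2, h3, h4, h0, hwm, hrm, fun u k s' hk => ?_⟩
  obtain ⟨d', hd', e'⟩ := hk
  refine ⟨_, ?_, (e u _).seq (execS_randReal.seq (execS_randReal.seq ((execS_randWord).seq
    ((execS_setW (WExp.eval_sub (WExp.eval_reg (v := m) ?_ ?_) (WExp.eval_reg (v := s₀.wordReg 4)
      ?_ ?_) ?_) ?_).seq ((execS_randWord).seq (e' u _))))))⟩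
  · simp only [WExp.cost]
    omega
  · simp [hI.reg1]
  · exact hB.lt (by omega)
  · simp
  · have := hI.reg4
    exact hB.lt (by omega)
  · exact hB.lt (by omega)
  · exact hB.lt (by omega)

end Header

/-! ## Returning an answer -/

theorem exec_quantileProg {W : ℕ} (hW : 2 < W) {s : Store} {ε x : ℝ} (N : Noise)
    (h1 : s.realReg 1 = ε) (h6 : s.realReg 6 = x) :
    ∃ s', ExecD W (quantileProg N) s 100 s' ∧ s'.realReg 0 = N.quantile x / ε ∧
      s'.wordReg = s.wordReg ∧ s'.wordMem = s.wordMem ∧ s'.realMem = s.realMem ∧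
      s'.realReg 1 = s.realReg 1 ∧ s'.realReg 2 = s.realReg 2 := by
  have hnum : ∀ {n : ℕ} {t : Store}, n ≤ 2 → (RExp.num n).eval W t = n := fun hn => by
    rw [RExp.eval, WExp.eval_const (by omega)]
  cases N with
  | laplace =>
    set s₁ := s.setReal 7 (1 / 2) with hs₁
    have e₁ : ExecD W (setR 7 (.div (.num 1) (.num 2))) s _ s₁ := execD_setR (by
      rw [RExp.eval, hnum (by norm_num), hnum (by norm_num)]
      simp [RealOp.eval])
    by_cases hx : x < 1 / 2
    · refine ⟨_, (e₁.cons ((ExecD.ite_true (by simpa [Test.Holds, hs₁, h6] using hx)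
        (execD_setR (v := Real.log (2 * x) / ε) ?_)).cons execD_nil)).mono ?_,
        by rw [Noise.quantile, if_pos hx]; simp, rfl, rfl, rfl, ?_, ?_⟩
      · simp only [RExp.eval, RealOp.eval, RealFun.eval]
        rw [WExp.eval_const (by omega)]
        simp [hs₁, h1, h6]
      · simp [RExp.cost, WExp.cost]
      · simp [hs₁]
      · simp [hs₁]
    · refine ⟨_, (e₁.cons ((ExecD.ite_false (by simpa [Test.Holds, hs₁, h6] using hx)
        (execD_setR (v := -Real.log (2 * (1 - x)) / ε) ?_)).cons execD_nil)).mono ?_,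
        by rw [Noise.quantile, if_neg hx]; simp, rfl, rfl, rfl, ?_, ?_⟩
      · simp only [RExp.eval, RealOp.eval, RealFun.eval]
        rw [WExp.eval_const (by omega), WExp.eval_const (by omega), WExp.eval_const (by omega)]
        simp [hs₁, h1, h6]
      · simp [RExp.cost, WExp.cost]
      · simp [hs₁]
      · simp [hs₁]
  | gumbel =>
    refine ⟨_, (execD_setR (v := -Real.log (-Real.log x) / ε) ?_).mono ?_,
        by simp [Noise.quantile], rfl, rfl, rfl, by simp, by simp⟩
    · simp only [RExp.eval, RealOp.eval, RealFun.eval]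
      rw [WExp.eval_const (by omega)]
      simp [h1, h6]
    · simp [RExp.cost, WExp.cost]

theorem Inv.exec_answer {m W : ℕ} {ε : ℝ} {s : Store} {ret : Finset ℕ} {bk : ℕ → ℕ}
    {lf : ℕ → ℕ → ℕ} (hB : Big m (m + 2) W) (h : Inv m ε s ret bk lf) (N : Noise) {i : ℕ}
    (hi : i < m) (h8 : s.wordReg 8 = i) :
    ∃ s', ExecD W (answerProg N) s 200 s' ∧ Inv m ε s' ret bk lf ∧ s'.wordReg 0 = i ∧
      s'.realReg 0 = N.quantile (s.realMem (i + 1) / buckets m) / ε ∧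
      CoreEq s s' ∧ s'.realReg 2 = s.realReg 2 ∧ s'.wordReg 3 = s.wordReg 3 := by
  have hlt : ∀ {v}, v < m + 3 → v < W := fun hv => hB.lt (by omega)
  have hbm := buckets_le m
  set s₁ := s.setWord 0 i with hs₁
  set s₂ := s₁.setReal 6 (s.realMem (i + 1) / buckets m) with hs₂
  have e₁ : ExecD W _ s _ s₁ := execD_setW (r := 0) (WExp.eval_reg h8 (hlt (by omega)))
    (hlt (by omega))
  have e₂ : ExecD W (setR 6 (.div (.load (.add (.reg 8) (.const 1))) (.cast (.reg 2)))) s₁ _ s₂ :=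
    execD_setR (by
      rw [RExp.eval, RExp.eval, RExp.eval, WExp.eval_add (WExp.eval_reg (v := i)
        (by simp [hs₁, h8]) (hlt (by omega))) (WExp.eval_const (hlt (by omega))) (hlt (by omega)),
        WExp.eval_reg (v := buckets m) (by simp [hs₁, h.reg2]) (hlt (by omega))]
      rfl)
  obtain ⟨s', e, h0, hw, hwm, hrm, hr1, hr2⟩ := exec_quantileProg (hlt (by have := hB.hm; omega))
    (s := s₂) (ε := ε) (x := s.realMem (i + 1) / buckets m) N (by simp [hs₂, hs₁, h.eps])
    (by simp [hs₂])
  have hc : CoreEq s s' := ⟨by rw [hw]; rfl, by rw [hw]; rfl, by rw [hw]; rfl, by rw [hw]; rfl,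
    by rw [hw]; rfl, hwm, hrm⟩
  have h3 : s'.wordReg 3 = s.wordReg 3 := by rw [hw]; rfl
  refine ⟨s', (e₁.cons (e₂.cons (e.cons execD_nil))).mono ?_, h.congr hc (by rw [hr1]; rfl)
    (by rw [hr2]; rfl) h3, by rw [hw]; simp [hs₂, hs₁], h0, hc, by rw [hr2]; rfl, h3⟩
  simp [WExp.cost, RExp.cost]

/-! ## Completions -/

/-- The keys of all items, when the unknown ones are the multiples by `x` of the threshold `τ`. -/
def complWith (m : ℕ) (s : Store) (τ : ℝ) (x : Fin m → unitInterval) (i : Fin m) : ℝ :=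
  if Known m s i then s.realMem (i + 1) else τ * x i

/-- The keys of all items, when the unknown ones are the multiples by `x` of the threshold. -/
def compl (m : ℕ) (s : Store) (x : Fin m → unitInterval) : Fin m → ℝ := complWith m s (tau m s) x

open Classical in
/-- The number of keys in bucket `b`. -/
def load (m b : ℕ) (y : Fin m → ℝ) : ℕ :=
  -- The bucket is closed here and open in `emptyCount`, so keys on a boundary can only increase
  -- either count.
  (Finset.univ.filter fun j => (b : ℝ) ≤ y j ∧ y j ≤ b + 1).card

open Classical in
/-- The number of buckets without keys. -/
def emptyCount (m : ℕ) (y : Fin m → ℝ) : ℕ :=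
  ((Finset.range (buckets m)).filter fun b : ℕ => ∀ j, ¬ ((b : ℝ) < y j ∧ y j < b + 1)).card

/-! ### Random accesses -/

section Specs

variable {m W : ℕ} {ε : ℝ} {s : Store} {ret : Finset ℕ} {bk : ℕ → ℕ} {lf : ℕ → ℕ → ℕ}

/-- Used slots belong to known items, and a completion leaves known keys as they are. So the height
of a tree can be charged to the completed keys, for every `x`. -/
theorem Core.cnt_le_load (h : Core m s ret bk lf) {b : ℕ} (hb : b < buckets m)
    (x : Fin m → unitInterval) : s.wordMem (8 * b + 4) ≤ load m b (compl m s x) := by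
  classical
  refine (h.cnt b hb).trans ?_
  rw [load, ← Finset.card_map Fin.valEmbedding]
  refine Finset.card_le_card fun j hj => ?_
  rw [Finset.mem_filter, Finset.mem_range] at hj
  obtain ⟨hj, hjk, rfl⟩ := hj
  rw [Finset.mem_map]
  refine ⟨⟨j, hj⟩, ?_, rfl⟩
  rw [Finset.mem_filter, compl, complWith, if_pos hjk]
  exact ⟨Finset.mem_univ _, h.le_key j hj hjk, h.key_le j hj hjk⟩

theorem CoreEq.known_iff {s' : Store} (e : CoreEq s s') (i : ℕ) : Known m s' i ↔ Known m s i := by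
  rw [Known, Known, e.wordMem, e.reg4]

theorem CoreEq.complWith_eq {s' : Store} (e : CoreEq s s') (τ : ℝ) :
    complWith m s' τ = complWith m s τ := by
  funext x i
  simp only [complWith, e.known_iff, e.realMem]

/-- The key of a new item, for the uniform numbers `a`, `b` and the random bucket `w`. -/
def sampleKey (β : ℕ) (τ : ℝ) (a b : unitInterval) (w : ℕ) : ℝ :=
  if τ - β < a * τ then w + b else β + b * (τ - β)

/-- The bucket of a new item. -/
def sampleBucket (β : ℕ) (τ : ℝ) (a : unitInterval) (w : ℕ) : ℕ :=
  if τ - β < a * τ then w else β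

theorem sampleKey_mem {β : ℕ} {τ : ℝ} (h1 : (β : ℝ) ≤ τ) (h2 : τ ≤ β + 1) (a b c : unitInterval) :
    let w := randIndex c β
    sampleBucket β τ a w ≤ β ∧ (sampleBucket β τ a w : ℝ) ≤ sampleKey β τ a b w ∧
      sampleKey β τ a b w ≤ sampleBucket β τ a w + 1 ∧ sampleKey β τ a b w ≤ τ := by
  intro w
  have hb0 := b.2.1
  have hb1 := b.2.2
  have ha1 := a.2.2
  have hβ : (0 : ℝ) ≤ β := Nat.cast_nonneg _
  rw [sampleKey, sampleBucket]
  split_ifs with h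
  -- For `β = 0` this branch would require τ < a τ, which is impossible; so the default value of
  -- `randIndex` for an empty range is never used.
  · have hpos : 0 < β := by
      rcases Nat.eq_zero_or_pos β with h0 | h0
      · rw [h0] at h h1
        simp only [Nat.cast_zero, sub_zero] at h h1
        nlinarith
      · exact h0
    have hw : w ≤ β - 1 := min_le_right _ _
    have hw' : (w : ℝ) + 1 ≤ β := by exact_mod_cast (show w + 1 ≤ β by omega)
    exact ⟨by omega, by linarith, by linarith, by linarith⟩
  · exact ⟨le_rfl, by nlinarith, by nlinarith, by nlinarith⟩

theorem exec_sampleProg (hB : Big m (m + 2) W) {β w : ℕ} {τ : ℝ} {a b : unitInterval}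
    (h3 : s.wordReg 3 = β) (h6 : s.wordReg 6 = w) (hβ : β < m) (hw : w < m)
    (hr2 : s.realReg 2 = τ) (hr3 : s.realReg 3 = a) (hr4 : s.realReg 4 = b) :
    ∃ s', ExecD W sampleProg s 150 s' ∧ s'.wordReg 10 = sampleBucket β τ a w ∧
      s'.realReg 5 = sampleKey β τ a b w ∧ (∀ r, r ≠ 10 → s'.wordReg r = s.wordReg r) ∧
      (∀ r < 5, s'.realReg r = s.realReg r) ∧ s'.wordMem = s.wordMem ∧ s'.realMem = s.realMem := by
  have hlt : ∀ {v}, v < m + 3 → v < W := fun hv => hB.lt (by omega)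
  set s₁ := s.setReal 6 (τ - β) with hs₁
  set s₂ := s₁.setReal 7 (a * τ) with hs₂
  have e₁ : ExecD W (setR 6 (.sub (.reg 2) (.cast (.reg 3)))) s _ s₁ := execD_setR (by
    simp only [RExp.eval, RealOp.eval]
    rw [WExp.eval_reg h3 (hlt (by omega)), hr2])
  have e₂ : ExecD W (setR 7 (.mul (.reg 3) (.reg 2))) s₁ _ s₂ := execD_setR (by
    simp [RExp.eval, RealOp.eval, hs₁, hr3, hr2])
  by_cases hc : τ - β < a * τ
  · set s₃ := s₂.setWord 10 w with hs₃
    set s₄ := s₃.setReal 5 (w + b) with hs₄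
    have e₃ : ExecD W _ s₂ _ s₃ := execD_setW (r := 10) (WExp.eval_reg (r := 6) (v := w)
      (by simp [hs₂, hs₁, h6]) (hlt (by omega))) (hlt (by omega))
    have e₄ : ExecD W (setR 5 (.add (.cast (.reg 6)) (.reg 4))) s₃ _ s₄ := execD_setR (by
      simp only [RExp.eval, RealOp.eval]
      rw [WExp.eval_reg (v := w) (by simp [hs₃, hs₂, hs₁, h6]) (hlt (by omega))]
      simp [hs₃, hs₂, hs₁, hr4])
    refine ⟨s₄, (e₁.cons (e₂.cons ((ExecD.ite_true (by simpa [Test.Holds, hs₂, hs₁] using hc)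
      (e₃.cons (e₄.cons execD_nil))).cons execD_nil))).mono (by simp [RExp.cost, WExp.cost]), ?_, ?_,
      ?_, ?_, rfl, rfl⟩
    · simp [hs₄, hs₃, sampleBucket, if_pos hc]
    · simp [hs₄, sampleKey, if_pos hc]
    · intro r hr; simp [hs₄, hs₃, hs₂, hs₁, hr]
    · intro r hr
      have : r ≠ 5 ∧ r ≠ 6 ∧ r ≠ 7 := by omega
      simp [hs₄, hs₃, hs₂, hs₁, this]
  · set s₃ := s₂.setWord 10 β with hs₃
    set s₄ := s₃.setReal 5 (β + b * (τ - β)) with hs₄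
    have e₃ : ExecD W _ s₂ _ s₃ := execD_setW (r := 10) (WExp.eval_reg (r := 3) (v := β)
      (by simp [hs₂, hs₁, h3]) (hlt (by omega))) (hlt (by omega))
    have e₄ : ExecD W (setR 5 (.add (.cast (.reg 3)) (.mul (.reg 4) (.reg 6)))) s₃ _ s₄ :=
      execD_setR (by
        simp only [RExp.eval, RealOp.eval]
        rw [WExp.eval_reg (v := β) (by simp [hs₃, hs₂, hs₁, h3]) (hlt (by omega))]
        simp [hs₃, hs₂, hs₁, hr4])
    refine ⟨s₄, (e₁.cons (e₂.cons ((ExecD.ite_false (by simpa [Test.Holds, hs₂, hs₁] using hc)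
      (e₃.cons (e₄.cons execD_nil))).cons execD_nil))).mono (by simp [RExp.cost, WExp.cost]), ?_, ?_,
      ?_, ?_, rfl, rfl⟩
    · simp [hs₄, hs₃, sampleBucket, if_neg hc]
    · simp [hs₄, sampleKey, if_neg hc]
    · intro r hr; simp [hs₄, hs₃, hs₂, hs₁, hr]
    · intro r hr
      have : r ≠ 5 ∧ r ≠ 6 ∧ r ≠ 7 := by omega
      simp [hs₄, hs₃, hs₂, hs₁, this]

theorem Ready.setWord_zero (h : Ready m ε s ret) (v : ℕ) : Ready m ε (s.setWord 0 v) ret := by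
  rcases h with ⟨h, rfl⟩ | ⟨bk, lf, h⟩
  · exact Or.inl ⟨⟨by simp [h.reg1], by simp [h.reg2], by simp [h.reg4], by simp [h.reg18], h.eps,
      h.wordMem, h.realMem⟩, rfl⟩
  · exact Or.inr ⟨bk, lf, h.congr ⟨by simp, by simp, by simp, by simp, by simp, rfl, rfl⟩ rfl rfl
      (by simp)⟩

theorem drawn_coreEq (m : ℕ) (s : Store) (a b c d : unitInterval) : CoreEq s (drawn m s a b c d) :=
  ⟨by simp [drawn], by simp [drawn], by simp [drawn], by simp [drawn], by simp [drawn], rfl, rfl⟩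

/-- What an access for the item `i` does to the store. -/
structure RandomPost (m : ℕ) (N : Noise) (ε : ℝ) (s : Store) (ret : Finset ℕ) (i : Fin m) (t : ℕ)
    (a b c : unitInterval) (s' : Store) : Prop where
  inv : ∃ bk lf, Inv m ε s' ret bk lf
  item : s'.wordReg 0 = i
  value : s'.realReg 0 = N.quantile (s'.realMem (i + 1) / buckets m) / ε
  known : Known m s' i
  compl_eq : ∀ x, compl m s' x = if Known m s i then compl m s x else
    Function.update (compl m s x) i
      (sampleKey (beta m s) (tau m s) a b (randIndex c (beta m s)))
  time : ∃ b < buckets m, ∀ x, t ≤ 2000 + 40 * logExp m +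
    402 * Nat.size (load m b (compl m s' x)) + 60 * emptyCount m (compl m s' x)

theorem eval_permE (hB : Big m (m + 2) W) {t x : ℕ} {e : WExp} (he : e.eval W s = x) (hx : x < m)
    (ht : t < 8) (h1 : s.wordReg 1 = m) (hraw : s.wordMem (8 * x + t) < m) :
    (permE t e).eval W s = (s.wordMem (8 * x + t) + x) % m :=
  WExp.eval_mod (WExp.eval_add (WExp.eval_load (hB.eval_entry he (by omega) ht) rfl) he
    (hB.lt (by omega))) (WExp.eval_reg h1 (hB.lt (by omega))) (hB.lt (by omega))

/-- A known item is only looked up. The key of an unknown one is at most τ, hence at most every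
returned key, and its bucket is at most that of τ; so the insertion keeps the invariant with the
same threshold, and the completion changes in one coordinate only. -/
theorem Ready.exec_random (hB : Big m (m + 2) W) (h : Ready m ε s ret) (N : Noise) (i : Fin m) :
    ∃ t₀, ∀ u, ∃ t s', ExecS W u (randomProg N) 0 (s.setWord 0 i) t s' ∧
      RandomPost m N ε s ret i t (u (t₀ + 1)) (u (t₀ + 3)) (u (t₀ + 5)) s' := by
  have hm := hB.hm
  have hlt : ∀ {v}, v < m + 3 → v < W := fun hv => hB.lt (by omega)
  have hi := i.2
  obtain ⟨s₀, bk, lf, t₀, hI, hτ, hβ, hr, hr0, hwm, hrm, hdraw⟩ :=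
    (h.setWord_zero i).exec_withDraws hB [
      setW 8 (.reg 0),
      setW 9 (permE 2 (.reg 8)),
      .ite (.wordLt 9 4) nop (block [sampleProg, insertProg]),
      answerProg N]
  refine ⟨t₀, fun u => ?_⟩
  replace hdraw := hdraw u
  have htau : tau m (s.setWord 0 i) = tau m s := by simp [tau]
  have hbeta : beta m (s.setWord 0 i) = beta m s := by simp [beta]
  rw [htau] at hτ
  rw [hbeta] at hβ
  rw [setWord_wordReg, if_neg (by norm_num)] at hr
  rw [setWord_wordReg, if_pos rfl] at hr0
  rw [setWord_wordMem] at hwm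
  have hK : ∀ j, Known m s₀ j ↔ Known m s j := fun j => by rw [Known, Known, hr, hwm]
  have hcompl : ∀ x, compl m s₀ x = compl m s x := fun x => by
    funext j
    rw [compl, compl, complWith, complWith, hI.tau_eq hm, hτ]
    by_cases hj : Known m s j
    · rw [if_pos ((hK j).2 hj), if_pos hj, hrm j (by simpa [Known] using hj)]; rfl
    · rw [if_neg (fun hh => hj ((hK j).1 hh)), if_neg hj]
  generalize u (t₀ + 1) = a, u (t₀ + 3) = b, u (t₀ + 5) = c, u (t₀ + 21) = d at hdraw
  set s₁ := drawn m s₀ a b c d with hs₁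
  have hc₁ : CoreEq s₀ s₁ := drawn_coreEq _ _ _ _ _ _
  have hI₁ : Inv m ε s₁ ret bk lf := hI.congr hc₁ (by simp [hs₁, drawn]) (by simp [hs₁, drawn])
    (by simp [hs₁, drawn])
  set p := permQ m s₁.wordMem i with hp
  have hpm : p < m := permQ_lt hm _ _
  set s₂ := s₁.setWord 8 i with hs₂
  set s₃ := s₂.setWord 9 p with hs₃
  have e₂ : ExecD W _ s₁ _ s₂ := execD_setW (r := 8) (WExp.eval_reg (r := 0) (v := i)
    (by simp [hs₁, drawn, hr0]) (hlt (by omega))) (hlt (by omega))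
  have e₃ : ExecD W (setW 9 (permE 2 (.reg 8))) s₂ _ s₃ := execD_setW (r := 9)
    (eval_permE hB (WExp.eval_reg (r := 8) (v := i) (by simp [hs₂]) (hlt (by omega))) hi
      (by norm_num) (by simp [hs₂, hI₁.reg1]) ((hI₁.raw i).2)) (hlt (by omega))
  have hc₃ : CoreEq s₁ s₃ := ⟨by simp [hs₃, hs₂], by simp [hs₃, hs₂], by simp [hs₃, hs₂],
    by simp [hs₃, hs₂], by simp [hs₃, hs₂], rfl, rfl⟩
  have hI₃ : Inv m ε s₃ ret bk lf := hI₁.congr hc₃ rfl rfl (by simp [hs₃, hs₂])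
  have h13 : CoreEq s₀ s₃ := ⟨hc₃.reg1.trans hc₁.reg1, hc₃.reg2.trans hc₁.reg2,
    hc₃.reg4.trans hc₁.reg4, hc₃.reg5.trans hc₁.reg5, hc₃.reg18.trans hc₁.reg18, rfl, rfl⟩
  have hτ₃ : s₃.realReg 2 = tau m s := by rw [← hτ]; simp [hs₃, hs₂, hs₁, drawn]
  have hβ₃ : s₃.wordReg 3 = beta m s := by rw [← hβ]; simp [hs₃, hs₂, hs₁, drawn]
  have hcomp₃ : ∀ x, compl m s₃ x = compl m s x := fun x => by
    rw [← hcompl, compl, compl, h13.complWith_eq, hI₃.tau_eq hm, hI.tau_eq hm, hτ₃, hτ]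
  have hK₃ : ∀ j, Known m s₃ j ↔ Known m s j := fun j => (h13.known_iff j).trans (hK j)
  have htest : Test.Holds s₃ (.wordLt 9 4) ↔ Known m s i := by
    rw [← hK₃, Test.Holds, show s₃.wordReg 9 = p by simp [hs₃]]
    exact Iff.rfl
  by_cases hk : Known m s i
  · obtain ⟨s', e', hI', h0, h0', hc', h2', h3'⟩ := hI₃.exec_answer hB N hi
      (by simp [hs₃, hs₂])
    obtain ⟨t, ht, e⟩ := hdraw _ s' (e₂.cons (e₃.cons ((ExecD.ite_true (htest.2 hk) execD_nop).cons (e'.cons execD_nil))))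
    -- No tree is touched, so any bucket serves as a witness for the time bound.
    refine ⟨t, s', e, ⟨bk, lf, hI'⟩, h0, ?_, (hc'.known_iff i).2 ((hK₃ i).2 hk), ?_,
      0, buckets_pos hm, fun x => ?_⟩
    · rw [h0', hc'.realMem]
    · intro x
      rw [if_pos hk, ← hcomp₃, compl, compl, hc'.complWith_eq, hI'.tau_eq hm, hI₃.tau_eq hm, h2']
    · simp only [WExp.cost, permE, WExp.entry] at ht
      omega
  · have hβm : beta m s < m := by
      have := hI₃.beta_lt
      rw [hβ₃] at this
      exact this.trans_le (buckets_le m)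
    have hw : randIndex c (beta m s) < m :=
      lt_of_le_of_lt (min_le_right _ _) (by omega)
    obtain ⟨hbβ, hbk, hkb, hkτ⟩ := sampleKey_mem (β := beta m s) (τ := tau m s)
      (by rw [← hτ₃, ← hβ₃]; exact hI₃.beta_le) (by rw [← hτ₃, ← hβ₃]; exact hI₃.tau_le) a b c
    obtain ⟨s₄, e₄, h10, h5, hw₄, hr₄, hwm₄, hrm₄⟩ := exec_sampleProg hB (s := s₃) (β := beta m s)
      (w := randIndex c (beta m s)) (τ := tau m s) (a := a) (b := b) hβ₃
      (by simp [hs₃, hs₂, hs₁, drawn, hβ]) hβm hw hτ₃ (by simp [hs₃, hs₂, hs₁, drawn])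
      (by simp [hs₃, hs₂, hs₁, drawn])
    set bb := sampleBucket (beta m s) (tau m s) a (randIndex c (beta m s)) with hbb
    set v := sampleKey (beta m s) (tau m s) a b (randIndex c (beta m s)) with hv
    have hc₄ : CoreEq s₃ s₄ := ⟨hw₄ _ (by norm_num), hw₄ _ (by norm_num), hw₄ _ (by norm_num),
      hw₄ _ (by norm_num), hw₄ _ (by norm_num), hwm₄, hrm₄⟩
    have hI₄ : Inv m ε s₄ ret bk lf := hI₃.congr hc₄ (hr₄ _ (by norm_num)) (hr₄ _ (by norm_num))
      (hw₄ _ (by norm_num))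
    have hτ₄ : s₄.realReg 2 = tau m s := (hr₄ _ (by norm_num)).trans hτ₃
    have hβ₄ : s₄.wordReg 3 = beta m s := (hw₄ _ (by norm_num)).trans hβ₃
    have hK₄ : ∀ j, Known m s₄ j ↔ Known m s j := fun j => (hc₄.known_iff j).trans (hK₃ j)
    have hbB : bb < buckets m := by
      have := hI₄.beta_lt
      rw [hβ₄] at this
      exact hbβ.trans_lt this
    obtain ⟨s₅, e₅, ⟨lf', hC₅⟩, fw, fr, h4', hX, hK₅⟩ := hI₄.toCore.exec_insert hB (i := i) (b := bb)
      (v := v) (by rw [hw₄ _ (by norm_num)]; simp [hs₃, hs₂])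
      (by rw [hw₄ _ (by norm_num), hc₄.wordMem]; simp [hs₃, hp]; rfl)
      h10 h5 hi (fun hh => hk ((hK₄ i).1 hh)) hbB hbk hkb
      (fun j hj => by have := hI₄.ret_tau j hj; rw [hτ₄] at this; linarith)
    have hret : ∀ j ∈ ret, j ≠ i := fun j hj hji =>
      hk ((hK₄ i).1 (hji ▸ (hI₄.ret_known j hj).2))
    have hI₅ : Inv m ε s₅ ret (Function.update bk i bb) lf' :=
      { toCore := hC₅
        eps := by rw [fr _ (by norm_num), hI₄.eps]
        beta_lt := by rw [fw _ (by norm_num) (by norm_num)]; exact hI₄.beta_lt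
        beta_le := by rw [fw _ (by norm_num) (by norm_num), fr _ (by norm_num)]; exact hI₄.beta_le
        tau_le := by rw [fw _ (by norm_num) (by norm_num), fr _ (by norm_num)]; exact hI₄.tau_le
        top := by
          intro j hj hjk hjr
          rw [fw _ (by norm_num) (by norm_num)]
          by_cases hji : j = i
          · rw [hji, Function.update_self, hβ₄]; exact hbβ
          · rw [Function.update_of_ne hji]
            exact hI₄.top j hj (((hK₅ j hj).1 hjk).resolve_right hji) hjr
        ret_tau := by
          intro j hj
          have := hret j hj
          rw [fr _ (by norm_num), hX, Function.update_of_ne (by omega)]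
          exact hI₄.ret_tau j hj }
    obtain ⟨s', e', hI', h0, h0', hc', h2', h3'⟩ := hI₅.exec_answer hB N hi
      (by rw [fw _ (by norm_num) (by norm_num), hw₄ _ (by norm_num)]; simp [hs₃, hs₂])
    obtain ⟨t, ht, e⟩ := hdraw _ s' (e₂.cons (e₃.cons ((ExecD.ite_false (fun hh => hk (htest.1 hh))
      (e₄.cons (e₅.cons execD_nil))).cons (e'.cons execD_nil))))
    refine ⟨t, s', e, ⟨_, lf', hI'⟩, h0, ?_, (hc'.known_iff i).2 ((hK₅ i hi).2 (Or.inr rfl)), ?_,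
      bb, hbB, fun x => ?_⟩
    · rw [h0', hc'.realMem]
    · intro x
      rw [if_neg hk, ← hcomp₃]
      funext j
      rw [compl, hc'.complWith_eq, hI'.tau_eq hm, h2', fr _ (by norm_num), hτ₄, complWith]
      by_cases hji : j = i
      · rw [if_pos ((hK₅ j j.2).2 (Or.inr (by rw [hji]))), hX, hji, Function.update_self,
          Function.update_self]
      · have hji' : (j : ℕ) ≠ i := fun hh => hji (Fin.ext hh)
        rw [Function.update_of_ne hji, compl, complWith, hI₃.tau_eq hm, hτ₃, hX,
          Function.update_of_ne (by omega), hrm₄]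
        by_cases hj : Known m s j
        · rw [if_pos ((hK₅ j j.2).2 (Or.inl ((hK₄ j).2 hj))), if_pos ((hK₃ j).2 hj)]
        · rw [if_neg, if_neg (fun hh => hj ((hK₃ j).1 hh))]
          intro hh
          rcases (hK₅ j j.2).1 hh with hh | hh
          · exact hj ((hK₄ j).1 hh)
          · exact hji' hh
    · have h1 := hI'.cnt_le_load hbB x
      rw [hc'.wordMem] at h1
      have h2 := Nat.size_le_size h1
      simp only [WExp.cost, permE, WExp.entry] at ht
      omega

end Specs

/-! ### Sorted accesses: the scan, the placement of the new key and the pop -/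

section Specs

variable {m W : ℕ} {ε V : ℝ} {s : Store} {ret : Finset ℕ} {bk : ℕ → ℕ} {lf : ℕ → ℕ → ℕ}

theorem eval_scanE (hB : Big m (m + 2) W) {β : ℕ} (h3 : s.wordReg 3 = β) (hβ : β < m) :
    scanE.eval W s = β - s.wordMem (8 * β + 5) * (β + 2) := by
  have hlt : ∀ {v}, v < m + 3 → v < W := fun hv => hB.lt (by omega)
  have e3 := WExp.eval_reg h3 (hlt (by omega))
  simp only [scanE, RExp.eval, RealOp.eval]
  rw [e3, WExp.eval_load (hB.eval_entry e3 (by omega) (by norm_num)) rfl,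
    WExp.eval_const (hlt (by omega))]
  norm_num

/-- Two loop conditions are packed into one real comparison: a nonzero root pushes the right-hand
side to -2 or less, which is below V. -/
theorem lt_scan_iff (hV : -1 ≤ V) (β r : ℕ) :
    V < β - r * (β + 2) ↔ r = 0 ∧ V < β := by
  rcases Nat.eq_zero_or_pos r with h | h
  · simp [h]
  · have h' : (1 : ℝ) ≤ r := by exact_mod_cast h
    have hβ : (0 : ℝ) ≤ β := Nat.cast_nonneg _
    constructor
    · intro hh; nlinarith
    · intro hh; omega

/-- The last hypothesis prevents the scan from running past bucket 0: it stops there at the latest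
if V ≥ 0, and otherwise at a nonempty bucket. A second reason for ending besides the root is `β' ≤
V`, and a bucket is left only if V lies below it. -/
theorem exec_scanLoop (hB : Big m (m + 2) W) (hV : -1 ≤ V) : ∀ (β : ℕ) (s : Store),
    s.wordReg 3 = β → β < m → s.realReg 5 = V →
    s.realReg 7 = β - s.wordMem (8 * β + 5) * (β + 2) →
    (0 ≤ V ∨ ∃ b ≤ β, s.wordMem (8 * b + 5) ≠ 0) →
    ∃ β' ≤ β, ∃ s', ExecD W scanLoop s (60 * (β - β') + 1) s' ∧ s'.wordReg 3 = β' ∧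
      (∀ r, r ≠ 3 → s'.wordReg r = s.wordReg r) ∧ (∀ r, r ≠ 7 → s'.realReg r = s.realReg r) ∧
      s'.wordMem = s.wordMem ∧ s'.realMem = s.realMem ∧
      (β' ≤ V ∨ s.wordMem (8 * β' + 5) ≠ 0) ∧ (β' = β ∨ V < β' + 1) ∧
      ∀ b, β' < b → b ≤ β → s.wordMem (8 * b + 5) = 0 := by
  intro β
  induction β with
  | zero =>
    intro s h3 hβ h5 h7 hex
    refine ⟨0, le_rfl, s, ExecD.loop_false ?_, h3, fun _ _ => rfl, fun _ _ => rfl, rfl, rfl, ?_,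
      Or.inl rfl, fun b h1 h2 => by omega⟩
    · rw [Test.Holds, h5, h7, lt_scan_iff hV]
      rintro ⟨h0, hV0⟩
      rcases hex with h | ⟨b, hb, h⟩
      · simp at hV0; linarith
      · rw [show b = 0 by omega] at h; exact h h0
    · rcases hex with h | ⟨b, hb, h⟩
      · exact Or.inl (by simpa using h)
      · rw [show b = 0 by omega] at h; exact Or.inr h
  | succ β ih =>
    intro s h3 hβ h5 h7 hex
    by_cases hc : s.wordMem (8 * (β + 1) + 5) = 0 ∧ V < (β + 1 : ℕ)
    · have hlt : ∀ {v}, v < m + 3 → v < W := fun hv => hB.lt (by omega)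
      set s₁ := s.setWord 3 β with hs₁
      set s₂ := s₁.setReal 7 (β - s.wordMem (8 * β + 5) * (β + 2)) with hs₂
      have e₁ : ExecD W (setW 3 (.sub (.reg 3) (.const 1))) s _ s₁ := execD_setW (r := 3) (v := β) (WExp.eval_sub (WExp.eval_reg (r := 3) (v := β + 1) h3
        (hlt (by omega))) (WExp.eval_const (v := 1) (hlt (by omega))) (hlt (by omega)))
        (hlt (by omega))
      have e₂ : ExecD W (setR 7 scanE) s₁ _ s₂ := execD_setR
        (eval_scanE hB (by simp [hs₁]) (by omega))
      obtain ⟨β', hβ', s', e, h3', hw, hr, hwm, hrm, h1, h2, h4⟩ := ih s₂ (by simp [hs₂, hs₁])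
        (by omega) (by simp [hs₂, hs₁, h5]) (by simp [hs₂, hs₁]) (hex.imp_right (by
          rintro ⟨b, hb, h⟩
          refine ⟨b, ?_, h⟩
          have : b ≠ β + 1 := fun hh => h (hh ▸ hc.1)
          omega))
      refine ⟨β', by omega, s', (ExecD.loop_true (s₁ := s₂) ?_ (e₁.cons (e₂.cons execD_nil)) e).mono
        ?_, h3', fun r h => by rw [hw r h]; simp [hs₂, hs₁, h],
        fun r h => by rw [hr r h]; simp [hs₂, hs₁, h], hwm, hrm, h1, ?_, ?_⟩
      · rw [Test.Holds, h5, h7, lt_scan_iff hV]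
        exact hc
      · simp [WExp.cost, RExp.cost, scanE, WExp.entry]
        omega
      · rcases h2 with h2 | h2
        · right; rw [h2]; simpa using hc.2
        · exact Or.inr h2
      · intro b hb1 hb2
        rcases Nat.lt_or_ge β b with hb | hb
        · rw [show b = β + 1 by omega]; exact hc.1
        · exact h4 b hb1 hb
    · refine ⟨β + 1, le_rfl, s, (ExecD.loop_false ?_).mono (by omega), h3, fun _ _ => rfl,
        fun _ _ => rfl, rfl, rfl, ?_, Or.inl rfl, fun b h1 h2 => by omega⟩
      · rw [Test.Holds, h5, h7, lt_scan_iff hV]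
        exact hc
      · by_cases h0 : s.wordMem (8 * (β + 1) + 5) = 0
        · exact Or.inl (not_lt.1 fun hh => hc ⟨h0, hh⟩)
        · exact Or.inr h0

/-- `hτ` guarantees that the popped key is at least the threshold: either the whole bucket is above
it, or some unreturned key is, and the popped one is the largest. -/
theorem Inv.exec_popAnswer (hB : Big m (m + 2) W) (h : Inv m ε s ret bk lf) (N : Noise)
    (hroot : s.wordMem (8 * s.wordReg 3 + 5) ≠ 0)
    (hτ : s.realReg 2 ≤ s.wordReg 3 ∨
      ∃ j < m, Known m s j ∧ j ∉ ret ∧ s.realReg 2 ≤ s.realMem (j + 1)) :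
    ∃ s' i, ExecD W (block [popProg, answerProg N]) s
        (520 + 201 * Nat.size (s'.wordMem (8 * s.wordReg 3 + 4))) s' ∧
      i < m ∧ i ∉ ret ∧ (∃ lf', Inv m ε s' (insert i ret) bk lf') ∧ s'.wordReg 0 = i ∧
      s'.realReg 0 = N.quantile (s'.realMem (i + 1) / buckets m) / ε ∧ Known m s' i ∧
      (∀ j ∈ ret, s'.realMem (i + 1) ≤ s'.realMem (j + 1)) ∧ s'.wordReg 3 = s.wordReg 3 ∧
      s'.realReg 2 = s.realReg 2 ∧ bk i = s.wordReg 3 ∧ ∀ x, compl m s' x = compl m s x := by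
  obtain ⟨s₁, e₁, ⟨i, hi, h8, hik, hir, hib, lf', hC⟩, fw, fr, hrm, hQ⟩ :=
    h.toCore.exec_pop hB rfl h.beta_lt hroot h.top
  have hK₁ : ∀ j, Known m s₁ j ↔ Known m s j := fun j => by
    rw [Known, Known, hQ, fw 4 (by norm_num) (by norm_num)]
  have h3 : s₁.wordReg 3 = s.wordReg 3 := fw _ (by norm_num) (by norm_num)
  have h2 : s₁.realReg 2 = s.realReg 2 := fr _ (by norm_num)
  have hI₁ : Inv m ε s₁ (insert i ret) bk lf' :=
    { toCore := hC
      eps := by rw [fr _ (by norm_num), h.eps]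
      beta_lt := by rw [h3]; exact h.beta_lt
      beta_le := by rw [h3, h2]; exact h.beta_le
      tau_le := by rw [h3, h2]; exact h.tau_le
      top := fun j hj hjk hjr => by
        rw [h3]
        exact h.top j hj ((hK₁ j).1 hjk) fun hh => hjr (Finset.mem_insert_of_mem hh)
      ret_tau := fun j hj => by
        rw [h2]
        rcases Finset.mem_insert.1 hj with rfl | hj
        · rcases hτ with hτ | ⟨l, hl, hlk, hlr, hlτ⟩
          · have := h.le_key j hi hik
            rw [hib] at this
            rw [hrm]
            linarith
          · by_cases hlj : l = j
            · rw [← hlj, hrm]; exact hlτ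
            · refine hlτ.trans ?_
              have := hC.ret_key j (Finset.mem_insert_self _ _) l hl ((hK₁ l).2 hlk)
                (by simp [hlj, hlr])
              rwa [hrm] at this ⊢
        · rw [hrm]; exact h.ret_tau j hj }
  obtain ⟨s', e', hI', h0, h0', hc', h2', h3'⟩ := hI₁.exec_answer hB N hi h8
  refine ⟨s', i, (e₁.cons (e'.cons execD_nil)).mono ?_, hi, hir, ⟨lf', hI'⟩, h0,
    by rw [h0', hc'.realMem], (hc'.known_iff i).2 ((hK₁ i).2 hik), ?_, h3'.trans h3, h2'.trans h2,
    hib, fun x => ?_⟩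
  · rw [hc'.wordMem]
    omega
  · intro j hj
    rw [hc'.realMem, hrm]
    exact h.ret_key j hj i hi hik hir
  · rw [compl, hc'.complWith_eq, hI'.tau_eq hB.hm, h2', h2, compl, h.tau_eq hB.hm]
    funext j
    simp only [complWith, hK₁, hrm]

/-- What is known when the maximal unknown key `V` has been generated and the topmost bucket has
been found. -/
structure Scanned (m : ℕ) (ε : ℝ) (s : Store) (ret : Finset ℕ) (bk : ℕ → ℕ) (lf : ℕ → ℕ → ℕ)
    (V : ℝ) : Prop extends Core m s ret bk lf where
  eps : s.realReg 1 = ε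
  beta_lt : s.wordReg 3 < buckets m
  beta_le : (s.wordReg 3 : ℝ) ≤ s.realReg 2
  top : ∀ j < m, Known m s j → j ∉ ret → bk j ≤ s.wordReg 3
  ret_tau : ∀ j ∈ ret, s.realReg 2 ≤ s.realMem (j + 1)
  val_le : V ≤ s.realReg 2
  val_lt : V ≤ s.wordReg 3 + 1
  reg5' : s.realReg 5 = V

/-- The tree of the bucket decides the access alone; lowering the threshold to the boundary of the
bucket preserves everything, since returned keys only have to be above it. -/
theorem Scanned.exec_place_known (h : Scanned m ε s ret bk lf V)
    (h6 : s.realReg 6 = s.wordReg 3) (hV : V < s.wordReg 3) :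
    ∃ s', ExecD W placeProg s 20 s' ∧ Inv m ε s' ret bk lf ∧ s'.realReg 2 = s.wordReg 3 ∧
      s'.wordReg 3 = s.wordReg 3 ∧ CoreEq s s' := by
  have hc : CoreEq s (s.setReal 2 (s.wordReg 3)) := ⟨rfl, rfl, rfl, rfl, rfl, rfl, rfl⟩
  refine ⟨s.setReal 2 (s.wordReg 3), (ExecD.ite_true ?_ (execD_setR ?_)).mono ?_, ?_, by simp, rfl,
    hc⟩
  · rw [Test.Holds, h.reg5', h6]; exact hV
  · exact h6
  · simp [RExp.cost]
  · exact
    { toCore := h.toCore.congr hc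
      eps := by simp [h.eps]
      beta_lt := h.beta_lt
      beta_le := by simp
      tau_le := by simp
      top := h.top
      ret_tau := fun j hj => by
        have := h.ret_tau j hj
        have := h.beta_le
        simp
        linarith }

/-- The positions from register 4 onwards hold the unknown items, so a random offset selects one of
them. The new key lies in the bucket where the scan stopped, whose root is therefore nonzero. -/
theorem Scanned.exec_place_new (hB : Big m (m + 2) W) {w : ℕ} (h : Scanned m ε s ret bk lf V)
    (h6 : s.realReg 6 = s.wordReg 3) (hV : s.wordReg 3 ≤ V) (h7 : s.wordReg 7 = w)
    (hw : s.wordReg 4 + w < m) :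
    let J := permP m s.wordMem (s.wordReg 4 + w)
    ∃ s' bk' lf', ExecD W placeProg s (1000 + 201 * Nat.size (s'.wordMem (8 * s.wordReg 3 + 4))) s' ∧
      Inv m ε s' ret bk' lf' ∧ s'.realReg 2 = V ∧ s'.wordReg 3 = s.wordReg 3 ∧
      s'.wordMem (8 * s.wordReg 3 + 5) ≠ 0 ∧ J ∉ ret ∧ ¬ Known m s J ∧
      (∀ j < m, Known m s' j ↔ Known m s j ∨ j = J) ∧
      s'.realMem = Function.update s.realMem (J + 1) V := by
  intro J
  have hm := hB.hm
  have hlt : ∀ {v}, v < m + 3 → v < W := fun hv => hB.lt (by omega)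
  have hJ : J < m := permP_lt hm _ _
  have hbm : s.wordReg 3 < m := h.beta_lt.trans_le (buckets_le m)
  have hQJ : permQ m s.wordMem J = s.wordReg 4 + w := h.QP _ hw
  have hJk : ¬ Known m s J := by rw [Known, hQJ]; omega
  have hJr : J ∉ ret := fun hh => hJk (h.ret_known J hh).2
  set s₁ := s.setWord 9 (s.wordReg 4 + w) with hs₁
  set s₂ := s₁.setWord 8 J with hs₂
  set s₃ := s₂.setWord 10 (s.wordReg 3) with hs₃
  have e₁ : ExecD W (setW 9 (.add (.reg 4) (.reg 7))) s _ s₁ := execD_setW (r := 9)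
    (WExp.eval_add (WExp.eval_reg (v := s.wordReg 4) rfl (hlt (by omega)))
      (WExp.eval_reg h7 (hlt (by omega))) (hlt (by omega))) (hlt (by omega))
  have e₂ : ExecD W (setW 8 (permE 1 (.reg 9))) s₁ _ s₂ := execD_setW (r := 8)
    (eval_permE hB (WExp.eval_reg (r := 9) (v := s.wordReg 4 + w) (by simp [hs₁]) (hlt (by omega)))
      hw (by norm_num) (by simp [hs₁, h.reg1]) ((h.raw _).1)) (hlt (by omega))
  have e₃ : ExecD W (setW 10 (.reg 3)) s₂ _ s₃ := execD_setW (r := 10)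
    (WExp.eval_reg (v := s.wordReg 3) (by simp [hs₂, hs₁]) (hlt (by omega))) (hlt (by omega))
  have hc₃ : CoreEq s s₃ := ⟨by simp [hs₃, hs₂, hs₁], by simp [hs₃, hs₂, hs₁],
    by simp [hs₃, hs₂, hs₁], by simp [hs₃, hs₂, hs₁], by simp [hs₃, hs₂, hs₁], rfl, rfl⟩
  have hKe : ∀ j, Known m s₃ j ↔ Known m s j := hc₃.known_iff
  have h3 : s₃.wordReg 3 = s.wordReg 3 := by simp [hs₃, hs₂, hs₁]
  obtain ⟨s₄, e₄, ⟨lf', hC₄⟩, fw, fr, h4', hX, hK₄⟩ := (h.toCore.congr hc₃).exec_insert hB (i := J)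
    (b := s.wordReg 3) (v := V) (by simp [hs₃, hs₂])
    (by rw [show s₃.wordReg 9 = s.wordReg 4 + w by simp [hs₃, hs₂, hs₁]]; exact hQJ.symm)
    (by simp [hs₃]) h.reg5' hJ (fun hh => hJk ((hKe J).1 hh)) h.beta_lt hV h.val_lt
    (fun j hj => h.val_le.trans (h.ret_tau j hj))
  rw [show s₃.realMem = s.realMem from rfl] at hX
  have hK₄' : ∀ j < m, Known m s₄ j ↔ Known m s j ∨ j = J := fun j hj => by rw [hK₄ j hj, hKe]
  set s' := s₄.setReal 2 V with hs'
  have e₅ : ExecD W (setR 2 (.reg 5)) s₄ _ s' := execD_setR (by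
    show s₄.realReg 5 = V
    rw [fr _ (by norm_num)]; exact h.reg5')
  have hc' : CoreEq s₄ s' := ⟨rfl, rfl, rfl, rfl, rfl, rfl, rfl⟩
  have h3' : s'.wordReg 3 = s.wordReg 3 := (fw _ (by norm_num) (by norm_num)).trans h3
  have hI : Inv m ε s' ret (Function.update bk J (s.wordReg 3)) lf' :=
    { toCore := hC₄.congr hc'
      eps := by
        rw [show s'.realReg 1 = s₄.realReg 1 by simp [hs'], fr _ (by norm_num)]; exact h.eps
      beta_lt := by rw [h3']; exact h.beta_lt
      beta_le := by rw [h3', show s'.realReg 2 = V by simp [hs']]; exact hV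
      tau_le := by rw [h3', show s'.realReg 2 = V by simp [hs']]; exact h.val_lt
      top := fun j hj hjk hjr => by
        rw [h3']
        by_cases hjJ : j = J
        · rw [hjJ, Function.update_self]
        · rw [Function.update_of_ne hjJ]
          exact h.top j hj (((hK₄' j hj).1 hjk).resolve_right hjJ) hjr
      ret_tau := fun j hj => by
        have hjJ : j ≠ J := fun hh => hJr (hh ▸ hj)
        rw [show s'.realReg 2 = V by simp [hs'], show s'.realMem = s₄.realMem from rfl, hX,
          Function.update_of_ne (by omega)]
        exact h.val_le.trans (h.ret_tau j hj) }
  refine ⟨s', _, lf', (ExecD.ite_false ?_ (e₁.cons (e₂.cons (e₃.cons (e₄.cons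
    (e₅.cons execD_nil)))))).mono ?_, hI, by simp [hs'], h3', ?_, hJr, hJk, hK₄', hX⟩
  · rw [Test.Holds, h.reg5', h6, not_lt]; exact hV
  · simp only [WExp.cost, RExp.cost, permE, WExp.entry]
    rw [hc'.wordMem]
    omega
  · have := hI.toCore.root_ne_zero hJ ((hK₄' J hJ).2 (Or.inr rfl)) hJr
    rwa [Function.update_self] at this

end Specs

/-- The largest of `k` independent uniform numbers below `τ`, generated from one uniform number. -/
def maxKey (τ : ℝ) (k : ℕ) (a : unitInterval) : ℝ := τ * Real.exp (Real.log a / k)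

theorem maxKey_nonneg {τ : ℝ} (hτ : 0 ≤ τ) (k : ℕ) (a : unitInterval) : 0 ≤ maxKey τ k a :=
  mul_nonneg hτ (Real.exp_pos _).le

theorem maxKey_le {τ : ℝ} (hτ : 0 ≤ τ) (k : ℕ) (a : unitInterval) : maxKey τ k a ≤ τ := by
  refine mul_le_of_le_one_right hτ (Real.exp_le_one_iff.2 ?_)
  exact div_nonpos_of_nonpos_of_nonneg (Real.log_nonpos a.2.1 a.2.2) (Nat.cast_nonneg _)

/-- The largest unknown key, and the item that it belongs to. -/
def newKey (m : ℕ) (s : Store) (a : unitInterval) : ℝ := maxKey (tau m s) (m - s.wordReg 4) a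

def newItem (m : ℕ) (s : Store) (d : unitInterval) : ℕ :=
  permP m s.wordMem (s.wordReg 4 + randIndex d (m - s.wordReg 4))

/-- What a sorted access does to the store. -/
structure SortedPost (m : ℕ) (N : Noise) (ε : ℝ) (s : Store) (ret : Finset ℕ) (v₀ : ℝ) (t : ℕ)
    (a d : unitInterval) (s' : Store) (i : ℕ) : Prop where
  inv : ∃ bk lf, Inv m ε s' (insert i ret) bk lf
  lt : i < m
  not_mem : i ∉ ret
  item : s'.wordReg 0 = i
  value : s'.realReg 0 = N.quantile (s'.realMem (i + 1) / buckets m) / ε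
  known : Known m s' i
  le : ∀ j ∈ ret, s'.realMem (i + 1) ≤ s'.realMem (j + 1)
  -- Apart from the case that all items are known, these are the alternatives of
  -- `lintegral_maxKey_scaled`, with `v₀` in the role of `v`.
  compl_eq_all : s.wordReg 4 = m → ∀ x, compl m s' x = compl m s x
  compl_eq_lt : s.wordReg 4 < m → newKey m s a < v₀ → ∀ x, compl m s' x = complWith m s v₀ x
  compl_eq_ge : s.wordReg 4 < m → v₀ ≤ newKey m s a → ∀ x j, compl m s' x j =
    if (j : ℕ) = newItem m s d then newKey m s a else complWith m s (newKey m s a) x j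
  time : ∃ b < buckets m, ∀ x, t ≤ 2000 + 40 * logExp m +
    402 * Nat.size (load m b (compl m s' x)) + 60 * emptyCount m (compl m s' x)

/-! ### A sorted access as a whole -/

section Specs

variable {m W : ℕ} {ε V : ℝ} {s : Store} {ret : Finset ℕ} {bk : ℕ → ℕ} {lf : ℕ → ℕ → ℕ}

theorem exec_maxProg (hB : Big m (m + 2) W) (h1 : s.wordReg 1 = m) (h4 : s.wordReg 4 ≤ m)
    (h17 : s.wordReg 17 = m - s.wordReg 4) {a : unitInterval} (h3 : s.realReg 3 = a) :
    ExecD W maxProg s 40 (s.setReal 5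
      (if s.wordReg 4 = m then -1 else maxKey (s.realReg 2) (m - s.wordReg 4) a)) := by
  have hlt : ∀ {v}, v < m + 3 → v < W := fun hv => hB.lt (by omega)
  by_cases hk : s.wordReg 4 = m
  · rw [if_pos hk]
    refine (ExecD.ite_false (by rw [Test.Holds, h1, hk]; omega) (execD_setR ?_)).mono ?_
    · simp only [RExp.eval, RealOp.eval]
      rw [WExp.eval_const (hlt (by omega)), WExp.eval_const (hlt (by omega))]
      norm_num
    · simp [RExp.cost, WExp.cost]
  · rw [if_neg hk]
    refine (ExecD.ite_true (by rw [Test.Holds, h1]; omega) (execD_setR ?_)).mono ?_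
    · simp only [RExp.eval, RealOp.eval, RealFun.eval]
      rw [WExp.eval_reg h17 (hlt (by omega)), h3]
      rfl
    · simp [RExp.cost, WExp.cost]

theorem exists_known_not_mem (hall : s.wordReg 4 = m) (hr : ret.card < m) :
    ∃ j < m, Known m s j ∧ j ∉ ret := by
  obtain ⟨j, hj, hjr⟩ := Finset.exists_mem_notMem_of_card_lt_card (s := ret) (t := Finset.range m)
    (by simpa using hr)
  rw [Finset.mem_range] at hj
  exact ⟨j, hj, by rw [Known, hall]; exact permQ_lt (by omega) _ _, hjr⟩

/-- The buckets strictly between `β'` and `β` are empty; the additional one is for the last step of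
the scan. -/
theorem sub_le_emptyCount {β β' : ℕ} {y : Fin m → ℝ} (hβ : β < buckets m)
    (h : ∀ j, y j ≤ β' + 1 ∨ β ≤ y j) : β - β' ≤ emptyCount m y + 1 := by
  classical
  have : (Finset.Ioo β' β).card ≤ emptyCount m y := by
    refine Finset.card_le_card fun b hb => ?_
    rw [Finset.mem_Ioo] at hb
    have h1 : (β' : ℝ) + 1 ≤ b := by exact_mod_cast hb.1
    have h2 : (b : ℝ) + 1 ≤ β := by exact_mod_cast hb.2
    rw [Finset.mem_filter, Finset.mem_range]
    refine ⟨by omega, fun j hj => ?_⟩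
    rcases h j with h | h <;> linarith
  rw [Nat.card_Ioo] at this
  omega

/-- `v₀` is the lower boundary of the highest bucket with an unreturned known key. It is determined
by the store, not by the draws of this access, so it is legitimate to condition on V being below it,
although the program never computes it beforehand. -/
theorem Ready.exec_sorted (hB : Big m (m + 2) W) (h : Ready m ε s ret) (hr : ret.card < m)
    (N : Noise) :
    ∃ t₀ v₀, 0 ≤ v₀ ∧ v₀ ≤ tau m s ∧ ∀ u, ∃ t s' i, ExecS W u (sortedProg N) 0 s t s' ∧
      SortedPost m N ε s ret v₀ t (u (t₀ + 1)) (u (t₀ + 21)) s' i := by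
  classical
  have hm := hB.hm
  have hlt : ∀ {v}, v < m + 3 → v < W := fun hv => hB.lt (by omega)
  obtain ⟨s₀, bk, lf, t₀, hI, hτ, hβ, hr4, -, hwm, hrm, hdraw⟩ := h.exec_withDraws hB [
    maxProg, setR 7 scanE, scanLoop, setR 6 (.cast (.reg 3)), placeProg, popProg, answerProg N]
  set β := beta m s with hβd
  have hβB : β < buckets m := hβ ▸ hI.beta_lt
  have hβm : β < m := hβB.trans_le (buckets_le m)
  have hβτ : (β : ℝ) ≤ tau m s := by rw [← hτ, ← hβ]; exact hI.beta_le
  have hτβ : tau m s ≤ β + 1 := by rw [← hτ, ← hβ]; exact hI.tau_le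
  have hτ0 : 0 ≤ tau m s := (Nat.cast_nonneg _).trans hβτ
  have htop : ∀ j < m, Known m s₀ j → j ∉ ret → bk j ≤ β := by rw [← hβ]; exact hI.top
  have hK : ∀ j, Known m s₀ j ↔ Known m s j := fun j => by rw [Known, Known, hr4, hwm]
  have hcw : ∀ τ x, complWith m s₀ τ x = complWith m s τ x := fun τ x => by
    funext j
    rw [complWith, complWith]
    by_cases hj : Known m s j
    · rw [if_pos ((hK j).2 hj), if_pos hj, hrm j hj]
    · rw [if_neg (fun hh => hj ((hK j).1 hh)), if_neg hj]
  set R : ℕ → ℕ := fun b => s₀.wordMem (8 * b + 5) with hR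
  -- The default 0, when all trees are empty, is correct: V is then not below `v₀`.
  set β₀ := Nat.findGreatest (fun b => R b ≠ 0) β with hβ₀
  have hβ₀β : β₀ ≤ β := Nat.findGreatest_le _
  refine ⟨t₀, β₀, Nat.cast_nonneg _, (Nat.cast_le.2 hβ₀β).trans hβτ, fun u => ?_⟩
  replace hdraw := hdraw u
  generalize u (t₀ + 1) = a, u (t₀ + 3) = b, u (t₀ + 5) = c, u (t₀ + 21) = d at hdraw
  set s₁ := drawn m s₀ a b c d with hs₁
  have hc₁ : CoreEq s₀ s₁ := drawn_coreEq _ _ _ _ _ _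
  -- When nothing is unknown, -1 plays the role of a maximum that is below every bucket.
  set V : ℝ := if s.wordReg 4 = m then -1 else newKey m s a with hV
  have h4m : s.wordReg 4 ≤ m := by rw [← hr4]; exact hI.reg4
  set s₂ := s₁.setReal 5 V with hs₂
  have e₁ : ExecD W maxProg s₁ 40 s₂ := by
    have h4' : s₁.wordReg 4 = s.wordReg 4 := by simp [hs₁, drawn, hr4]
    have := exec_maxProg (s := s₁) hB (by simp [hs₁, drawn, hI.reg1]) (by rw [h4']; exact h4m)
      (by simp [hs₁, drawn]) (a := a) (by simp [hs₁, drawn])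
    rw [h4', show s₁.realReg 2 = tau m s by simp [hs₁, drawn, hτ]] at this
    exact this
  have hV1 : -1 ≤ V := by
    rw [hV]; split_ifs
    · exact le_rfl
    · have := maxKey_nonneg hτ0 (m - s.wordReg 4) a
      rw [newKey]; linarith
  have hVτ : V ≤ tau m s := by
    rw [hV]; split_ifs
    · linarith
    · exact maxKey_le hτ0 _ _
  have h3₂ : s₂.wordReg 3 = β := by rw [← hβ]; simp [hs₂, hs₁, drawn]
  set s₃ := s₂.setReal 7 (β - R β * (β + 2)) with hs₃
  have e₂ : ExecD W (setR 7 scanE) s₂ _ s₃ := execD_setR (eval_scanE hB h3₂ hβm)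
  obtain ⟨β', hβ', s₄, e₃, h3₄, hw₄, hr₄, hwm₄, hrm₄, hend, hβV, hzero⟩ := exec_scanLoop hB hV1 β s₃
    h3₂ hβm (by simp [hs₃, hs₂]) (by rw [hs₃, setReal_realReg, if_pos rfl]; rfl) (by
      by_cases hk : s.wordReg 4 = m
      · right
        obtain ⟨j, hj, hjk, hjr⟩ := exists_known_not_mem (hr4.trans hk) hr
        exact ⟨bk j, htop j hj hjk hjr, hI.toCore.root_ne_zero hj hjk hjr⟩
      · left
        rw [hV, if_neg hk]
        exact maxKey_nonneg hτ0 _ _)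
  change β' ≤ V ∨ R β' ≠ 0 at hend
  change ∀ b, β' < b → b ≤ β → R b = 0 at hzero
  -- The scan has passed over empty trees only.
  have hβ₀' : β₀ ≤ β' := by
    rcases Nat.eq_zero_or_pos β₀ with h0 | h0
    · omega
    · by_contra hlt'
      exact Nat.findGreatest_of_ne_zero (P := fun b => R b ≠ 0) rfl h0.ne' (hzero _ (by omega) hβ₀β)
  have hβ'B : β' < buckets m := hβ'.trans_lt hβB
  have hβ'm : β' < m := hβ'B.trans_le (buckets_le m)
  set s₅ := s₄.setReal 6 β' with hs₅
  have e₄ : ExecD W (setR 6 (.cast (.reg 3))) s₄ _ s₅ := execD_setR (by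
    rw [RExp.eval, WExp.eval_reg h3₄ (hlt (by omega))])
  have hr2₅ : s₅.realReg 2 = tau m s := by
    simp [hs₅, hr₄, hs₃, hs₂, hs₁, drawn, hτ]
  have h3₅ : s₅.wordReg 3 = β' := h3₄
  have hc₅ : CoreEq s₀ s₅ := ⟨by simp [hs₅, hw₄, hs₃, hs₂, hs₁, drawn],
    by simp [hs₅, hw₄, hs₃, hs₂, hs₁, drawn], by simp [hs₅, hw₄, hs₃, hs₂, hs₁, drawn],
    by simp [hs₅, hw₄, hs₃, hs₂, hs₁, drawn], by simp [hs₅, hw₄, hs₃, hs₂, hs₁, drawn],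
    hwm₄.trans hc₁.wordMem, hrm₄.trans hc₁.realMem⟩
  have hK₅ : ∀ j, Known m s₅ j ↔ Known m s j := fun j => (hc₅.known_iff j).trans (hK j)
  have hcw₅ : ∀ τ x, complWith m s₅ τ x = complWith m s τ x := fun τ x => by
    rw [hc₅.complWith_eq, hcw]
  have hββ' : (β' : ℝ) ≤ β := Nat.cast_le.2 hβ'
  have hS : Scanned m ε s₅ ret bk lf V :=
    { toCore := hI.toCore.congr hc₅
      eps := by
        rw [← hI.eps]; simp [hs₅, hr₄, hs₃, hs₂, hs₁, drawn]
      beta_lt := by rw [h3₅]; exact hβ'B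
      beta_le := by rw [h3₅, hr2₅]; linarith
      top := fun j hj hjk hjr => by
        have hk := (hc₅.known_iff j).1 hjk
        rw [h3₅]
        by_contra hlt'
        exact hI.toCore.root_ne_zero hj hk hjr (hzero _ (by omega) (htop j hj hk hjr))
      ret_tau := fun j hj => by
        rw [hr2₅, hc₅.realMem, ← hτ]; exact hI.ret_tau j hj
      val_le := by rw [hr2₅]; exact hVτ
      val_lt := by
        rw [h3₅]
        rcases hβV with hβV | hβV
        · rw [hβV]; linarith
        · exact hβV.le
      reg5' := by simp [hs₅, hr₄, hs₃, hs₂] }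
  have h6₅ : s₅.realReg 6 = s₅.wordReg 3 := by rw [h3₅]; simp [hs₅]
  -- the common end of the two cases
  have fin : ∀ (s₆ : Store) (bk' : ℕ → ℕ) (lf' : ℕ → ℕ → ℕ) (k : ℕ), ExecD W placeProg s₅ k s₆ →
      Inv m ε s₆ ret bk' lf' → s₆.wordReg 3 = β' → s₆.wordMem (8 * β' + 5) ≠ 0 →
      (s₆.realReg 2 ≤ β' ∨ ∃ j < m, Known m s₆ j ∧ j ∉ ret ∧ s₆.realReg 2 ≤ s₆.realMem (j + 1)) →
      (∀ x, (s.wordReg 4 = m → compl m s₆ x = compl m s x) ∧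
        (s.wordReg 4 < m → newKey m s a < β₀ → compl m s₆ x = complWith m s β₀ x) ∧
        (s.wordReg 4 < m → β₀ ≤ newKey m s a → ∀ j, compl m s₆ x j =
          if (j : ℕ) = newItem m s d then newKey m s a else complWith m s (newKey m s a) x j)) →
      (∀ j ∈ ret, s₆.realMem (j + 1) = s₅.realMem (j + 1)) →
      (∀ x, k ≤ 1000 + 201 * Nat.size (load m β' (compl m s₆ x))) →
      ∃ t s' i, ExecS W u (sortedProg N) 0 s t s' ∧ SortedPost m N ε s ret β₀ t a d s' i := by
    intro s₆ bk' lf' k e₅ hI₆ h3₆ hroot hτ₆ hcompl hret hk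
    obtain ⟨s', i, e₆, hi, hir, ⟨lf₇, hI₇⟩, h0, h0', hik, hile, h3₇, h2₇, hib, hcompl'⟩ :=
      hI₆.exec_popAnswer hB N (by rw [h3₆]; exact hroot) (by rw [h3₆]; exact hτ₆)
    rw [h3₆] at e₆ h3₇ hib
    obtain ⟨t, ht, e⟩ := hdraw _ s' (e₁.cons (e₂.cons (e₃.cons (e₄.cons (e₅.cons e₆)))))
    refine ⟨t, s', i, e, ⟨_, _, hI₇⟩, hi, hir, h0, h0', hik, hile, ?_, ?_, ?_, β', hβ'B, ?_⟩
    · exact fun hh x => (hcompl' x).trans ((hcompl x).1 hh)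
    · exact fun h1 h2 x => (hcompl' x).trans ((hcompl x).2.1 h1 h2)
    · exact fun h1 h2 x j => (congrFun (hcompl' x) j).trans ((hcompl x).2.2 h1 h2 j)
    · intro x
      have hsz := Nat.size_le_size (hI₇.toCore.cnt_le_load hβ'B x)
      have hk := hk x
      rw [← hcompl'] at hk
      -- No completed key lies strictly between `β' + 1` and `β`: returned keys are at least the old
      -- threshold, unreturned known keys are in buckets up to `β'`, and unknown ones stay below the
      -- new threshold.
      have hE : β - β' ≤ emptyCount m (compl m s' x) + 1 := by
        refine sub_le_emptyCount hβB fun j => ?_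
        rw [hcompl', compl, complWith]
        split_ifs with hjk
        · by_cases hjr : (j : ℕ) ∈ ret
          · right
            rw [hret j hjr, hc₅.realMem]
            have := hI.ret_tau j hjr
            rw [hτ] at this
            linarith
          · left
            have h1 := hI₆.toCore.key_le j j.2 hjk
            have h2 := hI₆.top j j.2 hjk hjr
            rw [h3₆] at h2
            have h3 : (bk' j : ℝ) ≤ β' := by exact_mod_cast h2
            linarith
        · left
          rw [hI₆.tau_eq hm]
          have h1 := hI₆.tau_le
          have h2 := hI₆.beta_le
          rw [h3₆] at h1 h2
          have h3 : (0 : ℝ) ≤ β' := Nat.cast_nonneg _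
          have h4 := (x j).2.2
          have h5 := (x j).2.1
          nlinarith
      simp only [RExp.cost, WExp.cost, scanE, WExp.entry] at ht
      omega
  by_cases hVβ : V < β'
  · have hroot : R β' ≠ 0 := hend.resolve_left (not_le.2 hVβ)
    -- If V is below the bucket, only a nonempty tree can have stopped the scan, so this is the
    -- bucket that defines `v₀`.
    have hβeq : β₀ = β' := le_antisymm hβ₀' (Nat.le_findGreatest (P := fun b => R b ≠ 0) hβ' hroot)
    obtain ⟨s₆, e₅, hI₆, h2₆, h3₆, hc₆⟩ := hS.exec_place_known h6₅ (by rw [h3₅]; exact hVβ)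
    rw [h3₅] at h2₆ h3₆
    have hcs : ∀ x, compl m s₆ x = complWith m s β₀ x := fun x => by
      rw [compl, hI₆.tau_eq hm, h2₆, hβeq, hc₆.complWith_eq, hcw₅]
    refine fin s₆ bk lf _ e₅ hI₆ h3₆ ?_ (Or.inl h2₆.le) (fun x => ⟨?_, ?_, ?_⟩) ?_ ?_
    · rw [hc₆.wordMem, hc₅.wordMem]; exact hroot
    · intro hall
      rw [hcs]
      funext j
      have : Known m s j := by rw [Known, hall]; exact permQ_lt hm _ _
      rw [compl, complWith, complWith, if_pos this, if_pos this]
    · exact fun _ _ => hcs x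
    · intro h1 h2
      rw [hV, if_neg h1.ne] at hVβ
      rw [hβeq] at h2
      linarith
    · exact fun j _ => by rw [hc₆.realMem]
    · exact fun x => by omega
  · rw [not_lt] at hVβ
    have hk : s.wordReg 4 ≠ m := by
      intro hk
      rw [hV, if_pos hk] at hVβ
      have : (0 : ℝ) ≤ β' := Nat.cast_nonneg _
      linarith
    have hVn : V = newKey m s a := by rw [hV, if_neg hk]
    have h4₅ : s₅.wordReg 4 = s.wordReg 4 := hc₅.reg4.trans hr4
    have hd : randIndex d (m - s.wordReg 4) < m - s.wordReg 4 :=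
      lt_of_le_of_lt (min_le_right _ _) (by omega)
    have hJ : permP m s₅.wordMem (s₅.wordReg 4 + randIndex d (m - s.wordReg 4)) = newItem m s d := by
      rw [newItem, hc₅.wordMem, hwm, h4₅]
    obtain ⟨s₆, bk', lf', e₅, hI₆, h2₆, h3₆, hroot, hJr, hJk, hK₆, hX⟩ := hS.exec_place_new hB
      (w := randIndex d (m - s.wordReg 4)) h6₅ (by rw [h3₅]; exact hVβ)
      (by simp [hs₅, hw₄, hs₃, hs₂, hs₁, drawn, hr4]) (by omega)
    rw [hJ] at hJr hJk hK₆ hX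
    rw [h3₅] at e₅ h3₆ hroot
    have hJm : newItem m s d < m := permP_lt hm _ _
    refine fin s₆ bk' lf' _ e₅ hI₆ h3₆ hroot
      (Or.inr ⟨newItem m s d, hJm, (hK₆ _ hJm).2 (Or.inr rfl), hJr, by
        rw [h2₆, hX, Function.update_self]⟩) (fun x => ⟨fun hh => absurd hh hk, ?_, ?_⟩) ?_ ?_
    · intro _ h2
      have : (β₀ : ℝ) ≤ β' := by exact_mod_cast hβ₀'
      rw [← hVn] at h2
      linarith
    · intro _ _ j
      rw [compl, hI₆.tau_eq hm, h2₆, complWith, hX]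
      by_cases hj : (j : ℕ) = newItem m s d
      · rw [if_pos hj, if_pos ((hK₆ _ j.2).2 (Or.inr hj)), hj, Function.update_self, hVn]
      · rw [if_neg hj, ← hVn, ← hcw₅, complWith, Function.update_of_ne (by omega)]
        by_cases hjk : Known m s₅ j
        · rw [if_pos ((hK₆ _ j.2).2 (Or.inl hjk)), if_pos hjk]
        · rw [if_neg (fun hh => ((hK₆ _ j.2).1 hh).elim hjk hj), if_neg hjk]
    · intro j hj
      have : j ≠ newItem m s d := fun hh => hJr (hh ▸ hj)
      rw [hX, Function.update_of_ne (by omega)]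
    · intro x
      have := Nat.size_le_size (hI₆.toCore.cnt_le_load hβ'B x)
      omega

end Specs

/-! ## Measurability of the machine -/

instance : MeasurableSpace Store :=
  MeasurableSpace.comap (fun s : Store => (s.wordReg, s.realReg, s.wordMem, s.realMem)) inferInstance

theorem Store.measurable_tuple :
    Measurable fun s : Store => (s.wordReg, s.realReg, s.wordMem, s.realMem) :=
  comap_measurable _

@[fun_prop]
theorem Store.measurable_wordReg : Measurable Store.wordReg := Store.measurable_tuple.fst

@[fun_prop]
theorem Store.measurable_realReg : Measurable Store.realReg := Store.measurable_tuple.snd.fst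

@[fun_prop]
theorem Store.measurable_wordMem : Measurable Store.wordMem := Store.measurable_tuple.snd.snd.fst

@[fun_prop]
theorem Store.measurable_realMem : Measurable Store.realMem := Store.measurable_tuple.snd.snd.snd

section Machine

variable {α : Type*} [MeasurableSpace α]

theorem Store.measurable_mk {w : α → ℕ → ℕ} {r : α → ℕ → ℝ} {v : α → ℕ → ℕ} {q : α → ℕ → ℝ}
    (hw : Measurable w) (hr : Measurable r) (hv : Measurable v) (hq : Measurable q) :
    Measurable fun a => (⟨w a, r a, v a, q a⟩ : Store) :=
  measurable_comap_iff.2 (hw.prodMk (hr.prodMk (hv.prodMk hq)))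

theorem measurable_apply_nat {β : Type*} [MeasurableSpace β] {f : α → ℕ → β} {g : α → ℕ}
    (hf : Measurable f) (hg : Measurable g) : Measurable fun a => f a (g a) := by
  have : Measurable fun p : (ℕ → β) × ℕ => p.1 p.2 :=
    measurable_from_prod_countable_left fun n => measurable_pi_apply n
  exact this.comp (hf.prodMk hg)

theorem measurable_update_nat {β : Type*} [MeasurableSpace β] {f : α → ℕ → β} {g : α → ℕ} {v : α → β}
    (hf : Measurable f) (hg : Measurable g) (hv : Measurable v) :
    Measurable fun a => Function.update (f a) (g a) (v a) := by
  refine measurable_pi_iff.2 fun n => ?_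
  simp only [Function.update_apply]
  exact Measurable.ite (measurableSet_eq_fun measurable_const hg) hv (measurable_pi_iff.1 hf n)

theorem Store.measurable_setWord {s : α → Store} {v : α → ℕ} (d : ℕ) (hs : Measurable s)
    (hv : Measurable v) : Measurable fun a => (s a).setWord d (v a) :=
  Store.measurable_mk (measurable_update_nat (by fun_prop) measurable_const hv) (by fun_prop)
    (by fun_prop) (by fun_prop)

theorem Store.measurable_setReal {s : α → Store} {v : α → ℝ} (d : ℕ) (hs : Measurable s)
    (hv : Measurable v) : Measurable fun a => (s a).setReal d (v a) :=
  Store.measurable_mk (by fun_prop) (measurable_update_nat (by fun_prop) measurable_const hv)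
    (by fun_prop) (by fun_prop)

theorem measurable_nat_op (f : ℕ → ℕ → ℕ) {g h : α → ℕ} (hg : Measurable g) (hh : Measurable h) :
    Measurable fun a => f (g a) (h a) :=
  (measurable_of_countable fun p : ℕ × ℕ => f p.1 p.2).comp (hg.prodMk hh)

theorem Instr.measurable_exec (W : ℕ) (i : Instr) {u : α → unitInterval} {s : α → Store}
    (hu : Measurable u) (hs : Measurable s) : Measurable fun a => i.exec W (u a) (s a) := by
  have hw : ∀ r, Measurable fun a => (s a).wordReg r := fun r => by fun_prop
  have hr : ∀ r, Measurable fun a => (s a).realReg r := fun r => by fun_prop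
  have hu' : Measurable fun a => (u a : ℝ) := by fun_prop
  cases i with
  | const d n => exact Store.measurable_setWord _ hs measurable_const
  | word o d a b =>
    exact Store.measurable_setWord _ hs (measurable_nat_op (fun x y => o.eval x y % W) (hw a) (hw b))
  | load d a => exact Store.measurable_setWord _ hs (measurable_apply_nat (by fun_prop) (hw a))
  | store a r =>
    exact Store.measurable_mk (by fun_prop) (by fun_prop)
      (measurable_update_nat (by fun_prop) (hw a) (hw r)) (by fun_prop)
  | randWord d a =>
    refine Store.measurable_setWord _ hs (measurable_nat_op (fun x y => min x (y - 1))
      (Nat.measurable_floor.comp (hu'.mul ?_)) (hw a))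
    exact (measurable_of_countable (fun n : ℕ => (n : ℝ))).comp (hw a)
  | cast d a =>
    exact Store.measurable_setReal _ hs ((measurable_of_countable (fun n : ℕ => (n : ℝ))).comp (hw a))
  | real o d a b =>
    refine Store.measurable_setReal _ hs ?_
    cases o
    · exact (hr a).add (hr b)
    · exact (hr a).sub (hr b)
    · exact (hr a).mul (hr b)
    · exact (hr a).div (hr b)
  | realFun f d a =>
    refine Store.measurable_setReal _ hs ?_
    cases f
    · exact Real.measurable_exp.comp (hr a)
    · exact Real.measurable_log.comp (hr a)
    · exact Real.continuous_sqrt.measurable.comp (hr a)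
  | loadReal d a => exact Store.measurable_setReal _ hs (measurable_apply_nat (by fun_prop) (hw a))
  | storeReal a r =>
    exact Store.measurable_mk (by fun_prop) (by fun_prop) (by fun_prop)
      (measurable_update_nat (by fun_prop) (hw a) (hr r))
  | randReal d => exact Store.measurable_setReal _ hs hu'

theorem Test.measurableSet_holds (b : Test) {s : α → Store} (hs : Measurable s) :
    MeasurableSet {a | b.Holds (s a)} := by
  have hw : ∀ r, Measurable fun a => (s a).wordReg r := fun r => by fun_prop
  have hr : ∀ r, Measurable fun a => (s a).realReg r := fun r => by fun_prop
  cases b with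
  | wordEq a b => exact measurableSet_eq_fun (hw a) (hw b)
  | wordLt a b => exact measurableSet_lt (hw a) (hw b)
  | realLt a b => exact measurableSet_lt (hr a) (hr b)

theorem run_succ' (W : ℕ) (u : ℕ → unitInterval) (c : Config) (n : ℕ) :
    run W u c (n + 1) = run W (fun k => u (k + 1)) (step W (u 0) c) n := by
  induction n with
  | zero => rfl
  | succ n ih => rw [run, ih]; rfl

/-- The run is unrolled at its first step. Each branch of a test then starts again from a constant
list of programs, and only the store and the random numbers vary, measurably. -/
theorem measurable_run (W n : ℕ) : ∀ (l : List Prog) {u : α → ℕ → unitInterval} {s : α → Store},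
    Measurable u → Measurable s → (Measurable fun a => (run W (u a) ⟨l, s a⟩ n).store) ∧
      MeasurableSet {a | (run W (u a) ⟨l, s a⟩ n).todo = []} := by
  classical
  induction n with
  | zero =>
    intro l u s hu hs
    exact ⟨hs, MeasurableSet.const (l = [])⟩
  | succ n ih =>
    intro l u s hu hs
    have hu' : Measurable fun a k => u a (k + 1) := by fun_prop
    have hu0 : Measurable fun a => u a 0 := by fun_prop
    have key : ∀ (b : Test) (l₁ l₂ : List Prog),
        (Measurable fun a => (run W (fun k => u a (k + 1))
          (if b.Holds (s a) then ⟨l₁, s a⟩ else ⟨l₂, s a⟩) n).store) ∧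
        MeasurableSet {a | (run W (fun k => u a (k + 1))
          (if b.Holds (s a) then ⟨l₁, s a⟩ else ⟨l₂, s a⟩) n).todo = []} := by
      intro b l₁ l₂
      have hb := b.measurableSet_holds hs
      constructor
      · refine (congrArg Measurable (funext fun a => ?_)).mpr
          (@Measurable.ite _ _ _ _ _ _ (fun a => b.Holds (s a)) (fun _ => Classical.propDecidable _)
            hb (ih l₁ hu' hs).1 (ih l₂ hu' hs).1)
        split_ifs <;> rfl
      · convert (hb.inter (ih l₁ hu' hs).2).union (hb.compl.inter (ih l₂ hu' hs).2) using 1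
        ext a
        by_cases hba : b.Holds (s a) <;> simp [hba]
    simp only [run_succ']
    rcases l with _ | ⟨p, l⟩
    · exact ih _ hu' hs
    · cases p with
      | instr i => exact ih _ hu' (i.measurable_exec W hu0 hs)
      | seq p q => exact ih _ hu' hs
      | ite b p q => exact key b (p :: l) (q :: l)
      | loop b p => exact key b (p :: .loop b p :: l) l

theorem haltTime_le_iff (W : ℕ) (u : ℕ → unitInterval) (c : Config) (n : ℕ) :
    haltTime W u c ≤ n ↔ ∃ k ≤ n, (run W u c k).todo = [] := by
  constructor
  · intro h
    have : haltTime W u c < (n + 1 : ℕ) := lt_of_le_of_lt h (by exact_mod_cast Nat.lt_succ_self n)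
    rw [haltTime, iInf_lt_iff] at this
    obtain ⟨k, hk⟩ := this
    rw [iInf_lt_iff] at hk
    obtain ⟨h1, h2⟩ := hk
    exact ⟨k, Nat.lt_succ_iff.1 (by exact_mod_cast h2), h1⟩
  · rintro ⟨k, hk, h⟩
    exact (iInf₂_le k h).trans (by exact_mod_cast hk)

theorem measurable_haltTime (W : ℕ) (l : List Prog) {u : α → ℕ → unitInterval} {s : α → Store}
    (hu : Measurable u) (hs : Measurable s) : Measurable fun a => haltTime W (u a) ⟨l, s a⟩ := by
  have hle : ∀ n : ℕ, MeasurableSet {a | haltTime W (u a) ⟨l, s a⟩ ≤ n} := fun n => by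
    simp only [haltTime_le_iff]
    convert MeasurableSet.biUnion (Set.to_countable {k | k ≤ n})
      fun k _ => (measurable_run W k l hu hs).2 using 1
    ext a
    simp
  refine measurable_to_countable' fun x => ?_
  induction x with
  | top =>
    convert (MeasurableSet.iUnion hle).compl using 1
    ext a
    simp only [Set.mem_preimage, Set.mem_singleton_iff, Set.mem_compl_iff, Set.mem_iUnion,
      Set.mem_ofPred_eq]
    constructor
    · rintro h ⟨n, hn⟩
      rw [h] at hn
      exact absurd hn (by simp)
    · intro h
      by_contra h'
      obtain ⟨n, hn⟩ := ENat.ne_top_iff_exists.1 h'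
      exact h ⟨n, hn.symm.le⟩
  | coe n =>
    convert (hle n).diff (MeasurableSet.biUnion (Set.to_countable {k | k < n}) fun k _ => hle k)
      using 1
    ext a
    simp only [Set.mem_preimage, Set.mem_singleton_iff, Set.mem_sdiff, Set.mem_iUnion,
      Set.mem_ofPred_eq, not_exists, not_le]
    constructor
    · intro h
      exact ⟨h.le, fun k hk => by rw [h]; exact_mod_cast hk⟩
    · rintro ⟨h1, h2⟩
      obtain ⟨k, hk⟩ := ENat.ne_top_iff_exists.1 (ne_top_of_le_ne_top (ENat.natCast_ne_top n) h1)
      rw [← hk] at h1 h2 ⊢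
      have h1' : k ≤ n := by exact_mod_cast h1
      by_contra hne
      have : k < n := lt_of_le_of_ne h1' fun hh => hne (by rw [hh])
      exact lt_irrefl _ (h2 k this)

theorem Oracle.measurable_result {m : ℕ} (A : Oracle) (W : ℕ) (q : Query m)
    {u : α → ℕ → unitInterval} {s : α → Store} (hu : Measurable u) (hs : Measurable s) :
    Measurable fun a => A.result W (u a) (s a) q := by
  have key : ∀ (l : List Prog) {s : α → Store}, Measurable s →
      Measurable fun a => (run W (u a) ⟨l, s a⟩ (haltTime W (u a) ⟨l, s a⟩).toNat).store := by
    intro l s hs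
    have h1 : Measurable fun a => (haltTime W (u a) ⟨l, s a⟩).toNat :=
      (measurable_of_countable ENat.toNat).comp (measurable_haltTime W l hu hs)
    have h2 : Measurable fun p : (α × ℕ) => (run W (u p.1) ⟨l, s p.1⟩ p.2).store :=
      measurable_from_prod_countable_left fun n => (measurable_run W n l hu hs).1
    exact h2.comp (measurable_id.prodMk h1)
  cases q with
  | sorted => exact key [A.onSorted] hs
  | random i => exact key [A.onRandom] (Store.measurable_setWord 0 hs measurable_const)

instance (m : ℕ) : MeasurableSpace (Query m) := ⊤

instance (m : ℕ) : Finite (Query m) := by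
  refine Finite.of_injective (β := Option (Fin m)) (fun q => match q with
    | .sorted => none
    | .random i => some i) ?_
  rintro (_ | i) (_ | j) h <;> simp_all

theorem Strategy.measurable {m : ℕ} (σ : Strategy m) (t : ℕ) : Measurable (σ.next t) :=
  measurable_to_countable' fun q => σ.measurable_next t q

theorem measurable_of_query {m : ℕ} {β : Type*} [MeasurableSpace β] {f : Query m → α → β}
    {q : α → Query m} (hf : ∀ q, Measurable (f q)) (hq : Measurable q) :
    Measurable fun a => f (q a) a := by
  have : MeasurableSingletonClass (Query m) := ⟨fun _ => trivial⟩
  have : Measurable fun p : α × Query m => f p.2 p.1 := measurable_from_prod_countable_left hf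
  exact this.comp (measurable_id.prodMk hq)

theorem measurable_snoc {t : ℕ} {h : α → Fin t → Answer} {x : α → Answer} (hh : Measurable h)
    (hx : Measurable x) : Measurable fun a => Fin.snoc (α := fun _ => Answer) (h a) (x a) := by
  refine measurable_pi_iff.2 fun i => ?_
  refine Fin.lastCases ?_ (fun i => ?_) i
  · simpa using hx
  · simpa using measurable_pi_iff.1 hh i

theorem Store.measurable_answer : Measurable Store.answer :=
  Measurable.prodMk (by fun_prop) (by fun_prop)

theorem Oracle.measurable_session {m : ℕ} (A : Oracle) (W : ℕ) (ε : ℝ) (σ : Strategy m) (t : ℕ) :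
    Measurable fun ω => A.session W ε σ ω t := by
  induction t with
  | zero => exact measurable_const
  | succ t ih =>
    have h1 : Measurable fun ω => A.result W (ω t) (A.session W ε σ ω t).1
        (σ.next t (A.session W ε σ ω t).2) :=
      measurable_of_query (f := fun q ω => A.result W (ω t) (A.session W ε σ ω t).1 q)
        (fun q => A.measurable_result (u := fun ω => ω t) W q (measurable_pi_apply t) ih.fst) ((σ.measurable t).comp ih.snd)
    exact h1.prodMk (measurable_snoc ih.snd (Store.measurable_answer.comp h1))

/-- The part of the session that the random numbers of the later accesses do not influence. -/
theorem Oracle.session_congr {m : ℕ} (A : Oracle) (W : ℕ) (ε : ℝ) (σ : Strategy m)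
    {ω ω' : Randomness} : ∀ {t : ℕ}, (∀ k < t, ω k = ω' k) →
      A.session W ε σ ω t = A.session W ε σ ω' t
  | 0, _ => rfl
  | t + 1, h => by
    rw [Oracle.session, Oracle.session, session_congr A W ε σ fun k hk => h k (hk.trans t.lt_succ_self),
      h t t.lt_succ_self]

end Machine

/-! ## Integrals over the unit interval -/

theorem lintegral_unitInterval (F : ℝ → ℝ≥0∞) :
    ∫⁻ x : unitInterval, F x = ∫⁻ x in Set.Ioo (0 : ℝ) 1, F x := by
  rw [unitInterval.measurePreserving_coe.lintegral_comp_emb unitInterval.measurableEmbedding_coe,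
    unitInterval]
  exact setLIntegral_congr Ioo_ae_eq_Icc.symm

theorem lintegral_unitInterval_affine {c : ℝ} (hc : 0 ≤ c) (d : ℝ) (F : ℝ → ℝ≥0∞) :
    ENNReal.ofReal c * ∫⁻ x : unitInterval, F (d + c * x) = ∫⁻ y in Set.Ico d (d + c), F y := by
  rcases hc.eq_or_lt with rfl | hc
  · simp
  rw [lintegral_unitInterval fun x => F (d + c * x), setLIntegral_congr Ioo_ae_eq_Ico.symm]
  have himage : (fun x => d + c * x) '' Set.Ioo 0 1 = Set.Ioo d (d + c) := by
    rw [show (fun x => d + c * x) = (fun x => d + x) ∘ fun x => c * x from rfl, Set.image_comp,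
      Set.image_mul_left_Ioo hc, Set.image_const_add_Ioo]
    simp
  rw [← himage, lintegral_image_eq_lintegral_abs_deriv_mul measurableSet_Ioo
    (f' := fun _ => c) (fun x _ => ?_) (fun x _ y _ h => by simpa [hc.ne'] using h), abs_of_pos hc,
    lintegral_const_mul' _ _ (by simp)]
  · simpa using (((hasDerivAt_id x).const_mul c).const_add d).hasDerivWithinAt

theorem lintegral_unitInterval_mul {c : ℝ} (hc : 0 ≤ c) (F : ℝ → ℝ≥0∞) :
    ENNReal.ofReal c * ∫⁻ x : unitInterval, F (c * x) = ∫⁻ y in Set.Ico 0 c, F y := by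
  simpa using lintegral_unitInterval_affine hc 0 F

theorem lintegral_Ico_add {a b c : ℝ} (hab : a ≤ b) (hbc : b ≤ c) (F : ℝ → ℝ≥0∞) :
    ∫⁻ y in Set.Ico a c, F y = (∫⁻ y in Set.Ico a b, F y) + ∫⁻ y in Set.Ico b c, F y := by
  rw [← Set.Ico_union_Ico_eq_Ico hab hbc, lintegral_union measurableSet_Ico]
  exact Set.disjoint_left.2 fun x h1 h2 => absurd h1.2 (not_lt.2 h2.1)

theorem lintegral_Ico_natCast (k : ℕ) (F : ℝ → ℝ≥0∞) :
    ∫⁻ y in Set.Ico 0 (k : ℝ), F y =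
      ∑ w ∈ Finset.range k, ∫⁻ y in Set.Ico (w : ℝ) (w + 1), F y := by
  induction k with
  | zero => simp
  | succ k ih =>
    rw [Finset.sum_range_succ, ← ih, lintegral_Ico_add (Nat.cast_nonneg k) (by simp)]
    push_cast
    rfl

/-- `k` times a uniform number has floor `w` exactly on [w, w + 1). For `k = 0` both sides vanish.
-/
theorem mul_lintegral_randIndex (k : ℕ) (G : ℕ → ℝ≥0∞) :
    (k : ℝ≥0∞) * ∫⁻ c : unitInterval, G (randIndex c k) = ∑ w ∈ Finset.range k, G w := by
  have h := lintegral_unitInterval_mul (Nat.cast_nonneg (α := ℝ) k)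
    (fun y => G (min ⌊y⌋₊ (k - 1)))
  rw [ENNReal.ofReal_natCast, lintegral_Ico_natCast] at h
  have h1 : ∀ c : unitInterval, G (randIndex c k) = G (min ⌊(k : ℝ) * c⌋₊ (k - 1)) := fun c => by
    rw [randIndex, mul_comm]
  simp only [h1]
  rw [h]
  refine Finset.sum_congr rfl fun w hw => ?_
  rw [Finset.mem_range] at hw
  rw [setLIntegral_congr_fun (g := fun _ => G w) measurableSet_Ico]
  · simp
  · intro y hy
    have : ⌊y⌋₊ = w := (Nat.floor_eq_iff ((Nat.cast_nonneg w).trans hy.1)).2 hy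
    simp only [this]
    rw [min_eq_left (by omega)]

theorem measurable_randIndex (k : ℕ) : Measurable fun c : unitInterval => randIndex c k :=
  (measurable_of_countable fun x : ℕ => min x (k - 1)).comp
    (Nat.measurable_floor.comp (measurable_subtype_coe.mul_const _))

/-- A uniform number below τ is a mixture: with probability (τ - β) / τ it is uniform in the
incomplete top bucket, otherwise uniform in one of `β` equally likely full buckets. After
multiplication by τ both sides are integrals over [0, τ). -/
theorem lintegral_sampleKey {β : ℕ} {τ : ℝ} (h1 : (β : ℝ) ≤ τ) (F : ℝ → ℝ≥0∞) (hF : Measurable F) :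
    ∫⁻ a : unitInterval, ∫⁻ b : unitInterval, ∫⁻ c : unitInterval,
      F (sampleKey β τ a b (randIndex c β)) = ∫⁻ x : unitInterval, F (τ * x) := by
  have hβ : (0 : ℝ) ≤ β := Nat.cast_nonneg _
  rcases (hβ.trans h1).eq_or_lt with h0 | h0
  -- For τ = 0 the key is always 0.
  · have hβ0 : (β : ℝ) = 0 := le_antisymm (by rw [h0]; exact h1) hβ
    simp [sampleKey, ← h0, hβ0]
  set A := ∫⁻ b : unitInterval, ∫⁻ c : unitInterval, F (randIndex c β + b) with hA
  set A' := ∫⁻ b : unitInterval, F (β + (τ - β) * b) with hA'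
  have hmain : ∀ a : unitInterval, (∫⁻ b : unitInterval, ∫⁻ c : unitInterval,
      F (sampleKey β τ a b (randIndex c β))) =
        (fun y => if τ - β < y then A else A') (τ * a) := fun a => by
    simp only [sampleKey, mul_comm τ]
    split_ifs with h
    · rfl
    · simp only [lintegral_const, measure_univ, mul_one, hA', mul_comm (τ - (β : ℝ))]
  simp only [hmain]
  have hτ0 : ENNReal.ofReal τ ≠ 0 := by simpa using h0
  refine (ENNReal.mul_right_inj hτ0 ENNReal.ofReal_ne_top).1 ?_
  rw [lintegral_unitInterval_mul h0.le fun y => if τ - β < y then A else A',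
    lintegral_unitInterval_mul h0.le, lintegral_Ico_add (b := τ - β) (by linarith) (by linarith),
    lintegral_Ico_add (b := (β : ℝ)) hβ h1, add_comm]
  congr 1
  · rw [setLIntegral_congr Ioo_ae_eq_Ico.symm, setLIntegral_congr_fun (g := fun _ => A)
      measurableSet_Ioo fun y hy => if_pos hy.1]
    simp only [lintegral_const, MeasurableSet.univ, Measure.restrict_apply, Set.univ_inter,
      Real.volume_Ioo, sub_sub_cancel, ENNReal.ofReal_natCast]
    rw [hA, mul_comm, lintegral_lintegral_swap, mul_lintegral_randIndex β fun w =>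
      ∫⁻ b : unitInterval, F (w + b), lintegral_Ico_natCast]
    · refine Finset.sum_congr rfl fun w _ => ?_
      simpa using lintegral_unitInterval_affine zero_le_one (w : ℝ) F
    · refine (hF.comp (Measurable.add ?_ ?_)).aemeasurable
      · exact (measurable_of_countable fun n : ℕ => (n : ℝ)).comp
          ((measurable_randIndex β).comp measurable_snd)
      · exact measurable_subtype_coe.comp measurable_fst
  · rw [setLIntegral_congr_fun (g := fun _ => A') measurableSet_Ico fun y hy =>
      if_neg (not_lt.2 hy.2.le)]
    simp only [lintegral_const, MeasurableSet.univ, Measure.restrict_apply, Set.univ_inter,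
      Real.volume_Ico, sub_zero]
    rw [mul_comm, hA', lintegral_unitInterval_affine (by linarith)]
    simp

/-- The substitution a = x ^ k turns the uniform density into that of the maximum of `k` uniform
numbers. -/
theorem lintegral_maxKey {k : ℕ} (hk : k ≠ 0) (τ : ℝ) (F : ℝ → ℝ≥0∞) :
    ∫⁻ a : unitInterval, F (maxKey τ k a) =
      ∫⁻ x : unitInterval, ENNReal.ofReal (k * (x : ℝ) ^ (k - 1)) * F (τ * x) := by
  have hk' : (0 : ℝ) < k := by positivity
  have h1 := lintegral_unitInterval fun a => F (τ * Real.exp (Real.log a / k))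
  have h2 := lintegral_unitInterval fun x => ENNReal.ofReal (k * x ^ (k - 1)) * F (τ * x)
  rw [h2]
  simp only [maxKey]
  rw [h1]
  have himage : (fun x : ℝ => x ^ k) '' Set.Ioo 0 1 = Set.Ioo 0 1 := by
    ext y
    constructor
    · rintro ⟨x, hx, rfl⟩
      exact ⟨pow_pos hx.1 k, pow_lt_one₀ hx.1.le hx.2 hk⟩
    · intro hy
      refine ⟨y ^ (1 / (k : ℝ)), ⟨Real.rpow_pos_of_pos hy.1 _,
        Real.rpow_lt_one hy.1.le hy.2 (by positivity)⟩, ?_⟩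
      show (y ^ (1 / (k : ℝ))) ^ k = y
      rw [← Real.rpow_natCast, ← Real.rpow_mul hy.1.le, one_div_mul_cancel hk'.ne', Real.rpow_one]
  conv_lhs => rw [← himage]
  rw [lintegral_image_eq_lintegral_abs_deriv_mul measurableSet_Ioo
    (f' := fun x => k * x ^ (k - 1)) (fun x _ => (hasDerivAt_pow k x).hasDerivWithinAt) ?_]
  · refine setLIntegral_congr_fun measurableSet_Ioo fun x hx => ?_
    have : 0 ≤ k * x ^ (k - 1) := mul_nonneg hk'.le (pow_nonneg hx.1.le _)
    show ENNReal.ofReal |k * x ^ (k - 1)| * _ = _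
    rw [abs_of_nonneg this, Real.log_pow, mul_div_cancel_left₀ _ hk'.ne', Real.exp_log hx.1]
  · exact fun x hx y hy h => (pow_left_inj₀ hx.1.le hy.1.le hk).1 h

/-! ## Integrals over products of unit intervals -/

/-- Resampling one coordinate does not change a product measure; on boxes this is a product formula.
It takes the place of splitting the product into factors. -/
theorem lintegral_infinitePi_update {ι : Type*} {X : ι → Type*} {mX : ∀ i, MeasurableSpace (X i)}
    [DecidableEq ι] (μ : (i : ι) → Measure (X i)) [∀ i, IsProbabilityMeasure (μ i)] (i : ι)
    {f : (∀ i, X i) → ℝ≥0∞} (hf : Measurable f) :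
    ∫⁻ ω, ∫⁻ x, f (Function.update ω i x) ∂μ i ∂Measure.infinitePi μ =
      ∫⁻ ω, f ω ∂Measure.infinitePi μ := by
  have hm : Measurable fun p : (∀ i, X i) × X i => Function.update p.1 i p.2 := by
    refine measurable_pi_iff.2 fun j => ?_
    by_cases hj : j = i
    · subst hj
      simpa using measurable_snd
    · simp only [Function.update_of_ne hj]; exact (measurable_pi_apply (X := X) j).comp measurable_fst
  have hmap : ((Measure.infinitePi μ).prod (μ i)).map
      (fun p : (∀ i, X i) × X i => Function.update p.1 i p.2) = Measure.infinitePi μ := by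
    refine Measure.eq_infinitePi μ fun s t ht => ?_
    rw [Measure.map_apply hm (MeasurableSet.pi s.countable_toSet fun j _ => ht j)]
    by_cases hi : i ∈ s
    · have : (fun p : (∀ i, X i) × X i => Function.update p.1 i p.2) ⁻¹' Set.pi s t =
          Set.pi (s.erase i) t ×ˢ t i := by
        ext ⟨ω, x⟩
        simp only [Set.mem_preimage, Set.mem_pi, Set.mem_prod, Finset.coe_erase, Set.mem_sdiff,
          Finset.mem_coe, Set.mem_singleton_iff]
        constructor
        · intro h
          refine ⟨fun j hj => by simpa [hj.2] using h j hj.1, by simpa using h i hi⟩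
        · rintro ⟨h1, h2⟩ j hj
          by_cases hji : j = i
          · subst hji; simpa using h2
          · simpa [hji] using h1 j ⟨hj, hji⟩
      rw [this, Measure.prod_prod, Measure.infinitePi_pi _ fun j _ => ht j, mul_comm,
        Finset.mul_prod_erase s (fun i => μ i (t i)) hi]
    · have : (fun p : (∀ i, X i) × X i => Function.update p.1 i p.2) ⁻¹' Set.pi s t =
          Set.pi s t ×ˢ Set.univ := by
        ext ⟨ω, x⟩
        simp only [Set.mem_preimage, Set.mem_pi, Set.mem_prod, Finset.mem_coe, Set.mem_univ,
          and_true]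
        refine forall₂_congr fun j hj => ?_
        rw [Function.update_of_ne (fun h : j = i => hi (h ▸ Finset.mem_coe.1 hj))]
      rw [this, Measure.prod_prod, Measure.infinitePi_pi _ fun j _ => ht j, measure_univ, mul_one]
  conv_rhs => rw [← hmap, lintegral_map hf hm, lintegral_prod (fun p => f (Function.update p.1 i p.2)) (hf.comp hm).aemeasurable]

/-- The law of the random numbers of one access. -/
abbrev accessLaw : Measure (ℕ → unitInterval) := Measure.infinitePi fun _ => volume

theorem lintegral_accessLaw_two {f : unitInterval → unitInterval → ℝ≥0∞}
    (hf : Measurable (Function.uncurry f)) {i j : ℕ} (hij : i ≠ j) :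
    ∫⁻ u, f (u i) (u j) ∂accessLaw = ∫⁻ a, ∫⁻ b, f a b := by
  have h : ∀ {g : unitInterval → ℝ≥0∞} (_ : Measurable g) (k : ℕ),
      ∫⁻ u, g (u k) ∂accessLaw = ∫⁻ a, g a := fun hg k =>
    (measurePreserving_eval_infinitePi (fun _ : ℕ => (volume : Measure unitInterval)) k).lintegral_comp hg
  rw [← lintegral_infinitePi_update _ j (f := fun u : ℕ → unitInterval => f (u i) (u j))
    (show Measurable (Function.uncurry f ∘ fun u : ℕ → unitInterval => (u i, u j)) from
      hf.comp ((measurable_pi_apply i).prodMk (measurable_pi_apply j)))]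
  simp only [Function.update_self, Function.update_of_ne hij]
  exact h hf.lintegral_prod_right' i

theorem lintegral_accessLaw_three {f : unitInterval → unitInterval → unitInterval → ℝ≥0∞}
    (hf : Measurable fun p : unitInterval × unitInterval × unitInterval => f p.1 p.2.1 p.2.2)
    {i j k : ℕ} (hij : i ≠ j) (hik : i ≠ k) (hjk : j ≠ k) :
    ∫⁻ u, f (u i) (u j) (u k) ∂accessLaw = ∫⁻ a, ∫⁻ b, ∫⁻ c, f a b c := by
  rw [← lintegral_infinitePi_update _ k (f := fun u : ℕ → unitInterval => f (u i) (u j) (u k))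
    (show Measurable ((fun p : unitInterval × unitInterval × unitInterval => f p.1 p.2.1 p.2.2) ∘
      fun u : ℕ → unitInterval => (u i, u j, u k)) from hf.comp ((measurable_pi_apply i).prodMk
        ((measurable_pi_apply j).prodMk (measurable_pi_apply k))))]
  simp only [Function.update_self, Function.update_of_ne hik, Function.update_of_ne hjk]
  refine lintegral_accessLaw_two (f := fun a b => ∫⁻ c, f a b c) ?_ hij
  refine Measurable.lintegral_prod_right' (f := fun p : (unitInterval × unitInterval) × unitInterval =>
    f p.1.1 p.1.2 p.2) ?_
  have h3 : Measurable fun q : (unitInterval × unitInterval) × unitInterval =>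
    (q.1.1, q.1.2, q.2) := by fun_prop
  exact hf.comp h3

/-! ## The maximum of independent uniform numbers -/

section Max

theorem measurableSet_forall_lt {ι α : Type*} [MeasurableSpace α] (U : Finset ι) {f : α → ι → ℝ}
    {g : α → ℝ} (hf : Measurable f) (hg : Measurable g) :
    MeasurableSet {a | ∀ l ∈ U, f a l < g a} := by
  have : {a | ∀ l ∈ U, f a l < g a} = ⋂ l ∈ U, {a | f a l < g a} := by ext; simp
  rw [this]
  exact U.measurableSet_biInter fun l _ => measurableSet_lt (measurable_pi_iff.1 hf l) hg

variable {ι : Type*} [DecidableEq ι]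

/-- The coordinates in `U` are multiples of uniform numbers, the others are given by `κ`. -/
def scaled (U : Finset ι) (κ : ι → ℝ) (τ : ℝ) (x : ι → unitInterval) (j : ι) : ℝ :=
  if j ∈ U then τ * x j else κ j

variable {U : Finset ι} {κ : ι → ℝ} {τ v : ℝ} {j : ι}

theorem scaled_insert (x : ι → unitInterval) :
    scaled (insert j U) κ τ x = Function.update (scaled U κ τ x) j (τ * x j) := by
  funext l
  by_cases h : l = j
  · subst h; simp [scaled]
  · simp [scaled, h]

theorem scaled_update (hj : j ∉ U) (x : ι → unitInterval) (a : unitInterval) :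
    scaled U κ τ (Function.update x j a) = scaled U κ τ x := by
  funext l
  by_cases h : l = j
  · subst h; simp [scaled, hj]
  · simp [scaled, h]

theorem update_scaled_erase (x : ι → unitInterval) (y : ℝ) :
    Function.update (scaled (U.erase j) κ τ x) j y = Function.update (scaled U κ τ x) j y := by
  funext l
  by_cases h : l = j
  · subst h; simp
  · simp [scaled, h]

theorem measurable_scaled {α : Type*} [MeasurableSpace α] {f : α → ℝ} {g : α → ι → unitInterval}
    (hf : Measurable f) (hg : Measurable g) : Measurable fun a => scaled U κ (f a) (g a) := by
  refine measurable_pi_iff.2 fun l => ?_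
  by_cases h : l ∈ U
  · simp only [scaled, if_pos h]
    exact hf.mul (measurable_subtype_coe.comp ((measurable_pi_apply l).comp hg))
  · simp only [scaled, if_neg h]
    exact measurable_const

theorem measurable_update_pi {α : Type*} [MeasurableSpace α] {β : Type*} [MeasurableSpace β]
    {f : α → ι → β} {g : α → β} (hf : Measurable f) (hg : Measurable g) (j : ι) :
    Measurable fun a => Function.update (f a) j (g a) := by
  refine measurable_pi_iff.2 fun l => ?_
  by_cases h : l = j
  · subst h; simpa using hg
  · simpa [h] using measurable_pi_iff.1 hf l

theorem measurableSet_argmax (U : Finset ι) (τ v : ℝ) (j : ι) :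
    MeasurableSet {x : ι → unitInterval | v ≤ τ * (x j : ℝ) ∧ ∀ l ∈ U.erase j, (x l : ℝ) < x j} :=
  (measurableSet_le measurable_const (g := fun x : ι → unitInterval => τ * (x j : ℝ))
    (by fun_prop)).inter (measurableSet_forall_lt _ (f := fun (x : ι → unitInterval) l => (x l : ℝ))
      (g := fun x => (x j : ℝ)) (by fun_prop) (by fun_prop))

variable [Fintype ι]

theorem lintegral_update {f : (ι → unitInterval) → ℝ≥0∞} (hf : Measurable f) (j : ι) :
    ∫⁻ x, ∫⁻ a, f (Function.update x j a) = ∫⁻ x, f x := by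
  have := lintegral_infinitePi_update (fun _ : ι => (volume : Measure unitInterval)) j hf
  rwa [Measure.infinitePi_eq_pi] at this

theorem lintegral_update_swap {f : (ι → unitInterval) → ℝ≥0∞} (hf : Measurable f) (j : ι) :
    ∫⁻ a, ∫⁻ x, f (Function.update x j a) = ∫⁻ x, f x := by
  rw [← lintegral_update hf j, lintegral_lintegral_swap]
  exact (hf.comp (measurable_update_pi measurable_snd measurable_fst j)).aemeasurable

-- Uniform numbers below τ, conditioned to lie below v, are uniform below v. Multiplying with powers
-- of τ and v instead of dividing includes v = 0. The induction integrates one coordinate by a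
-- substitution and freezes it inside `H` for the others.
open Classical in
theorem lintegral_scaled_lt (hv : 0 ≤ v) (hvτ : v ≤ τ) {H : (ι → ℝ) → ℝ≥0∞} (hH : Measurable H) :
    ENNReal.ofReal τ ^ U.card *
      ∫⁻ x, (if ∀ l ∈ U, τ * (x l : ℝ) < v then H (scaled U κ τ x) else 0) =
    ENNReal.ofReal v ^ U.card * ∫⁻ x, H (scaled U κ v x) := by
  have hτ : 0 ≤ τ := hv.trans hvτ
  have hset : ∀ U : Finset ι, MeasurableSet {x : ι → unitInterval | ∀ l ∈ U, τ * (x l : ℝ) < v} :=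
    fun U => measurableSet_forall_lt U (f := fun (x : ι → unitInterval) l => τ * (x l : ℝ))
      (by fun_prop) measurable_const
  induction U using Finset.induction generalizing H with
  | empty =>
    have : ∀ (t : ℝ) (x : ι → unitInterval), scaled ∅ κ t x = κ := fun t x => by
      funext; simp [scaled]
    simp [this]
  | insert j U hj ih =>
    rw [Finset.card_insert_of_notMem hj]
    have hHs : ∀ t : ℝ, Measurable fun x : ι → unitInterval => H (scaled (insert j U) κ t x) :=
      fun t => hH.comp (measurable_scaled measurable_const measurable_id)
    rw [← lintegral_update_swap (Measurable.ite (hset _) (hHs τ) measurable_const) j]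
    set Ψ : ℝ → ℝ≥0∞ := fun y => ENNReal.ofReal v ^ U.card *
      ∫⁻ x, H (Function.update (scaled U κ v x) j y) with hΨ
    have hΨm : Measurable fun p : ℝ × (ι → unitInterval) =>
        H (Function.update (scaled U κ v p.2) j p.1) := hH.comp
      (measurable_update_pi (measurable_scaled measurable_const measurable_snd) measurable_fst j)
    have h1 : ∀ a : unitInterval, ENNReal.ofReal τ ^ U.card * (∫⁻ x : ι → unitInterval,
        if ∀ l ∈ insert j U, τ * (Function.update x j a l : ℝ) < v then
          H (scaled (insert j U) κ τ (Function.update x j a)) else 0) =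
        (fun y => if y < v then Ψ y else 0) (τ * a) := fun a => by
      have h2 : ∀ x : ι → unitInterval, (∀ l ∈ insert j U, τ * (Function.update x j a l : ℝ) < v) ↔
          τ * (a : ℝ) < v ∧ ∀ l ∈ U, τ * (x l : ℝ) < v := fun x => by
        rw [Finset.forall_mem_insert, Function.update_self]
        refine and_congr_right fun _ => forall₂_congr fun l hl => ?_
        rw [Function.update_of_ne (fun h : l = j => hj (h ▸ hl))]
      simp only [h2, scaled_insert, scaled_update hj, Function.update_self]
      by_cases ha : τ * (a : ℝ) < v
      · simp only [ha, true_and, if_true]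
        exact ih (H := fun y => H (Function.update y j (τ * a)))
          (hH.comp (measurable_update_pi measurable_id measurable_const j))
      · simp [ha]
    rw [pow_succ', mul_assoc, ← lintegral_const_mul' _ _ (by simp)]
    simp only [h1]
    rw [lintegral_unitInterval_mul hτ fun y => if y < v then Ψ y else 0, lintegral_Ico_add hv hvτ,
      setLIntegral_congr_fun (g := Ψ) measurableSet_Ico fun y hy => if_pos hy.2,
      setLIntegral_congr_fun (g := fun _ => 0) measurableSet_Ico fun y hy => if_neg (not_lt.2 hy.1),
      lintegral_zero, add_zero, ← lintegral_unitInterval_mul hv, hΨ, pow_succ', mul_assoc,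
      lintegral_const_mul' _ _ (by simp), ← lintegral_update_swap (hHs v) j]
    simp only [scaled_insert, scaled_update hj, Function.update_self]

/-- Resampling `x i` hits the fixed value `x j` with probability zero. -/
theorem ae_injective : ∀ᵐ x : ι → unitInterval, Function.Injective x := by
  have h : ∀ i j : ι, i ≠ j → ∀ᵐ x : ι → unitInterval, x i ≠ x j := by
    intro i j hij
    have hm : MeasurableSet {x : ι → unitInterval | x i = x j} :=
      measurableSet_eq_fun (measurable_pi_apply i) (measurable_pi_apply j)
    rw [ae_iff]
    simp only [not_not]
    rw [← lintegral_indicator_one hm, ← lintegral_update (measurable_one.indicator hm) i]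
    have : ∀ (x : ι → unitInterval) (a : unitInterval), Set.indicator
        {x : ι → unitInterval | x i = x j} (1 : (ι → unitInterval) → ℝ≥0∞) (Function.update x i a) =
        Set.indicator {x j} 1 a := fun x a => by
      simp only [Set.indicator_apply, Set.mem_ofPred_eq, Function.update_self,
        Function.update_of_ne hij.symm, Set.mem_singleton_iff, Pi.one_apply]
    simp only [this]
    simp only [lintegral_indicator_one (measurableSet_singleton _), measure_singleton, lintegral_zero]
  have := ae_all_iff.2 fun i => ae_all_iff.2 fun j => ae_all_iff.2 (h i j)
  filter_upwards [this] with x hx i j hij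
  by_contra hne
  exact hx i j hne hij

-- Fix the value of coordinate `j`. That the others lie below it is the event of
-- `lintegral_scaled_lt` for `U.erase j`, which contributes the power of `a` and makes them uniform
-- below τ a.
open Classical in
theorem lintegral_scaled_argmax (hτ : 0 < τ) (hj : j ∈ U) {H : (ι → ℝ) → ℝ≥0∞}
    (hH : Measurable H) :
    ∫⁻ x, (if v ≤ τ * (x j : ℝ) ∧ ∀ l ∈ U.erase j, (x l : ℝ) < x j then H (scaled U κ τ x) else 0) =
      ∫⁻ a : unitInterval, (if v ≤ τ * (a : ℝ) then ENNReal.ofReal a ^ (U.card - 1) *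
        ∫⁻ x, H (Function.update (scaled U κ (τ * a) x) j (τ * a)) else 0) := by
  have hHm : Measurable fun x : ι → unitInterval => H (scaled U κ τ x) :=
    hH.comp (measurable_scaled measurable_const measurable_id)
  rw [← lintegral_update_swap (Measurable.ite (measurableSet_argmax U τ v j) hHm measurable_const) j]
  refine lintegral_congr fun a => ?_
  have h1 : ∀ x : ι → unitInterval, (∀ l ∈ U.erase j,
      ((Function.update x j a l : unitInterval) : ℝ) < a) ↔
      ∀ l ∈ U.erase j, τ * (x l : ℝ) < τ * a := fun x => by
    refine forall₂_congr fun l hl => ?_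
    rw [Function.update_of_ne (Finset.ne_of_mem_erase hl), mul_lt_mul_iff_right₀ hτ]
  have h2 : ∀ x : ι → unitInterval, scaled U κ τ (Function.update x j a) =
      Function.update (scaled (U.erase j) κ τ x) j (τ * a) := fun x => by
    conv_lhs => rw [← Finset.insert_erase hj, scaled_insert, Function.update_self,
      scaled_update (Finset.notMem_erase j U)]
  simp only [Function.update_self, h1, h2]
  by_cases ha : v ≤ τ * (a : ℝ)
  · simp only [ha, true_and, if_true]
    have h3 := lintegral_scaled_lt (U := U.erase j) (κ := κ) (v := τ * a) (τ := τ)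
      (mul_nonneg hτ.le a.2.1) (mul_le_of_le_one_right hτ.le a.2.2)
      (H := fun y => H (Function.update y j (τ * a)))
      (hH.comp (measurable_update_pi measurable_id measurable_const j))
    rw [ENNReal.ofReal_mul hτ.le, mul_pow, mul_assoc, Finset.card_erase_of_mem hj] at h3
    have hne : ENNReal.ofReal τ ^ (U.card - 1) ≠ 0 := pow_ne_zero _ (by simpa using hτ)
    have hnt : ENNReal.ofReal τ ^ (U.card - 1) ≠ ⊤ := ENNReal.pow_ne_top ENNReal.ofReal_ne_top
    simpa only [update_scaled_erase] using (ENNReal.mul_right_inj hne hnt).1 h3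
  · simp [ha]

-- Either all coordinates in `U` are below v, or exactly one of them is the largest and is at least
-- v; ties have measure zero.
open Classical in
theorem lintegral_scaled_eq_add (hτ : 0 < τ) {H : (ι → ℝ) → ℝ≥0∞}
    (hH : Measurable H) :
    ∫⁻ x, H (scaled U κ τ x) =
      (∫⁻ x : ι → unitInterval, if ∀ l ∈ U, τ * (x l : ℝ) < v then H (scaled U κ τ x) else 0) +
      ∑ j ∈ U, ∫⁻ a : unitInterval, (if v ≤ τ * (a : ℝ) then ENNReal.ofReal a ^ (U.card - 1) *
        ∫⁻ x, H (Function.update (scaled U κ (τ * a) x) j (τ * a)) else 0) := by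
  have hHm : Measurable fun x : ι → unitInterval => H (scaled U κ τ x) :=
    hH.comp (measurable_scaled measurable_const measurable_id)
  have hset : MeasurableSet {x : ι → unitInterval | ∀ l ∈ U, τ * (x l : ℝ) < v} :=
    measurableSet_forall_lt U (f := fun (x : ι → unitInterval) l => τ * (x l : ℝ))
      (by fun_prop) measurable_const
  rw [← Finset.sum_congr rfl fun j hj => lintegral_scaled_argmax hτ hj hH,
    ← lintegral_finsetSum _ fun j _ => Measurable.ite (measurableSet_argmax U τ v j) hHm measurable_const,
    ← lintegral_add_left (Measurable.ite hset hHm measurable_const)]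
  refine lintegral_congr_ae ?_
  filter_upwards [ae_injective] with x hx
  by_cases hlt : ∀ l ∈ U, τ * (x l : ℝ) < v
  · rw [if_pos hlt, Finset.sum_eq_zero, add_zero]
    intro j hj
    exact if_neg fun h => absurd (hlt j hj) (not_lt.2 h.1)
  · rw [if_neg hlt, zero_add]
    push Not at hlt
    obtain ⟨i, hi, hiv⟩ := hlt
    obtain ⟨j, hj, hmax⟩ := U.exists_max_image (fun l => (x l : ℝ)) ⟨i, hi⟩
    rw [Finset.sum_eq_single_of_mem j hj]
    · rw [if_pos]
      refine ⟨hiv.trans (mul_le_mul_of_nonneg_left (hmax i hi) hτ.le), fun l hl => ?_⟩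
      refine lt_of_le_of_ne (hmax l (Finset.mem_of_mem_erase hl)) fun h => ?_
      exact Finset.ne_of_mem_erase hl (hx (Subtype.ext h))
    · intro l hl hlj
      rw [if_neg]
      rintro ⟨-, h⟩
      exact absurd (h j (Finset.mem_erase.2 ⟨hlj.symm, hj⟩)) (not_lt.2 (hmax l hl))

-- The probabilistic core of a sorted access. The density k x ^ (k - 1) of the maximum, divided
-- among `k` equally likely positions, is exactly the weight of each summand of
-- `lintegral_scaled_eq_add`; below v the value of the maximum is forgotten.
open Classical in
theorem lintegral_maxKey_scaled (hU : U.Nonempty) (hv : 0 ≤ v) (hvτ : v ≤ τ) {H : (ι → ℝ) → ℝ≥0∞}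
    (hH : Measurable H) :
    ∫⁻ a : unitInterval, (fun y => if y < v then ∫⁻ x, H (scaled U κ v x) else
      (∑ j ∈ U, ∫⁻ x, H (Function.update (scaled U κ y x) j y)) / U.card) (maxKey τ U.card a) =
      ∫⁻ x, H (scaled U κ τ x) := by
  have hk : U.card ≠ 0 := hU.card_pos.ne'
  have hk0 : (U.card : ℝ≥0∞) ≠ 0 := by exact_mod_cast hk
  have hkt : (U.card : ℝ≥0∞) ≠ ⊤ := ENNReal.natCast_ne_top _
  rcases (hv.trans hvτ).eq_or_lt with h0 | hτ
  -- For τ = 0 all coordinates in `U` are 0 and nothing is random.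
  · have hv0 : v = 0 := le_antisymm (hvτ.trans h0.symm.le) hv
    have : ∀ j ∈ U, ∀ x : ι → unitInterval, Function.update (scaled U κ 0 x) j 0 = scaled U κ 0 x := by
      intro j hj x
      rw [Function.update_eq_self_iff]
      simp [scaled, hj]
    simp only [← h0, maxKey, zero_mul, hv0, lt_irrefl, if_false, lintegral_const, measure_univ,
      mul_one]
    rw [Finset.sum_congr rfl fun j hj => by rw [lintegral_congr fun x => by rw [this j hj x]],
      Finset.sum_const, nsmul_eq_mul, ENNReal.mul_div_right_comm, ENNReal.div_self hk0 hkt, one_mul]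
  have hset : MeasurableSet {x : unitInterval | τ * (x : ℝ) < v} :=
    measurableSet_lt (by fun_prop) measurable_const
  have hofReal : ∀ x : unitInterval, ENNReal.ofReal (U.card * (x : ℝ) ^ (U.card - 1)) =
      U.card * ENNReal.ofReal x ^ (U.card - 1) := fun x => by
    rw [ENNReal.ofReal_mul (Nat.cast_nonneg _), ENNReal.ofReal_natCast, ENNReal.ofReal_pow x.2.1]
  set A := ∫⁻ x, H (scaled U κ v x) with hA
  -- the two probabilities
  set p : ℝ≥0∞ := ∫⁻ x : unitInterval, (if τ * (x : ℝ) < v then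
    U.card * ENNReal.ofReal x ^ (U.card - 1) else 0) with hp
  set q : ℝ≥0∞ := ∫⁻ x : ι → unitInterval, (if ∀ l ∈ U, τ * (x l : ℝ) < v then 1 else 0) with hq
  have hpow : Measurable fun x : unitInterval => (U.card : ℝ≥0∞) * ENNReal.ofReal x ^ (U.card - 1) := by
    fun_prop
  have hsplit : ∀ (B : ℝ≥0∞) (G : ℝ → ℝ≥0∞),
      ∫⁻ a : unitInterval, (fun y => if y < v then B else G y / U.card) (maxKey τ U.card a) =
        p * B + ∫⁻ a : unitInterval, (if v ≤ τ * (a : ℝ) then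
          ENNReal.ofReal a ^ (U.card - 1) * G (τ * a) else 0) := by
    intro B G
    rw [lintegral_maxKey hk τ fun y => if y < v then B else G y / U.card, hp,
      ← lintegral_mul_const _ (Measurable.ite hset hpow measurable_const),
      ← lintegral_add_left ((Measurable.ite hset hpow measurable_const).mul_const _)]
    refine lintegral_congr fun a => ?_
    rw [hofReal]
    by_cases ha : τ * (a : ℝ) < v
    · rw [if_pos ha, if_pos ha, if_neg (not_le.2 ha), add_zero]
    · rw [if_neg ha, if_neg ha, if_pos (not_lt.1 ha), zero_mul, zero_add, mul_comm (U.card : ℝ≥0∞),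
        mul_assoc, ENNReal.mul_div_cancel hk0 hkt]
  -- Both are the probability that the maximum is below v. Instead of evaluating them, the two
  -- decompositions are compared for the constant function 1: both have total mass 1 and share their
  -- second term, which is finite.
  have hpq : p = q := by
    have h1 := hsplit 1 fun _ => U.card
    have h2 := lintegral_scaled_eq_add (U := U) (κ := κ) (v := v) hτ (H := fun _ => 1) measurable_const
    simp only [ENNReal.div_self hk0 hkt, ite_self, lintegral_const, measure_univ, mul_one] at h1 h2
    rw [Finset.sum_const, nsmul_eq_mul, ← lintegral_const_mul' _ _ hkt] at h2
    have h3 : ∀ a : unitInterval, (U.card : ℝ≥0∞) * (if v ≤ τ * (a : ℝ) then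
        ENNReal.ofReal a ^ (U.card - 1) else 0) = if v ≤ τ * (a : ℝ) then
        ENNReal.ofReal a ^ (U.card - 1) * U.card else 0 := fun a => by
      split_ifs
      · rw [mul_comm]
      · rw [mul_zero]
    simp only [h3] at h2
    refine (ENNReal.add_left_inj ?_).1 (h1.symm.trans h2)
    refine ne_top_of_le_ne_top ENNReal.one_ne_top ?_
    rw [h1]
    exact le_add_self
  have hqA : q * A = ∫⁻ x : ι → unitInterval,
      if ∀ l ∈ U, τ * (x l : ℝ) < v then H (scaled U κ τ x) else 0 := by
    have hne : ENNReal.ofReal τ ^ U.card ≠ 0 := pow_ne_zero _ (by simpa using hτ)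
    have hnt : ENNReal.ofReal τ ^ U.card ≠ ⊤ := ENNReal.pow_ne_top ENNReal.ofReal_ne_top
    have h1 := lintegral_scaled_lt (U := U) (κ := κ) hv hvτ (H := fun _ => 1) measurable_const
    rw [lintegral_one, measure_univ, mul_one] at h1
    refine (ENNReal.mul_right_inj hne hnt).1 ?_
    rw [lintegral_scaled_lt hv hvτ hH, ← mul_assoc, h1]
  rw [hsplit A fun y => ∑ j ∈ U, ∫⁻ x, H (Function.update (scaled U κ y x) j y), hpq, hqA,
    lintegral_scaled_eq_add (v := v) hτ hH]
  congr 1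
  rw [← lintegral_finsetSum]
  · refine lintegral_congr fun a => ?_
    split_ifs
    · rw [Finset.mul_sum]
    · simp
  · intro j _
    refine Measurable.ite (measurableSet_le measurable_const (by fun_prop)) (Measurable.mul
      (by fun_prop) ?_) measurable_const
    refine Measurable.lintegral_prod_right' (f := fun p : unitInterval × (ι → unitInterval) =>
      H (Function.update (scaled U κ (τ * p.1) p.2) j (τ * p.1))) ?_
    refine hH.comp (measurable_update_pi (measurable_scaled (by fun_prop) measurable_snd)
      (by fun_prop) j)

end Max

/-! ## The effect of an access on the store -/

theorem Sim.coreEq {s t : Store} (h : Sim s t) : CoreEq s t :=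
  ⟨h.wordReg _ (by norm_num), h.wordReg _ (by norm_num), h.wordReg _ (by norm_num),
    h.wordReg _ (by norm_num), h.wordReg _ (by norm_num), h.wordMem, h.realMem⟩

section Result

variable {m W : ℕ} {ε : ℝ} {s : Store} {ret : Finset ℕ}

theorem Sim.inv {s t : Store} (h : Sim s t) {bk : ℕ → ℕ} {lf : ℕ → ℕ → ℕ}
    (hI : Inv m ε s ret bk lf) : Inv m ε t ret bk lf :=
  hI.congr h.coreEq (h.realReg _ (by norm_num)) (h.realReg _ (by norm_num))
    (h.wordReg _ (by norm_num))

theorem Sim.compl_eq {s t : Store} (h : Sim s t) : compl m t = compl m s := by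
  have : tau m t = tau m s := by
    rw [tau, tau, h.wordReg 2 (by norm_num), h.realReg 2 (by norm_num)]
  funext x
  rw [compl, compl, h.coreEq.complWith_eq, this]

theorem Ready.result_random (hB : Big m (m + 2) W) (h : Ready m ε s ret) (N : Noise) (i : Fin m) :
    ∃ t₀, ∀ u, ∃ t : ℕ, haltTime W u ((oracle N).start s (.random i)) ≤ t ∧
      RandomPost m N ε s ret i t (u (t₀ + 1)) (u (t₀ + 3)) (u (t₀ + 5))
        ((oracle N).result W u s (.random i)) := by
  obtain ⟨t₀, ht₀⟩ := h.exec_random hB N i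
  refine ⟨t₀, fun u => ?_⟩
  obtain ⟨t, s', e, hp⟩ := ht₀ u
  obtain ⟨s'', hs, e⟩ := e _ (Sim.refl _)
  refine ⟨t, e.haltTime_le, ?_⟩
  have hr : (oracle N).result W u s (.random i) = s'' := e.run_haltTime
  rw [hr]
  obtain ⟨bk, lf, hI⟩ := hp.inv
  refine ⟨⟨bk, lf, hs.inv hI⟩, (hs.wordReg _ (by norm_num)).trans hp.item, ?_,
    (hs.coreEq.known_iff _).2 hp.known, ?_, ?_⟩
  · rw [hs.realReg _ (by norm_num), hs.realMem]; exact hp.value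
  · rw [hs.compl_eq]; exact hp.compl_eq
  · rw [hs.compl_eq]; exact hp.time

theorem Ready.result_sorted (hB : Big m (m + 2) W) (h : Ready m ε s ret) (hr : ret.card < m)
    (N : Noise) :
    ∃ t₀ v₀, 0 ≤ v₀ ∧ v₀ ≤ tau m s ∧ ∀ u, ∃ (t : ℕ) (i : ℕ),
      haltTime W u ((oracle N).start (m := m) s .sorted) ≤ t ∧
      SortedPost m N ε s ret v₀ t (u (t₀ + 1)) (u (t₀ + 21))
        ((oracle N).result (m := m) W u s .sorted) i := by
  obtain ⟨t₀, v₀, h0, hτ, ht₀⟩ := h.exec_sorted hB hr N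
  refine ⟨t₀, v₀, h0, hτ, fun u => ?_⟩
  obtain ⟨t, s', i, e, hp⟩ := ht₀ u
  obtain ⟨s'', hs, e⟩ := e _ (Sim.refl _)
  refine ⟨t, i, e.haltTime_le, ?_⟩
  have hr : (oracle N).result (m := m) W u s .sorted = s'' := e.run_haltTime
  rw [hr]
  obtain ⟨bk, lf, hI⟩ := hp.inv
  refine ⟨⟨bk, lf, hs.inv hI⟩, hp.lt, hp.not_mem, (hs.wordReg _ (by norm_num)).trans hp.item, ?_,
    (hs.coreEq.known_iff _).2 hp.known, ?_, ?_, ?_, ?_, ?_⟩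
  · rw [hs.realReg _ (by norm_num), hs.realMem]; exact hp.value
  · rw [hs.realMem]; exact hp.le
  · rw [hs.compl_eq]; exact hp.compl_eq_all
  · rw [hs.compl_eq]; exact hp.compl_eq_lt
  · rw [hs.compl_eq]; exact hp.compl_eq_ge
  · rw [hs.compl_eq]; exact hp.time

/-! ## The law of the completed keys does not change -/

open Classical in
theorem complWith_eq_scaled (m : ℕ) (s : Store) (τ : ℝ) (x : Fin m → unitInterval) :
    complWith m s τ x = scaled (Finset.univ.filter fun j : Fin m => ¬ Known m s j)
      (fun j => s.realMem (j + 1)) τ x := by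
  funext j
  by_cases h : Known m s j <;> simp [complWith, scaled, h]

theorem measurable_complWith {α : Type*} [MeasurableSpace α] {f : α → ℝ}
    {g : α → Fin m → unitInterval} (hf : Measurable f) (hg : Measurable g) (s : Store) :
    Measurable fun a => complWith m s (f a) (g a) := by
  simp only [complWith_eq_scaled]
  exact measurable_scaled hf hg

theorem measurable_compl (m : ℕ) (s : Store) : Measurable (compl m s) :=
  measurable_complWith measurable_const measurable_id s

theorem complWith_update {i : Fin m} (hi : ¬ Known m s i) (τ : ℝ) (x : Fin m → unitInterval)
    (a : unitInterval) :
    complWith m s τ (Function.update x i a) = Function.update (complWith m s τ x) i (τ * a) := by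
  funext j
  by_cases h : j = i
  · subst h; simp [complWith, hi]
  · simp [complWith, h]

theorem measurable_sampleKey (β : ℕ) (τ : ℝ) :
    Measurable fun p : unitInterval × unitInterval × unitInterval =>
      sampleKey β τ p.1 p.2.1 (randIndex p.2.2 β) := by
  refine Measurable.ite (measurableSet_lt measurable_const (by fun_prop)) (Measurable.add ?_
    (by fun_prop)) (by fun_prop)
  exact (measurable_of_countable fun n : ℕ => (n : ℝ)).comp
    ((measurable_randIndex β).comp (measurable_snd.comp measurable_snd))

theorem Ready.beta_le (hm : 1 ≤ m) (h : Ready m ε s ret) : (beta m s : ℝ) ≤ tau m s := by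
  rcases h with ⟨h, -⟩ | ⟨bk, lf, h⟩
  · rw [beta, tau, if_pos h.reg2, if_pos h.reg2]
    exact_mod_cast Nat.sub_le _ _
  · rw [h.tau_eq hm, h.beta_eq hm]; exact h.beta_le

theorem Ready.perm (h : Ready m ε s ret) : s.wordReg 4 ≤ m ∧
    (∀ x < m, permQ m s.wordMem (permP m s.wordMem x) = x) ∧
    (∀ i < m, permP m s.wordMem (permQ m s.wordMem i) = i) := by
  rcases h with ⟨h, -⟩ | ⟨bk, lf, h⟩
  · rw [h.reg4, h.wordMem]
    exact ⟨Nat.zero_le _, fun x hx => by rw [permP_zero hx, permQ_zero hx],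
      fun x hx => by rw [permQ_zero hx, permP_zero hx]⟩
  · exact ⟨h.reg4, h.QP, h.PQ⟩

/-- The sampled key has the law of τ x_i and is independent of the other coordinates, so putting it
in amounts to resampling one coordinate of `x`. -/
theorem Ready.lintegral_random (hB : Big m (m + 2) W) (h : Ready m ε s ret) (N : Noise) (i : Fin m)
    {f : (Fin m → ℝ) → ℝ≥0∞} (hf : Measurable f) :
    ∫⁻ u, (∫⁻ x, f (compl m ((oracle N).result W u s (.random i)) x)) ∂accessLaw =
      ∫⁻ x, f (compl m s x) := by
  obtain ⟨t₀, ht₀⟩ := h.result_random hB N i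
  by_cases hk : Known m s i
  · have : ∀ u x, compl m ((oracle N).result W u s (.random i)) x = compl m s x := fun u x => by
      obtain ⟨t, -, hp⟩ := ht₀ u
      rw [hp.compl_eq, if_pos hk]
    simp [this]
  · have : ∀ u x, compl m ((oracle N).result W u s (.random i)) x =
        Function.update (compl m s x) i (sampleKey (beta m s) (tau m s) (u (t₀ + 1)) (u (t₀ + 3))
          (randIndex (u (t₀ + 5)) (beta m s))) := fun u x => by
      obtain ⟨t, -, hp⟩ := ht₀ u
      rw [hp.compl_eq, if_neg hk]
    simp only [this]
    set F : ℝ → ℝ≥0∞ := fun y => ∫⁻ x, f (Function.update (compl m s x) i y) with hF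
    have hFm : Measurable F := Measurable.lintegral_prod_right'
      (f := fun p : ℝ × (Fin m → unitInterval) => f (Function.update (compl m s p.2) i p.1))
      (hf.comp (measurable_update_pi ((measurable_compl m s).comp measurable_snd) measurable_fst i))
    rw [lintegral_accessLaw_three (f := fun a b c => F (sampleKey (beta m s) (tau m s) a b
      (randIndex c (beta m s)))) (hFm.comp (measurable_sampleKey _ _)) (by omega) (by omega)
      (by omega), lintegral_sampleKey (h.beta_le hB.hm) F hFm, hF]
    have h1 := lintegral_update_swap (hf.comp (measurable_compl m s)) i
    simpa only [Function.comp, compl, complWith_update hk] using h1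

/-- The positions from register 4 onwards enumerate the unknown items bijectively, so the chosen
item is uniform among them. -/
theorem Ready.lintegral_newItem (hm : 1 ≤ m) (h : Ready m ε s ret) (hr : s.wordReg 4 < m)
    (F : ℕ → ℝ≥0∞) :
    (Finset.univ.filter fun j : Fin m => ¬ Known m s j).card = m - s.wordReg 4 ∧
    ∫⁻ d, F (newItem m s d) =
      (∑ j ∈ Finset.univ.filter (fun j : Fin m => ¬ Known m s j), F j) /
        (m - s.wordReg 4 : ℕ) := by
  classical
  obtain ⟨-, hQP, hPQ⟩ := h.perm
  set r := s.wordReg 4 with hr4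
  have hsum : ∀ F : ℕ → ℝ≥0∞, ∑ w ∈ Finset.range (m - r), F (permP m s.wordMem (r + w)) =
      ∑ j ∈ Finset.univ.filter (fun j : Fin m => ¬ Known m s j), F j := by
    intro F
    refine Finset.sum_bij' (fun w _ => ⟨permP m s.wordMem (r + w), permP_lt hm _ _⟩)
      (fun j _ => permQ m s.wordMem j - r) ?_ ?_ ?_ ?_ ?_
    · intro w hw
      rw [Finset.mem_range] at hw
      rw [Finset.mem_filter, Known, hQP _ (by omega)]
      exact ⟨Finset.mem_univ _, by omega⟩
    · intro j hj
      rw [Finset.mem_filter, Known] at hj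
      have := permQ_lt hm s.wordMem j
      rw [Finset.mem_range]
      omega
    · intro w hw
      rw [Finset.mem_range] at hw
      simp only []
      rw [hQP _ (by omega)]
      omega
    · intro j hj
      rw [Finset.mem_filter, Known] at hj
      apply Fin.ext
      simp only []
      rw [show r + (permQ m s.wordMem j - r) = permQ m s.wordMem j by omega, hPQ _ j.2]
    · intro w _
      rfl
  have hcard : (Finset.univ.filter fun j : Fin m => ¬ Known m s j).card = m - r := by
    have := hsum fun _ => 1
    simp only [Finset.sum_const, Finset.card_range, nsmul_eq_mul, mul_one] at this
    exact_mod_cast this.symm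
  refine ⟨hcard, ?_⟩
  have hk : ((m - r : ℕ) : ℝ≥0∞) ≠ 0 := by
    simp only [ne_eq, Nat.cast_eq_zero]
    omega
  rw [ENNReal.eq_div_iff hk (ENNReal.natCast_ne_top _), ← hsum F]
  exact mul_lintegral_randIndex (m - r) fun w => F (permP m s.wordMem (r + w))

theorem measurable_maxKey (τ : ℝ) (k : ℕ) : Measurable (maxKey τ k) := by
  refine measurable_const.mul (Real.measurable_exp.comp (Measurable.div_const ?_ _))
  exact Real.measurable_log.comp measurable_subtype_coe

/-- Integrating over the choice of the item first produces the average over the unknown items that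
`lintegral_maxKey_scaled` asks for. -/
theorem Ready.lintegral_sorted (hB : Big m (m + 2) W) (h : Ready m ε s ret) (hr : ret.card < m)
    (N : Noise) {f : (Fin m → ℝ) → ℝ≥0∞} (hf : Measurable f) :
    ∫⁻ u, (∫⁻ x, f (compl m ((oracle N).result (m := m) W u s .sorted) x)) ∂accessLaw =
      ∫⁻ x, f (compl m s x) := by
  classical
  have hm := hB.hm
  obtain ⟨t₀, v₀, hv0, hvτ, ht₀⟩ := h.result_sorted hB hr N
  by_cases hk : s.wordReg 4 = m
  · have : ∀ u x, compl m ((oracle N).result (m := m) W u s .sorted) x = compl m s x := fun u x => by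
      obtain ⟨t, i, -, hp⟩ := ht₀ u
      exact hp.compl_eq_all hk x
    simp [this]
  have hk : s.wordReg 4 < m := lt_of_le_of_ne h.perm.1 hk
  set J : unitInterval → Fin m := fun d => ⟨newItem m s d, permP_lt hm _ _⟩ with hJ
  set U := Finset.univ.filter (fun j : Fin m => ¬ Known m s j) with hU
  set κ : Fin m → ℝ := fun j => s.realMem (j + 1) with hκ
  set g : Fin m → ℝ → ℝ≥0∞ := fun j y => ∫⁻ x, f (Function.update (scaled U κ y x) j y) with hg
  set A := ∫⁻ x, f (scaled U κ v₀ x) with hA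
  have hgm : ∀ j, Measurable (g j) := fun j => Measurable.lintegral_prod_right'
    (f := fun p : ℝ × (Fin m → unitInterval) => f (Function.update (scaled U κ p.1 p.2) j p.1))
    (hf.comp (measurable_update_pi (measurable_scaled measurable_fst measurable_snd) measurable_fst j))
  have hu : ∀ u, ∫⁻ x, f (compl m ((oracle N).result (m := m) W u s .sorted) x) =
      if newKey m s (u (t₀ + 1)) < v₀ then A else g (J (u (t₀ + 21))) (newKey m s (u (t₀ + 1))) := by
    intro u
    obtain ⟨t, i, -, hp⟩ := ht₀ u
    split_ifs with hlt
    · exact lintegral_congr fun x => by rw [hp.compl_eq_lt hk hlt, complWith_eq_scaled]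
    · refine lintegral_congr fun x => congrArg f (funext fun j => ?_)
      rw [hp.compl_eq_ge hk (not_lt.1 hlt), complWith_eq_scaled, Function.update_apply]
      simp only [hJ, Fin.ext_iff]
      rfl
  have hJm : Measurable J := by
    have h1 : Measurable fun d : unitInterval => newItem m s d :=
      (measurable_of_countable fun w : ℕ => permP m s.wordMem (s.wordReg 4 + w)).comp
        (measurable_randIndex (m - s.wordReg 4))
    refine measurable_to_countable' fun j => ?_
    have : J ⁻¹' {j} = (fun d => newItem m s d) ⁻¹' {(j : ℕ)} := by
      ext d; simp [hJ, Fin.ext_iff]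
    rw [this]
    exact h1 (measurableSet_singleton _)
  have hnm : Measurable (newKey m s) := measurable_maxKey _ _
  have hgJ : Measurable fun p : unitInterval × unitInterval => g (J p.2) (newKey m s p.1) := by
    have h1 : Measurable fun p : Fin m × ℝ => g p.1 p.2 := measurable_from_prod_countable_right hgm
    exact h1.comp ((hJm.comp measurable_snd).prodMk (hnm.comp measurable_fst))
  simp only [hu]
  rw [lintegral_accessLaw_two (f := fun a d => if newKey m s a < v₀ then A else
    g (J d) (newKey m s a)) (Measurable.ite (measurableSet_lt (hnm.comp measurable_fst)
      measurable_const) measurable_const hgJ) (by omega)]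
  have hcard := (h.lintegral_newItem hm hk fun _ => 0).1
  have hin : ∀ a, ∫⁻ d, (if newKey m s a < v₀ then A else g (J d) (newKey m s a)) =
      (fun y => if y < v₀ then A else (∑ j ∈ U, g j y) / U.card) (maxKey (tau m s) U.card a) := by
    intro a
    rw [hcard, ← newKey]
    by_cases hlt : newKey m s a < v₀
    · simp [hlt]
    · simp only [hlt, if_false]
      have h2 := (h.lintegral_newItem hm hk fun i => if hi : i < m then g ⟨i, hi⟩ (newKey m s a)
        else 0).2
      simp only [show ∀ d, newItem m s d < m from fun d => permP_lt hm _ _, dif_pos, Fin.is_lt,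
        Fin.eta] at h2
      exact h2
  simp only [hin]
  have hUne : U.Nonempty := Finset.card_pos.1 (by rw [hcard]; omega)
  rw [lintegral_maxKey_scaled hUne hv0 hvτ hf]
  simp only [compl, complWith_eq_scaled]
  rfl

theorem Ready.lintegral_result (hB : Big m (m + 2) W) (h : Ready m ε s ret) (N : Noise) (q : Query m)
    (hr : q = .sorted → ret.card < m) {f : (Fin m → ℝ) → ℝ≥0∞} (hf : Measurable f) :
    ∫⁻ u, (∫⁻ x, f (compl m ((oracle N).result W u s q) x)) ∂accessLaw = ∫⁻ x, f (compl m s x) := by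
  cases q with
  | sorted => exact h.lintegral_sorted hB (hr rfl) N hf
  | random i => exact h.lintegral_random hB N i hf

end Result

/-! ## The noise as a function of uniform numbers -/

section Quantile

variable {N : Noise} {ε : ℝ}

theorem Noise.measurable_quantile (N : Noise) : Measurable N.quantile := by
  cases N with
  | laplace =>
    refine Measurable.ite measurableSet_Iio ?_ ?_
    · exact Real.measurable_log.comp (by fun_prop)
    · exact (Real.measurable_log.comp (by fun_prop)).neg
  | gumbel => exact (Real.measurable_log.comp Real.measurable_log.neg).neg

theorem Noise.strictMonoOn_quantile (N : Noise) : StrictMonoOn N.quantile (Set.Ioo 0 1) := by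
  intro x hx y hy hxy
  obtain ⟨hx0, hx1⟩ := hx
  obtain ⟨hy0, hy1⟩ := hy
  cases N with
  | laplace =>
    simp only [Noise.quantile]
    have hlog : ∀ t : ℝ, 0 < t → t < 1 / 2 → Real.log (2 * t) < 0 := fun t h0 h1 =>
      Real.log_neg (by linarith) (by linarith)
    have hlog' : ∀ t : ℝ, t < 1 → ¬ t < 1 / 2 → Real.log (2 * (1 - t)) ≤ 0 := fun t h0 h1 =>
      Real.log_nonpos (by linarith) (by linarith)
    split_ifs with h1 h2 h2
    · exact Real.log_lt_log (by linarith) (by linarith)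
    · linarith [hlog x hx0 h1, hlog' y hy1 h2]
    · linarith
    · exact neg_lt_neg (Real.log_lt_log (by linarith) (by linarith))
  | gumbel =>
    have h1 := Real.log_lt_log hx0 hxy
    have h2 := Real.log_neg hy0 hy1
    exact neg_lt_neg (Real.log_lt_log (by linarith) (by linarith))

/-- Change of variables by the distribution function `G`, whose derivative is the density; the
quantile is its inverse. -/
theorem lintegral_quantile_image {s T : Set ℝ} (hs : MeasurableSet s) {G : ℝ → ℝ}
    (hd : ∀ z, 0 ≤ N.density (1 / ε) z)
    (hG : ∀ z ∈ s, HasDerivWithinAt G (N.density (1 / ε) z) s z) (hmaps : Set.MapsTo G s T)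
    (hleft : ∀ z ∈ s, N.quantile (G z) / ε = z)
    (hright : ∀ x ∈ T, N.quantile x / ε ∈ s ∧ G (N.quantile x / ε) = x) (F : ℝ → ℝ≥0∞) :
    ∫⁻ x in T, F (N.quantile x / ε) =
      ∫⁻ z in s, ENNReal.ofReal (N.density (1 / ε) z) * F z := by
  have himage : G '' s = T := Set.Subset.antisymm hmaps.image_subset
    fun x hx => ⟨_, (hright x hx).1, (hright x hx).2⟩
  rw [← himage, lintegral_image_eq_lintegral_abs_deriv_mul hs hG fun x hx y hy h => by
    rw [← hleft x hx, ← hleft y hy, h]]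
  refine setLIntegral_congr_fun hs fun z hz => ?_
  simp only [abs_of_nonneg (hd z), hleft z hz]

theorem density_laplace (hε : 0 < ε) (z : ℝ) :
    Noise.laplace.density (1 / ε) z = ε / 2 * Real.exp (-(|z| * ε)) := by
  rw [Noise.density, div_div_eq_mul_div, div_one]
  congr 1
  field_simp

theorem density_gumbel (z : ℝ) :
    Noise.gumbel.density (1 / ε) z = ε * Real.exp (-(z * ε + Real.exp (-(z * ε)))) := by
  simp only [Noise.density, one_div, div_inv_eq_mul, one_mul]

theorem lintegral_quantile (hε : 0 < ε) (N : Noise) (F : ℝ → ℝ≥0∞) :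
    ∫⁻ x : unitInterval, F (N.quantile x / ε) =
      ∫⁻ z, ENNReal.ofReal (N.density (1 / ε) z) * F z := by
  rw [lintegral_unitInterval fun x => F (N.quantile x / ε)]
  have hε' := hε.ne'
  cases N with
  | gumbel =>
    rw [← setLIntegral_univ fun z => ENNReal.ofReal (Noise.gumbel.density (1 / ε) z) * F z]
    refine lintegral_quantile_image (G := fun z => Real.exp (-Real.exp (-(z * ε)))) .univ ?_ ?_ ?_ ?_
      ?_ F
    · intro z; rw [density_gumbel]; positivity
    · intro z _
      rw [density_gumbel]
      have h1 : HasDerivAt (fun z : ℝ => -(z * ε)) (-ε) z := (hasDerivAt_mul_const ε).fun_neg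
      refine (h1.exp.fun_neg.exp.congr_deriv ?_).hasDerivWithinAt
      rw [neg_add, Real.exp_add]
      ring
    · intro z _
      exact ⟨Real.exp_pos _, Real.exp_lt_one_iff.2 (neg_neg_of_pos (Real.exp_pos _))⟩
    · intro z _
      simp only [Noise.quantile, Real.log_exp, neg_neg]
      field_simp
    · intro x hx
      refine ⟨trivial, ?_⟩
      have h1 : 0 < -Real.log x := neg_pos.2 (Real.log_neg hx.1 hx.2)
      simp only [Noise.quantile]
      rw [div_mul_cancel₀ _ hε', neg_neg, Real.exp_log h1, neg_neg, Real.exp_log hx.1]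
  | laplace =>
    have hd : ∀ z, 0 ≤ Noise.laplace.density (1 / ε) z := fun z => by
      rw [density_laplace hε]; positivity
    -- The distribution function and the quantile of the Laplace law have different formulas on the
    -- two sides of 0 and of 1 / 2.
    rw [setLIntegral_congr Ioo_ae_eq_Ico, lintegral_Ico_add (b := 1 / 2) (by norm_num) (by norm_num),
      setLIntegral_congr Ioo_ae_eq_Ico.symm, setLIntegral_congr (Ioo_ae_eq_Ico (a := (1 / 2 : ℝ))).symm,
      ← lintegral_add_compl (fun z => ENNReal.ofReal (Noise.laplace.density (1 / ε) z) * F z)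
        (measurableSet_Iio (a := (0 : ℝ))), Set.compl_Iio, setLIntegral_congr Ioi_ae_eq_Ici.symm]
    congr 1
    · refine lintegral_quantile_image (G := fun z => 1 / 2 * Real.exp (z * ε)) measurableSet_Iio hd
        ?_ ?_ ?_ ?_ F
      · intro z hz
        rw [density_laplace hε, abs_of_neg hz]
        have h1 : HasDerivAt (fun z : ℝ => z * ε) ε z := hasDerivAt_mul_const ε
        refine ((h1.exp.const_mul (1 / 2)).congr_deriv ?_).hasDerivWithinAt
        rw [neg_mul, neg_neg]
        ring
      · intro z hz
        have : Real.exp (z * ε) < 1 := Real.exp_lt_one_iff.2 (mul_neg_of_neg_of_pos hz hε)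
        exact ⟨by positivity, by linarith⟩
      · intro z hz
        have : Real.exp (z * ε) < 1 := Real.exp_lt_one_iff.2 (mul_neg_of_neg_of_pos hz hε)
        simp only [Noise.quantile]
        rw [if_pos (by linarith), ← mul_assoc, mul_one_div_cancel two_ne_zero, one_mul, Real.log_exp,
          mul_div_cancel_right₀ _ hε']
      · intro x hx
        simp only [Noise.quantile]
        rw [if_pos hx.2, div_mul_cancel₀ _ hε', Real.exp_log (by linarith [hx.1])]
        exact ⟨div_neg_of_neg_of_pos (Real.log_neg (by linarith [hx.1]) (by linarith [hx.2])) hε,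
          by ring⟩
    · refine lintegral_quantile_image (G := fun z => 1 - 1 / 2 * Real.exp (-(z * ε))) measurableSet_Ioi
        hd ?_ ?_ ?_ ?_ F
      · intro z hz
        rw [density_laplace hε, abs_of_pos hz]
        have h1 : HasDerivAt (fun z : ℝ => -(z * ε)) (-ε) z := (hasDerivAt_mul_const ε).fun_neg
        refine (((h1.exp.const_mul (1 / 2)).const_sub 1).congr_deriv ?_).hasDerivWithinAt
        ring
      · intro z hz
        have h1 : Real.exp (-(z * ε)) < 1 := Real.exp_lt_one_iff.2 (neg_neg_of_pos (mul_pos hz hε))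
        have h2 := Real.exp_pos (-(z * ε))
        exact ⟨by linarith, by linarith⟩
      · intro z hz
        have h1 : Real.exp (-(z * ε)) < 1 := Real.exp_lt_one_iff.2 (neg_neg_of_pos (mul_pos hz hε))
        simp only [Noise.quantile]
        rw [if_neg (by linarith), sub_sub_cancel, ← mul_assoc, mul_one_div_cancel two_ne_zero, one_mul,
          Real.log_exp, neg_neg, mul_div_cancel_right₀ _ hε']
      · intro x hx
        have hx1 := hx.1
        have hx2 := hx.2
        simp only [Noise.quantile]
        rw [if_neg (by linarith), div_mul_cancel₀ _ hε', neg_neg, Real.exp_log (by linarith)]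
        exact ⟨div_pos (neg_pos.2 (Real.log_neg (by linarith) (by linarith))) hε, by ring⟩

theorem Noise.law_eq_map (hε : 0 < ε) (N : Noise) :
    N.law (1 / ε) = (volume : Measure unitInterval).map fun x : unitInterval => N.quantile (x : ℝ) / ε := by
  have hm : Measurable fun x : unitInterval => N.quantile x / ε :=
    (N.measurable_quantile.comp measurable_subtype_coe).div_const _
  ext A hA
  rw [Noise.law, withDensity_apply _ hA, Measure.map_apply hm hA, ← lintegral_indicator_one (hm hA)]
  have h := lintegral_quantile hε N (A.indicator 1)
  have h1 : ∀ x : unitInterval, A.indicator (1 : ℝ → ℝ≥0∞) (N.quantile x / ε) =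
      ((fun x : unitInterval => N.quantile x / ε) ⁻¹' A).indicator 1 x := fun x => rfl
  simp only [h1] at h
  rw [h, ← lintegral_indicator hA]
  refine lintegral_congr fun z => ?_
  by_cases hz : z ∈ A <;> simp [hz]

/-- The noise values that belong to the keys `y`. -/
def noiseOf (N : Noise) (m : ℕ) (ε : ℝ) (y : Fin m → ℝ) (i : Fin m) : ℝ :=
  N.quantile (y i / buckets m) / ε

theorem measurable_noiseOf (N : Noise) (m : ℕ) (ε : ℝ) : Measurable (noiseOf N m ε) :=
  measurable_pi_iff.2 fun i => (N.measurable_quantile.comp (by fun_prop)).div_const _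

theorem noiseLaw_eq_map {m : ℕ} (hm : 1 ≤ m) (hε : 0 < ε) (N : Noise) :
    noiseLaw N m ε = (volume : Measure (Fin m → unitInterval)).map
      fun x => noiseOf N m ε fun i => buckets m * x i := by
  have hB : (buckets m : ℝ) ≠ 0 := by exact_mod_cast (buckets_pos hm).ne'
  have hq : Measurable fun x : unitInterval => N.quantile x / ε :=
    (N.measurable_quantile.comp measurable_subtype_coe).div_const _
  have : ∀ x : Fin m → unitInterval, noiseOf N m ε (fun i => buckets m * x i) =
      fun i => N.quantile (x i) / ε := fun x => by
    funext i
    rw [noiseOf, mul_div_cancel_left₀ _ hB]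
  simp only [this]
  rw [noiseLaw, N.law_eq_map hε, volume_pi]
  have := Measure.isProbabilityMeasure_map (μ := (volume : Measure unitInterval)) hq.aemeasurable
  rw [Measure.pi_map_pi fun _ => hq.aemeasurable]

theorem noiseOf_lt_iff {m : ℕ} (hε : 0 < ε) {y : Fin m → ℝ}
    (hy : ∀ i, y i / buckets m ∈ Set.Ioo (0 : ℝ) 1) (i j : Fin m) :
    noiseOf N m ε y i < noiseOf N m ε y j ↔ y i < y j := by
  have hB : (0 : ℝ) < buckets m := by
    rcases (Nat.cast_nonneg (α := ℝ) (buckets m)).eq_or_lt with h | h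
    · have := (hy i).1
      rw [← h, div_zero] at this
      exact absurd this (lt_irrefl _)
    · exact h
  rw [noiseOf, noiseOf, div_lt_div_iff_of_pos_right hε,
    N.strictMonoOn_quantile.lt_iff_lt (hy i) (hy j), div_lt_div_iff_of_pos_right hB]

end Quantile

/-! ## The sorted array -/

section Table

variable {m : ℕ}

/-- With distinct values the sorted sequence is strictly decreasing, so the items with larger values
are those at earlier positions. -/
theorem card_lt_sortPerm {z : Fin m → ℝ} (hz : Function.Injective z) (j : Fin m) :
    (Finset.univ.filter fun k => z (sortPerm z j) < z k).card = j := by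
  have hmono : StrictMono fun l => -z (sortPerm z l) := by
    refine Monotone.strictMono_of_injective (Tuple.monotone_sort fun i => -z i) ?_
    intro a b h
    exact (sortPerm z).injective (hz (neg_injective h))
  have : (Finset.univ.filter fun k => z (sortPerm z j) < z k) =
      (Finset.Iio j).map (sortPerm z).toEmbedding := by
    ext k
    rw [Finset.mem_filter, Finset.mem_map_equiv, Finset.mem_Iio, ← hmono.lt_iff_lt]
    simp
  rw [this, Finset.card_map, Fin.card_Iio]

theorem tableAnswer_sorted {z : Fin m → ℝ} (hz : Function.Injective z) {n : ℕ} {i : Fin m}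
    (hn : (Finset.univ.filter fun k => z i < z k).card = n) :
    tableAnswer z n .sorted = ((i : ℕ), z i) := by
  obtain ⟨j, rfl⟩ := (sortPerm z).surjective i
  rw [card_lt_sortPerm hz] at hn
  subst hn
  rw [tableAnswer, dif_pos j.2]
  rfl

theorem tableAnswer_random (z : Fin m → ℝ) (n : ℕ) (i : Fin m) :
    tableAnswer z n (.random i) = ((i : ℕ), z i) := by
  simp [tableAnswer, sortedArray, invertedIndex]

/-- A permutation is the result of sorting if and only if it is monotone and breaks ties by index,
which is a finite set of measurable conditions. -/
theorem measurableSet_sortPerm (π : Equiv.Perm (Fin m)) :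
    MeasurableSet {z : Fin m → ℝ | sortPerm z = π} := by
  have : {z : Fin m → ℝ | sortPerm z = π} = (⋂ i, ⋂ j, {z | i ≤ j → -z (π i) ≤ -z (π j)}) ∩
      ⋂ i, ⋂ j, {z | i < j → -z (π i) = -z (π j) → π i < π j} := by
    ext z
    simp only [Set.mem_ofPred_eq, Set.mem_inter_iff, Set.mem_iInter]
    rw [sortPerm, eq_comm, Tuple.eq_sort_iff]
    exact Iff.rfl
  rw [this]
  refine (MeasurableSet.iInter fun i => MeasurableSet.iInter fun j => ?_).inter
    (MeasurableSet.iInter fun i => MeasurableSet.iInter fun j => ?_)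
  · exact (MeasurableSet.const _).imp (measurableSet_le (by fun_prop) (by fun_prop))
  · exact (MeasurableSet.const _).imp ((measurableSet_eq_fun (by fun_prop) (by fun_prop)).imp
      (MeasurableSet.const _))

theorem measurable_tableAnswer (n : ℕ) (q : Query m) :
    Measurable fun z : Fin m → ℝ => tableAnswer z n q := by
  cases q with
  | random i =>
    simp only [tableAnswer_random]
    exact measurable_const.prodMk (measurable_pi_apply i)
  | sorted =>
    by_cases hn : n < m
    · simp only [tableAnswer, dif_pos hn, sortedArray]
      have h1 : Measurable fun z : Fin m → ℝ => sortPerm z ⟨n, hn⟩ := by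
        refine measurable_to_countable' fun i => ?_
        have : (fun z : Fin m → ℝ => sortPerm z ⟨n, hn⟩) ⁻¹' {i} =
            ⋃ π ∈ {π : Equiv.Perm (Fin m) | π ⟨n, hn⟩ = i}, {z | sortPerm z = π} := by
          ext z; simp
        rw [this]
        exact MeasurableSet.biUnion (Set.to_countable _) fun π _ => measurableSet_sortPerm π
      refine Measurable.prodMk ((measurable_of_countable fun i : Fin m => (i : ℕ)).comp h1) ?_
      have h2 : Measurable fun p : (Fin m → ℝ) × Fin m => p.1 p.2 :=
        measurable_from_prod_countable_left fun i => measurable_pi_apply i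
      exact h2.comp (measurable_id.prodMk h1)
    · simp only [tableAnswer, dif_neg hn]
      exact measurable_const

theorem measurable_sortedCount (σ : Strategy m) (t : ℕ) : Measurable (sortedCount σ.next t) := by
  have : sortedCount σ.next t = fun h => ∑ s : Fin t,
      if σ.next s (fun i => h (Fin.castLE s.isLt.le i)) = Query.sorted then 1 else 0 := by
    funext h
    rw [sortedCount, Finset.card_filter]
  rw [this]
  refine Finset.measurable_sum _ fun s _ => Measurable.ite ?_ measurable_const measurable_const
  have : Measurable fun (h : Fin t → Answer) (i : Fin s) => h (Fin.castLE s.isLt.le i) :=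
    measurable_pi_iff.2 fun i => measurable_pi_apply _
  exact this (σ.measurable_next s .sorted)

/-- The next answer from the sorted array, appended to the answers `p.1`. -/
def tableSnoc (σ : Strategy m) (t : ℕ) (p : (Fin t → Answer) × (Fin m → ℝ)) : Fin (t + 1) → Answer :=
  Fin.snoc (α := fun _ => Answer) p.1 (tableAnswer p.2 (sortedCount σ.next t p.1) (σ.next t p.1))

theorem measurable_tableSnoc (σ : Strategy m) (t : ℕ) : Measurable (tableSnoc σ t) := by
  refine measurable_snoc measurable_fst ?_
  refine measurable_of_query (f := fun q (p : (Fin t → Answer) × (Fin m → ℝ)) =>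
    tableAnswer p.2 (sortedCount σ.next t p.1) q) (fun q => ?_) ((σ.measurable t).comp measurable_fst)
  have h : Measurable fun p : (Fin m → ℝ) × ℕ => tableAnswer p.1 p.2 q :=
    measurable_from_prod_countable_left fun n => measurable_tableAnswer n q
  exact h.comp (measurable_snd.prodMk ((measurable_sortedCount σ t).comp measurable_fst))

theorem measurable_tableTranscript (σ : Strategy m) (t : ℕ) :
    Measurable fun z => tableTranscript σ z t := by
  induction t with
  | zero => exact measurable_const
  | succ t ih => exact (measurable_tableSnoc σ t).comp (ih.prodMk measurable_id)

theorem sortedCount_snoc (σ : Strategy m) (t : ℕ) (h : Fin t → Answer) (x : Answer) :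
    sortedCount σ.next (t + 1) (Fin.snoc (α := fun _ => Answer) h x) =
      sortedCount σ.next t h + if σ.next t h = Query.sorted then 1 else 0 := by
  rw [sortedCount, sortedCount, Finset.card_filter, Finset.card_filter, Fin.sum_univ_castSucc]
  have key : ∀ (s : ℕ) (hs : s ≤ t), (fun i : Fin s => (Fin.snoc (α := fun _ => Answer) h x :
      Fin (t + 1) → Answer) (Fin.castLE (hs.trans t.le_succ) i)) = fun i => h (Fin.castLE hs i) := by
    intro s hs
    funext i
    rw [show Fin.castLE (hs.trans t.le_succ) i = (Fin.castLE hs i).castSucc from rfl, Fin.snoc_castSucc]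
  congr 1
  · refine Finset.sum_congr rfl fun s _ => ?_
    have := key s s.isLt.le
    exact if_congr (by rw [← this]; rfl) rfl rfl
  · exact if_congr (Eq.congr_left (congrArg (σ.next t) (key t le_rfl))) rfl rfl

end Table

/-! ## The law of the transcript -/

/-- The keys are distinct and lie strictly inside their range. -/
def Nice (m : ℕ) (y : Fin m → ℝ) : Prop :=
  Function.Injective y ∧ ∀ i, y i / buckets m ∈ Set.Ioo (0 : ℝ) 1

section Step

variable {m W : ℕ} {ε : ℝ} {s : Store} {ret : Finset ℕ} {bk : ℕ → ℕ} {lf : ℕ → ℕ → ℕ}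

theorem compl_of_known {j : Fin m} (hj : Known m s j) (x : Fin m → unitInterval) :
    compl m s x j = s.realMem (j + 1) := by
  rw [compl, complWith, if_pos hj]

/-- Known keys are compared through `ret_key`, unknown ones through the threshold. So returned items
stay on top in every completion. -/
theorem Inv.compl_le (hm : 1 ≤ m) (h : Inv m ε s ret bk lf) {i : ℕ} (hi : i ∈ ret) {k : Fin m}
    (hk : (k : ℕ) ∉ ret) (x : Fin m → unitInterval) : compl m s x k ≤ s.realMem (i + 1) := by
  rw [compl, complWith]
  split_ifs with hkn
  · exact h.ret_key i hi k k.2 hkn hk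
  · rw [h.tau_eq hm]
    have h0 : 0 ≤ s.realReg 2 := (Nat.cast_nonneg _).trans h.beta_le
    exact (mul_le_of_le_one_right h0 (x k).2.2).trans (h.ret_tau i hi)

theorem noiseOf_injective {N : Noise} (hε : 0 < ε) {y : Fin m → ℝ} (hy : Nice m y) :
    Function.Injective (noiseOf N m ε y) := by
  intro i j hij
  refine hy.1 (le_antisymm ?_ ?_)
  · exact not_lt.1 fun h => hij.not_gt ((noiseOf_lt_iff hε hy.2 _ _).2 h)
  · exact not_lt.1 fun h => hij.not_lt ((noiseOf_lt_iff hε hy.2 _ _).2 h)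

theorem RandomPost.answer_eq {N : Noise} {i : Fin m} {t : ℕ} {a b c : unitInterval} {s' : Store}
    (h : RandomPost m N ε s ret i t a b c s') (n : ℕ) (x : Fin m → unitInterval) :
    s'.answer = tableAnswer (noiseOf N m ε (compl m s' x)) n (.random i) := by
  rw [tableAnswer_random, Store.answer, h.item, h.value, noiseOf, compl_of_known h.known]

/-- The items with a larger completed key than the answer are exactly those returned before, so
their number is its position in the sorted array; `Nice` excludes ties. -/
theorem SortedPost.answer_eq {N : Noise} (hm : 1 ≤ m) (hε : 0 < ε) {v₀ : ℝ} {t i : ℕ}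
    {a d : unitInterval} {s' : Store} (h : SortedPost m N ε s ret v₀ t a d s' i)
    {x : Fin m → unitInterval} (hx : Nice m (compl m s' x)) :
    s'.answer = tableAnswer (noiseOf N m ε (compl m s' x)) ret.card .sorted := by
  obtain ⟨bk, lf, hI⟩ := h.inv
  have hyi : compl m s' x ⟨i, h.lt⟩ = s'.realMem (i + 1) :=
    compl_of_known (j := ⟨i, h.lt⟩) h.known x
  rw [tableAnswer_sorted (noiseOf_injective hε hx) (i := ⟨i, h.lt⟩), Store.answer, h.item, h.value,
    noiseOf, hyi]
  rw [← Finset.card_map Fin.valEmbedding]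
  congr 1
  ext k
  simp only [noiseOf_lt_iff hε hx.2, Finset.mem_map, Finset.mem_filter, Finset.mem_univ, true_and,
    hyi]
  constructor
  · rintro ⟨k, hk, rfl⟩
    by_contra hkr
    by_cases hki : k = ⟨i, h.lt⟩
    · rw [hki, hyi] at hk
      exact lt_irrefl _ hk
    · refine absurd hk (not_lt.2 (hI.compl_le hm (Finset.mem_insert_self i ret) ?_ x))
      rw [Finset.mem_insert]
      rintro (h' | h')
      · exact hki (Fin.ext h')
      · exact hkr h'
  · intro hk
    obtain ⟨hkm, hkk⟩ := hI.ret_known k (Finset.mem_insert_of_mem hk)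
    refine ⟨⟨k, hkm⟩, lt_of_le_of_ne ?_ fun heq => ?_, rfl⟩
    · rw [compl_of_known (j := ⟨k, hkm⟩) hkk]
      exact h.le k hk
    · rw [← hyi] at heq
      have := congrArg Fin.val (hx.1 heq)
      simp only at this
      exact h.not_mem (this ▸ hk)

/-- A bound for the time of an access in terms of the keys. -/
def timeBound (m : ℕ) (y : Fin m → ℝ) : ℕ :=
  -- The bucket touched depends on the adaptive history, hence the supremum. The factor 402 pays for
  -- an insertion and a pop, 40 for the initialization, 60 for a step of the scan.
  2000 + 40 * logExp m + 402 * (Finset.range (buckets m)).sup (fun b => Nat.size (load m b y)) +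
    60 * emptyCount m y

theorem le_timeBound {t : ℕ} {y : Fin m → ℝ} {b : ℕ} (hb : b < buckets m)
    (h : t ≤ 2000 + 40 * logExp m + 402 * Nat.size (load m b y) + 60 * emptyCount m y) :
    t ≤ timeBound m y := by
  have := Finset.le_sup (f := fun b => Nat.size (load m b y)) (Finset.mem_range.2 hb)
  rw [timeBound]
  omega

theorem Ready.step (hB : Big m (m + 2) W) (hε : 0 < ε) (h : Ready m ε s ret) (N : Noise)
    (q : Query m) (hr : q = .sorted → ret.card < m) (u : ℕ → unitInterval) :
    let s' := (oracle N).result W u s q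
    (∃ ret', Ready m ε s' ret' ∧ ret'.card = ret.card + if q = .sorted then 1 else 0) ∧
      (∀ x, Nice m (compl m s' x) →
        s'.answer = tableAnswer (noiseOf N m ε (compl m s' x)) ret.card q) ∧
      ∀ x, haltTime W u ((oracle N).start s q) ≤ timeBound m (compl m s' x) := by
  intro s'
  cases q with
  | sorted =>
    obtain ⟨t₀, v₀, -, -, ht₀⟩ := h.result_sorted hB (hr rfl) N
    obtain ⟨t, i, ht, hp⟩ := ht₀ u
    refine ⟨⟨insert i ret, Or.inr hp.inv, ?_⟩, fun x hx => hp.answer_eq hB.hm hε hx, fun x => ?_⟩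
    · rw [Finset.card_insert_of_notMem hp.not_mem, if_pos rfl]
    · obtain ⟨b, hb, hT⟩ := hp.time
      exact ht.trans (by exact_mod_cast le_timeBound hb (hT x))
  | random i =>
    obtain ⟨t₀, ht₀⟩ := h.result_random hB N i
    obtain ⟨t, ht, hp⟩ := ht₀ u
    refine ⟨⟨ret, Or.inr hp.inv, ?_⟩, fun x _ => hp.answer_eq _ x, fun x => ?_⟩
    · simp
    · obtain ⟨b, hb, hT⟩ := hp.time
      exact ht.trans (by exact_mod_cast le_timeBound hb (hT x))

end Step

/-! ### Measurability of completions, and general position -/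

section Measurability

variable (m : ℕ)

theorem measurable_compl_uncurry :
    Measurable fun p : Store × (Fin m → unitInterval) => compl m p.1 p.2 := by
  have hw : ∀ r, Measurable fun p : Store × (Fin m → unitInterval) => p.1.wordReg r := fun r => by
    fun_prop
  have hr : ∀ r, Measurable fun p : Store × (Fin m → unitInterval) => p.1.realReg r := fun r => by
    fun_prop
  refine measurable_pi_iff.2 fun i => ?_
  refine Measurable.ite (measurableSet_lt ?_ (hw 4)) (by fun_prop) (Measurable.mul ?_ (by fun_prop))
  · exact (measurable_of_countable fun n : ℕ => (n + (i : ℕ)) % m).comp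
      (show Measurable fun p : Store × (Fin m → unitInterval) => p.1.wordMem (8 * i + 2) by fun_prop)
  · exact Measurable.ite (measurableSet_eq_fun (hw 2) measurable_const) measurable_const (hr 2)

theorem measurableSet_nice : MeasurableSet {y | Nice m y} := by
  have : {y | Nice m y} = (⋂ i, ⋂ j, {y : Fin m → ℝ | y i = y j → i = j}) ∩
      ⋂ i, {y | y i / buckets m ∈ Set.Ioo (0 : ℝ) 1} := by
    ext y
    simp only [Set.mem_ofPred_eq, Set.mem_inter_iff, Set.mem_iInter, Nice]
    exact Iff.rfl
  rw [this]
  refine (MeasurableSet.iInter fun i => MeasurableSet.iInter fun j => ?_).inter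
    (MeasurableSet.iInter fun i => ?_)
  · exact (measurableSet_eq_fun (by fun_prop) (by fun_prop)).imp (MeasurableSet.const _)
  · exact measurableSet_Ioo.preimage (f := fun y : Fin m → ℝ => y i / buckets m) (by fun_prop)

variable {m}

theorem ae_nice (hm : 1 ≤ m) :
    ∀ᵐ x : Fin m → unitInterval, Nice m fun i => buckets m * (x i : ℝ) := by
  have hB : (buckets m : ℝ) ≠ 0 := by exact_mod_cast (buckets_pos hm).ne'
  have h1 : ∀ i : Fin m, ∀ᵐ x : Fin m → unitInterval, x i ≠ 0 ∧ x i ≠ 1 := by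
    intro i
    have : ∀ᵐ a : unitInterval, a ≠ 0 ∧ a ≠ 1 := by
      filter_upwards [Measure.ae_ne volume (0 : unitInterval), Measure.ae_ne volume (1 : unitInterval)]
        with a h0 h1 using ⟨h0, h1⟩
    exact (Measure.quasiMeasurePreserving_eval (fun _ : Fin m => (volume : Measure unitInterval)) i).ae
      this
  filter_upwards [ae_injective (ι := Fin m), ae_all_iff.2 h1] with x hx h
  refine ⟨fun i j hij => hx (Subtype.ext (mul_left_cancel₀ hB hij)), fun i => ?_⟩
  rw [mul_div_cancel_left₀ _ hB]
  exact ⟨lt_of_le_of_ne (x i).2.1 fun hh => (h i).1 (Subtype.ext hh.symm),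
    lt_of_le_of_ne (x i).2.2 fun hh => (h i).2 (Subtype.ext hh)⟩

end Measurability

/-! ### Induction over the accesses -/

section Session

variable {m W : ℕ} {ε : ℝ} {N : Noise} (σ : Strategy m)

theorem session_ready (hB : Big m (m + 2) W) (hε : 0 < ε) (ω : Randomness) (t : ℕ) :
    ∃ ret, Ready m ε ((oracle N).session W ε σ ω t).1 ret ∧
      ret.card = sortedCount σ.next t ((oracle N).session W ε σ ω t).2 := by
  induction t with
  | zero =>
    refine ⟨∅, Or.inl ⟨⟨by simp [Oracle.session, initStore], by simp [Oracle.session, initStore],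
      by simp [Oracle.session, initStore], by simp [Oracle.session, initStore],
      by simp [Oracle.session, initStore], rfl, rfl⟩, rfl⟩, ?_⟩
    simp [sortedCount]
  | succ t ih =>
    obtain ⟨ret, hR, hc⟩ := ih
    obtain ⟨⟨ret', hR', hc'⟩, -⟩ := hR.step hB hε N (σ.next t ((oracle N).session W ε σ ω t).2)
      (fun hq => hc ▸ σ.sorted_lt t _ hq) (ω t)
    exact ⟨ret', hR', by rw [hc', hc]; exact (sortedCount_snoc σ t _ _).symm⟩

theorem session_update (ω : Randomness) (t : ℕ) (u : ℕ → unitInterval) :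
    (oracle N).session W ε σ (Function.update ω t u) t = (oracle N).session W ε σ ω t :=
  (oracle N).session_congr W ε σ fun k hk => by rw [Function.update_of_ne hk.ne]

theorem session_update_succ (ω : Randomness) (t : ℕ) (u : ℕ → unitInterval) :
    ((oracle N).session W ε σ (Function.update ω t u) (t + 1)).1 =
      (oracle N).result W u ((oracle N).session W ε σ ω t).1
        (σ.next t ((oracle N).session W ε σ ω t).2) := by
  rw [Oracle.session, session_update, Function.update_self]

/-- One access does not change the joint law of the earlier answers and the completed keys. -/
theorem lintegral_session_succ (hB : Big m (m + 2) W) (hε : 0 < ε) (t : ℕ)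
    {f : (Fin t → Answer) × (Fin m → ℝ) → ℝ≥0∞} (hf : Measurable f) :
    ∫⁻ ω, (∫⁻ x, f (((oracle N).session W ε σ ω t).2,
      compl m ((oracle N).session W ε σ ω (t + 1)).1 x)) ∂randomnessLaw =
    ∫⁻ ω, (∫⁻ x, f (((oracle N).session W ε σ ω t).2,
      compl m ((oracle N).session W ε σ ω t).1 x)) ∂randomnessLaw := by
  have hs := fun t => (oracle N).measurable_session W ε σ t
  have hm : Measurable fun p : Randomness × (Fin m → unitInterval) =>
      f (((oracle N).session W ε σ p.1 t).2, compl m ((oracle N).session W ε σ p.1 (t + 1)).1 p.2) :=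
    hf.comp (((hs t).snd.comp measurable_fst).prodMk ((measurable_compl_uncurry m).comp
      (((hs (t + 1)).fst.comp measurable_fst).prodMk measurable_snd)))
  -- The session before access `t` does not see `ω t`, so resampling it isolates the randomness of
  -- this one access.
  rw [randomnessLaw, ← lintegral_infinitePi_update _ t hm.lintegral_prod_right']
  refine lintegral_congr fun ω => ?_
  simp only [session_update, session_update_succ]
  obtain ⟨ret, hR, hc⟩ := session_ready (N := N) σ hB hε ω t
  exact hR.lintegral_result hB N _ (fun hq => hc ▸ σ.sorted_lt t _ hq)
    (f := fun y => f (((oracle N).session W ε σ ω t).2, y))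
    (hf.comp (measurable_const.prodMk measurable_id))

theorem compl_initStore (m : ℕ) (ε : ℝ) (x : Fin m → unitInterval) :
    compl m (initStore m ε) x = fun i => buckets m * (x i : ℝ) := by
  funext i
  rw [compl, complWith, if_neg, tau, if_pos]
  · simp [initStore]
  · simp [Known, initStore]

theorem lintegral_session_compl (hB : Big m (m + 2) W) (hε : 0 < ε) (t : ℕ)
    {f : (Fin m → ℝ) → ℝ≥0∞} (hf : Measurable f) :
    ∫⁻ ω, (∫⁻ x, f (compl m ((oracle N).session W ε σ ω t).1 x)) ∂randomnessLaw =
      ∫⁻ x : Fin m → unitInterval, f fun i => buckets m * (x i : ℝ) := by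
  induction t with
  | zero =>
    have : IsProbabilityMeasure randomnessLaw := by unfold randomnessLaw; infer_instance
    simp [Oracle.session, compl_initStore]
  | succ t ih =>
    rw [← ih]
    exact lintegral_session_succ σ hB hε t (f := fun p => f p.2) (hf.comp measurable_snd)

/-- The keys, completed after an access, are almost surely in general position. -/
theorem ae_nice_session (hB : Big m (m + 2) W) (hε : 0 < ε) (t : ℕ) :
    ∀ᵐ ω ∂randomnessLaw, ∀ᵐ x : Fin m → unitInterval,
      Nice m (compl m ((oracle N).session W ε σ ω t).1 x) := by
  set S : Randomness → Store := fun ω => ((oracle N).session W ε σ ω t).1 with hS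
  have hSm : Measurable S := ((oracle N).measurable_session W ε σ t).fst
  set g : (Fin m → ℝ) → ℝ≥0∞ := {y | Nice m y}ᶜ.indicator 1 with hg
  have hgm : Measurable g := measurable_one.indicator (measurableSet_nice m).compl
  have hg0 : ∀ y, g y = 0 ↔ Nice m y := fun y => by
    rw [hg, Set.indicator_apply_eq_zero]
    simp
  have hcm : Measurable fun p : Randomness × (Fin m → unitInterval) => g (compl m (S p.1) p.2) :=
    hgm.comp ((measurable_compl_uncurry m).comp ((hSm.comp measurable_fst).prodMk measurable_snd))
  have hmm : Measurable fun ω => ∫⁻ x : Fin m → unitInterval, g (compl m (S ω) x) :=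
    hcm.lintegral_prod_right'
  have h0 : ∫⁻ ω, (∫⁻ x, g (compl m (S ω) x)) ∂randomnessLaw = 0 := by
    refine (lintegral_session_compl σ hB hε t hgm).trans ((lintegral_congr_ae ?_).trans lintegral_zero)
    filter_upwards [ae_nice hB.hm] with x hx using (hg0 _).2 hx
  have h1 := (lintegral_eq_zero_iff hmm).1 h0
  filter_upwards [h1] with ω hω
  have h2 := (lintegral_eq_zero_iff (hgm.comp (measurable_compl m (S ω)))).1 hω
  filter_upwards [h2] with x hx using (hg0 _).1 hx

/-- The new answer is almost surely a function of the earlier answers and of the keys completed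
after the access. It is absorbed into the test function, after which the access can be undone by
`lintegral_session_succ`. -/
theorem lintegral_session (hB : Big m (m + 2) W) (hε : 0 < ε) (t : ℕ)
    {f : (Fin t → Answer) × (Fin m → ℝ) → ℝ≥0∞} (hf : Measurable f) :
    ∫⁻ ω, (∫⁻ x, f (((oracle N).session W ε σ ω t).2,
      compl m ((oracle N).session W ε σ ω t).1 x)) ∂randomnessLaw =
      ∫⁻ x : Fin m → unitInterval, f (tableTranscript σ (noiseOf N m ε fun i => buckets m * x i) t,
        fun i => buckets m * (x i : ℝ)) := by
  induction t with
  | zero =>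
    have : IsProbabilityMeasure randomnessLaw := by unfold randomnessLaw; infer_instance
    simp [Oracle.session, compl_initStore, tableTranscript]
  | succ t ih =>
    set g : (Fin t → Answer) × (Fin m → ℝ) → ℝ≥0∞ :=
      fun p => f (tableSnoc σ t (p.1, noiseOf N m ε p.2), p.2) with hg
    have hgm : Measurable g := hf.comp (((measurable_tableSnoc σ t).comp
      (measurable_fst.prodMk ((measurable_noiseOf N m ε).comp measurable_snd))).prodMk measurable_snd)
    refine Eq.trans ?_ ((lintegral_session_succ σ hB hε t hgm).trans (ih hgm))
    refine lintegral_congr_ae ?_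
    filter_upwards [ae_nice_session (N := N) σ hB hε (t + 1)] with ω hω
    refine lintegral_congr_ae ?_
    filter_upwards [hω] with x hx'
    obtain ⟨ret, hR, hc⟩ := session_ready (N := N) σ hB hε ω t
    have hans := (hR.step hB hε N (σ.next t ((oracle N).session W ε σ ω t).2)
      (fun hq => hc ▸ σ.sorted_lt t _ hq) (ω t)).2.1 x hx'
    rw [hc] at hans
    have htr : ((oracle N).session W ε σ ω (t + 1)).2 = tableSnoc σ t
        (((oracle N).session W ε σ ω t).2,
          noiseOf N m ε (compl m ((oracle N).session W ε σ ω (t + 1)).1 x)) := by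
      rw [tableSnoc]
      exact congrArg (Fin.snoc (α := fun _ => Answer) ((oracle N).session W ε σ ω t).2) hans
    rw [hg]
    simp only
    rw [htr]

theorem map_transcript (hB : Big m (m + 2) W) (hε : 0 < ε) (t : ℕ) :
    randomnessLaw.map ((oracle N).transcript W ε σ t) =
      (noiseLaw N m ε).map fun z => tableTranscript σ z t := by
  have h1 : Measurable ((oracle N).transcript W ε σ t) :=
    ((oracle N).measurable_session W ε σ t).snd
  have h2 := measurable_tableTranscript σ t
  have h3 : Measurable fun x : Fin m → unitInterval => noiseOf N m ε fun i => buckets m * x i :=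
    (measurable_noiseOf N m ε).comp (by fun_prop)
  ext A hA
  rw [noiseLaw_eq_map hB.hm hε, Measure.map_map h2 h3, Measure.map_apply h1 hA,
    Measure.map_apply (h2.comp h3) hA, ← lintegral_indicator_one (h1 hA),
    ← lintegral_indicator_one ((h2.comp h3) hA)]
  have := lintegral_session (N := N) σ hB hε t (f := fun p => A.indicator 1 p.1)
    ((measurable_one.indicator hA).comp measurable_fst)
  simp only [lintegral_const, measure_univ, mul_one] at this
  exact this

/-- The time is bounded through the store after the access, hence `t + 1`. The bound holds for every
completion, so it may be averaged over `x`, and the averaged law is that of uniform keys. -/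
theorem lintegral_accessTime_le (hB : Big m (m + 2) W) (hε : 0 < ε) (t : ℕ)
    (hm : Measurable (timeBound m)) :
    ∫⁻ ω, (((oracle N).accessTime W ε σ t ω : ℕ∞) : ℝ≥0∞) ∂randomnessLaw ≤
      ∫⁻ x : Fin m → unitInterval, (timeBound m (fun i => buckets m * (x i : ℝ)) : ℝ≥0∞) := by
  rw [← lintegral_session_compl (N := N) (W := W) (ε := ε) σ hB hε (t + 1)
    (f := fun y => (timeBound m y : ℝ≥0∞)) ((measurable_of_countable fun n : ℕ => (n : ℝ≥0∞)).comp hm)]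
  refine lintegral_mono fun ω => ?_
  obtain ⟨ret, hR, hc⟩ := session_ready (N := N) σ hB hε ω t
  have h := (hR.step hB hε N (σ.next t ((oracle N).session W ε σ ω t).2)
      (fun hq => hc ▸ σ.sorted_lt t _ hq) (ω t)).2.2
  have h2 : ∀ x : Fin m → unitInterval, (((oracle N).accessTime W ε σ t ω : ℕ∞) : ℝ≥0∞) ≤
      (timeBound m (compl m ((oracle N).session W ε σ ω (t + 1)).1 x) : ℝ≥0∞) := fun x => by
    have := ENat.toENNReal_le.2 (h x)
    rw [ENat.toENNReal_coe] at this
    exact this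
  calc (((oracle N).accessTime W ε σ t ω : ℕ∞) : ℝ≥0∞)
      = ∫⁻ _ : Fin m → unitInterval, (((oracle N).accessTime W ε σ t ω : ℕ∞) : ℝ≥0∞) := by simp
    _ ≤ _ := lintegral_mono h2

end Session

/-! ## The expected time -/

theorem lintegral_pi_prod (m : ℕ) {φ : unitInterval → ℝ≥0∞} (hφ : Measurable φ) :
    ∫⁻ x : Fin m → unitInterval, ∏ i, φ (x i) = (∫⁻ a, φ a) ^ m := by
  have h := ProbabilityTheory.lintegral_prod_eq_prod_lintegral_of_indepFun
    (μ := (volume : Measure (Fin m → unitInterval))) Finset.univ (fun i x => φ (x i))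
    (ProbabilityTheory.iIndepFun_pi (μ := fun _ : Fin m => (volume : Measure unitInterval))
      (X := fun _ => φ) fun _ => hφ.aemeasurable) (fun i => hφ.comp (measurable_pi_apply i))
  refine h.trans ?_
  rw [Finset.prod_congr rfl fun i _ => ?_, Finset.prod_const, Finset.card_univ, Fintype.card_fin]
  exact (measurePreserving_eval (fun _ : Fin m => (volume : Measure unitInterval)) i).lintegral_comp hφ

/-! ### Measurability of the time bound -/

section Measurability

variable (m b : ℕ)

theorem measurable_load : Measurable (load m b) := by
  classical
  have : load m b = fun y : Fin m → ℝ =>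
      ∑ j, if (b : ℝ) ≤ y j ∧ y j ≤ b + 1 then 1 else 0 := by
    funext y
    rw [load, Finset.card_filter]
  rw [this]
  refine Finset.measurable_sum _ fun j _ => Measurable.ite ?_ measurable_const measurable_const
  exact measurableSet_Icc.preimage (measurable_pi_apply j)

theorem measurable_emptyCount : Measurable (emptyCount m) := by
  classical
  have : emptyCount m = fun y : Fin m → ℝ => ∑ b ∈ Finset.range (buckets m),
      if ∀ j, ¬ ((b : ℝ) < y j ∧ y j < b + 1) then 1 else 0 := by
    funext y
    rw [emptyCount, Finset.card_filter]
  rw [this]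
  refine Finset.measurable_sum _ fun b _ => Measurable.ite ?_ measurable_const measurable_const
  rw [show {y : Fin m → ℝ | ∀ j, ¬ ((b : ℝ) < y j ∧ y j < b + 1)} =
    ⋂ j, {y | y j ∈ Set.Ioo (b : ℝ) (b + 1)}ᶜ by ext y; simp]
  exact MeasurableSet.iInter fun j => (measurableSet_Ioo.preimage (measurable_pi_apply j)).compl

theorem measurable_supSize : Measurable fun y : Fin m → ℝ =>
    (Finset.range (buckets m)).sup fun b => Nat.size (load m b y) := by
  induction Finset.range (buckets m) using Finset.induction_on with
  | empty => simp
  | insert b s _ ih =>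
    simp only [Finset.sup_insert]
    exact ((measurable_of_countable Nat.size).comp (measurable_load m b)).sup ih

theorem measurable_timeBound : Measurable (timeBound m) :=
  (((measurable_supSize m).const_mul 402).const_add _).add ((measurable_emptyCount m).const_mul 60)

end Measurability

/-! ### Balls into bins: empty buckets and the maximal load -/

section Bounds

variable {m : ℕ}

/-- Uses 1 + c / B ≤ exp (c / B); `c` may be negative. It bounds the contribution of a single item
in a product over the items. -/
theorem le_ofReal_exp {I : ℝ≥0∞} {B c : ℝ} (hB : 0 < B)
    (h : ENNReal.ofReal B * I ≤ ENNReal.ofReal (B + c)) : I ≤ ENNReal.ofReal (Real.exp (c / B)) := by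
  have h1 : I ≤ ENNReal.ofReal ((B + c) / B) := by
    rw [ENNReal.ofReal_div_of_pos hB]
    rw [ENNReal.le_div_iff_mul_le (Or.inl (by simpa using hB)) (Or.inl ENNReal.ofReal_ne_top), mul_comm]
    exact h
  refine h1.trans (ENNReal.ofReal_le_ofReal ?_)
  rw [add_div, div_self hB.ne', add_comm]
  exact Real.add_one_le_exp _

theorem ofReal_exp_pow (m : ℕ) (a : ℝ) :
    ENNReal.ofReal (Real.exp a) ^ m = ENNReal.ofReal (Real.exp (m * a)) := by
  rw [← ENNReal.ofReal_pow (Real.exp_pos _).le, ← Real.exp_nat_mul]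

/-- The exponential moment factorizes over the items, and an item falls into the bucket with
probability at most 1 / B, so each factor is at most 1 + 3 / B. -/
theorem lintegral_four_pow_load_le {B b : ℕ} (hB : 0 < B) :
    ∫⁻ x : Fin m → unitInterval, (4 : ℝ≥0∞) ^ load m b (fun i => B * (x i : ℝ)) ≤
      ENNReal.ofReal (Real.exp (m * (3 / B))) := by
  classical
  have hB' : (0 : ℝ) < B := by exact_mod_cast hB
  set φ : ℝ → ℝ≥0∞ := fun y => 1 + (Set.Icc (b : ℝ) (b + 1)).indicator (fun _ => 3) y with hφ
  have hm : Measurable φ :=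
    (measurable_const.indicator measurableSet_Icc).const_add 1
  have h1 : ∀ x : Fin m → unitInterval, (4 : ℝ≥0∞) ^ load m b (fun i => B * (x i : ℝ)) =
      ∏ i, φ (B * (x i : ℝ)) := fun x => by
    rw [load, ← Finset.prod_const, Finset.prod_filter]
    refine Finset.prod_congr rfl fun i _ => ?_
    rw [hφ]
    simp only [Set.indicator_apply, Set.mem_Icc]
    split_ifs <;> norm_num
  simp only [h1]
  rw [lintegral_pi_prod m (φ := fun a : unitInterval => φ (B * a)) (hm.comp (by fun_prop)),
    ← ofReal_exp_pow]
  gcongr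
  refine le_ofReal_exp hB' ?_
  rw [lintegral_unitInterval_mul hB'.le φ, hφ, lintegral_add_left measurable_const,
    ENNReal.ofReal_add hB'.le (by norm_num)]
  gcongr
  · simp
  · refine (setLIntegral_le_lintegral _ _).trans ?_
    rw [lintegral_indicator measurableSet_Icc]
    simp

/-- A bucket is missed by all items with probability (1 - 1 / B) ^ m ≤ exp (-m / B). -/
theorem lintegral_emptyCount_le :
    ∫⁻ x : Fin m → unitInterval, (emptyCount m (fun i => buckets m * (x i : ℝ)) : ℝ≥0∞) ≤
      buckets m * ENNReal.ofReal (Real.exp (m * (-1 / buckets m))) := by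
  classical
  set B := buckets m with hB
  set φ : ℕ → ℝ → ℝ≥0∞ := fun b => (Set.Ioo (b : ℝ) (b + 1))ᶜ.indicator 1 with hφ
  have hm : ∀ b, Measurable (φ b) := fun b => measurable_one.indicator measurableSet_Ioo.compl
  have h1 : ∀ x : Fin m → unitInterval, (emptyCount m (fun i => B * (x i : ℝ)) : ℝ≥0∞) =
      ∑ b ∈ Finset.range B, ∏ i, φ b (B * (x i : ℝ)) := fun x => by
    rw [emptyCount, Finset.card_filter, Nat.cast_sum]
    refine Finset.sum_congr rfl fun b _ => ?_
    simp only [hφ, Set.indicator_apply, Pi.one_apply, Set.mem_compl_iff, Set.mem_Ioo]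
    rw [Finset.prod_ite_zero]
    simp
  have hm' : ∀ b, Measurable fun a : unitInterval => φ b (B * a) := fun b => (hm b).comp (by fun_prop)
  simp only [h1]
  have hp : ∀ b, Measurable fun x : Fin m → unitInterval => ∏ i, φ b (B * (x i : ℝ)) := fun b =>
    Finset.measurable_prod _ fun i _ => (hm' b).comp (measurable_pi_apply i)
  rw [lintegral_finsetSum _ fun b _ => hp b]
  refine (Finset.sum_le_card_nsmul _ _ (ENNReal.ofReal (Real.exp (m * (-1 / B)))) fun b hb => ?_).trans
    (by rw [Finset.card_range, nsmul_eq_mul])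
  rw [Finset.mem_range] at hb
  have hB' : (0 : ℝ) < B := by exact_mod_cast (Nat.zero_le b).trans_lt hb
  rw [lintegral_pi_prod m (hm' b), ← ofReal_exp_pow]
  gcongr
  refine le_ofReal_exp hB' ?_
  rw [lintegral_unitInterval_mul hB'.le (φ b), hφ]
  simp only
  have hsub : Set.Ioo (b : ℝ) (b + 1) ⊆ Set.Ico 0 (B : ℝ) := fun y hy =>
    ⟨(Nat.cast_nonneg b).trans hy.1.le, hy.2.trans_le (by exact_mod_cast hb)⟩
  rw [lintegral_indicator_one measurableSet_Ioo.compl, Measure.restrict_apply measurableSet_Ioo.compl,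
    Set.inter_comm, ← Set.sdiff_eq, measure_sdiff hsub measurableSet_Ioo.nullMeasurableSet (by simp),
    Real.volume_Ico, Real.volume_Ioo, ← ENNReal.ofReal_sub _ (by simp)]
  exact (congrArg ENNReal.ofReal (by ring)).le

/-- If the largest load `n` exceeds `k`, then size n ≤ 2 ^ n and 2 ^ k ≤ 2 ^ n, so size n · 2 ^ k ≤
4 ^ n, one of the terms of the sum. This is the union bound without a tail integral. -/
theorem supSize_le (hm : 1 ≤ m) (y : Fin m → ℝ) (k : ℕ) :
    (((Finset.range (buckets m)).sup fun b => Nat.size (load m b y) : ℕ) : ℝ≥0∞) ≤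
      Nat.size k + (∑ b ∈ Finset.range (buckets m), 4 ^ load m b y) / 2 ^ k := by
  obtain ⟨b, hb, h⟩ := Finset.exists_mem_eq_sup (Finset.range (buckets m))
    ⟨0, Finset.mem_range.2 (buckets_pos hm)⟩ fun b => Nat.size (load m b y)
  rw [h]
  set n := load m b y with hn
  rcases le_or_gt n k with hnk | hnk
  · refine le_trans ?_ le_self_add
    exact_mod_cast Nat.size_le_size hnk
  · refine le_trans ?_ le_add_self
    rw [ENNReal.le_div_iff_mul_le (Or.inl (by positivity)) (Or.inl (by finiteness))]
    refine le_trans ?_ (Finset.single_le_sum (f := fun b => (4 : ℝ≥0∞) ^ load m b y)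
      (fun _ _ => zero_le) hb)
    have h1 : Nat.size n ≤ 2 ^ n := (Nat.size_le.2 Nat.lt_two_pow_self).trans Nat.lt_two_pow_self.le
    have h2 : 2 ^ k ≤ 2 ^ n := Nat.pow_le_pow_right (by norm_num) hnk.le
    have h3 : 2 ^ n * 2 ^ n = 4 ^ n := by rw [← mul_pow]; norm_num
    exact_mod_cast h3 ▸ Nat.mul_le_mul h1 h2

theorem le_exp_two_pow_logExp {m : ℕ} (hm : 1 ≤ m) :
    (buckets m : ℝ) ≤ Real.exp ((2 ^ logExp m : ℕ) : ℝ) := by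
  have h1 : (buckets m : ℝ) ≤ m := by exact_mod_cast Nat.div_le_self m _
  refine h1.trans ?_
  rw [← Real.log_le_iff_le_exp (by exact_mod_cast hm)]
  push_cast
  exact logExp_le_iff.1 le_rfl

theorem two_pow_logExp_le_div (hm : 1 ≤ m) : ((2 ^ logExp m : ℕ) : ℝ) ≤ m / buckets m := by
  rw [le_div_iff₀ (by exact_mod_cast buckets_pos hm), mul_comm]
  exact_mod_cast Nat.div_mul_le_self m (2 ^ logExp m)

theorem div_le_two_pow_logExp (hm : 1 ≤ m) : (m : ℝ) / buckets m ≤ 2 * (2 ^ logExp m : ℕ) := by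
  rw [div_le_iff₀ (by exact_mod_cast buckets_pos hm)]
  have h1 : m < (buckets m + 1) * 2 ^ logExp m := by
    rw [mul_comm, buckets]
    exact Nat.lt_mul_div_succ m (by positivity)
  have h2 := Nat.mul_le_mul_right (2 ^ logExp m) (buckets_pos hm)
  have h3 : m ≤ 2 * 2 ^ logExp m * buckets m := by nlinarith
  exact_mod_cast h3

/-- B ≤ m ≤ exp L and m / B ≥ L, so the two exponentials cancel; this is why the average load must
be at least log m. -/
theorem lintegral_emptyCount_le_one (hm : 1 ≤ m) :
    ∫⁻ x : Fin m → unitInterval, (emptyCount m (fun i => buckets m * (x i : ℝ)) : ℝ≥0∞) ≤ 1 := by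
  refine lintegral_emptyCount_le.trans ?_
  rw [← ENNReal.ofReal_natCast (buckets m), ← ENNReal.ofReal_mul (Nat.cast_nonneg _),
    ENNReal.ofReal_le_one]
  calc (buckets m : ℝ) * Real.exp (m * (-1 / buckets m))
      ≤ Real.exp ((2 ^ logExp m : ℕ) : ℝ) * Real.exp (-((2 ^ logExp m : ℕ) : ℝ)) := by
        gcongr
        · exact le_exp_two_pow_logExp hm
        · have := two_pow_logExp_le_div hm
          rw [mul_div_assoc', mul_neg_one, neg_div]
          exact neg_le_neg this
    _ = 1 := by rw [← Real.exp_add, add_neg_cancel, Real.exp_zero]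

/-- The cutoff is 12 L: the sum of the moments is at most exp L · exp (6 L) ≤ 3 ^ (7 L) ≤ 2 ^ (12
L), since 3 ^ 7 = 2187 ≤ 4096, so loads above the cutoff contribute at most 1. Loads below it
contribute at most `logExp m + 4`, since 12 < 2 ^ 4. -/
theorem lintegral_supSize_le (hm : 1 ≤ m) :
    ∫⁻ x : Fin m → unitInterval, (((Finset.range (buckets m)).sup fun b =>
      Nat.size (load m b fun i => buckets m * (x i : ℝ)) : ℕ) : ℝ≥0∞) ≤ (logExp m + 5 : ℕ) := by
  set L := 2 ^ logExp m with hL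
  have hsize : Nat.size (12 * L) ≤ logExp m + 4 := by
    rw [Nat.size_le, pow_add, ← hL]
    have : 0 < L := by positivity
    omega
  have hmeas : ∀ b, Measurable fun x : Fin m → unitInterval =>
      (4 : ℝ≥0∞) ^ load m b fun i => buckets m * (x i : ℝ) := fun b =>
    (measurable_of_countable fun n : ℕ => (4 : ℝ≥0∞) ^ n).comp
      ((measurable_load m b).comp (by fun_prop))
  have hsum : ∑ b ∈ Finset.range (buckets m), ∫⁻ x : Fin m → unitInterval,
      (4 : ℝ≥0∞) ^ load m b (fun i => buckets m * (x i : ℝ)) ≤ 2 ^ (12 * L) := by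
    refine (Finset.sum_le_card_nsmul _ _ _ fun b _ =>
      lintegral_four_pow_load_le (m := m) (b := b) (buckets_pos hm)).trans ?_
    rw [Finset.card_range, nsmul_eq_mul, ← ENNReal.ofReal_natCast (buckets m),
      ← ENNReal.ofReal_mul (Nat.cast_nonneg _)]
    refine ENNReal.ofReal_le_of_le_toReal ?_
    rw [ENNReal.toReal_pow, ENNReal.toReal_ofNat]
    calc (buckets m : ℝ) * Real.exp (m * (3 / buckets m))
        ≤ Real.exp (L : ℝ) * Real.exp (6 * L) := by
          have := div_le_two_pow_logExp hm
          rw [← hL] at this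
          rw [mul_div_assoc', mul_comm (m : ℝ), mul_div_assoc]
          refine mul_le_mul (le_exp_two_pow_logExp hm) (Real.exp_le_exp.2 ?_) (Real.exp_pos _).le
            (Real.exp_pos _).le
          linarith
      _ = Real.exp 1 ^ (7 * L) := by
          rw [← Real.exp_add, ← Real.exp_nat_mul]
          push_cast
          ring_nf
      _ ≤ 3 ^ (7 * L) := by
          gcongr
          exact Real.exp_one_lt_three.le
      _ ≤ 2 ^ (12 * L) := by
          rw [pow_mul, pow_mul]
          gcongr
          norm_num
  refine (lintegral_mono fun x => supSize_le hm _ (12 * L)).trans ?_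
  rw [lintegral_add_left measurable_const, lintegral_const, measure_univ, mul_one]
  simp only [ENNReal.div_eq_inv_mul]
  rw [lintegral_const_mul _ (Finset.measurable_sum _ fun b _ => hmeas b),
    lintegral_finsetSum _ fun b _ => hmeas b]
  rw [← ENNReal.div_eq_inv_mul, show logExp m + 5 = logExp m + 4 + 1 from rfl, Nat.cast_add _ 1]
  gcongr
  rw [Nat.cast_one]
  exact ENNReal.div_le_of_le_mul (by rwa [one_mul])

theorem lintegral_timeBound_le (hm : 1 ≤ m) :
    ∫⁻ x : Fin m → unitInterval, (timeBound m (fun i => buckets m * (x i : ℝ)) : ℝ≥0∞) ≤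
      (4070 + 442 * logExp m : ℕ) := by
  have hc : Measurable fun n : ℕ => (n : ℝ≥0∞) := measurable_of_countable _
  have hx : Measurable fun (x : Fin m → unitInterval) i => (buckets m * (x i : ℝ) : ℝ) := by fun_prop
  have h1 := hc.comp ((measurable_supSize m).comp hx)
  have h2 := hc.comp ((measurable_emptyCount m).comp hx)
  have h1' := h1.const_mul (402 : ℕ)
  have h2' := h2.const_mul (60 : ℕ)
  simp only [Function.comp_def] at h1 h2 h1' h2'
  have hsplit : ∀ y : Fin m → ℝ, (timeBound m y : ℝ≥0∞) = ((2000 + 40 * logExp m : ℕ) : ℝ≥0∞) +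
      (402 : ℕ) * (((Finset.range (buckets m)).sup fun b => Nat.size (load m b y) : ℕ) : ℝ≥0∞) +
      (60 : ℕ) * (emptyCount m y : ℝ≥0∞) := fun y => by
    rw [timeBound, Nat.cast_add, Nat.cast_add _ (402 * _), Nat.cast_mul 402, Nat.cast_mul 60]
  simp only [hsplit]
  rw [lintegral_add_right _ h2', lintegral_add_left measurable_const,
    lintegral_const_mul _ h1, lintegral_const_mul _ h2, lintegral_const, measure_univ, mul_one]
  calc _ ≤ (((2000 + 40 * logExp m : ℕ) : ℝ≥0∞) + (402 : ℕ) * ((logExp m + 5 : ℕ) : ℝ≥0∞) +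
        (60 : ℕ) * 1) := by
        gcongr
        · exact lintegral_supSize_le hm
        · exact lintegral_emptyCount_le_one hm
    _ = ((2000 + 40 * logExp m + 402 * (logExp m + 5) + 60 * 1 : ℕ) : ℝ≥0∞) := by push_cast; ring
    _ ≤ _ := Nat.cast_le.2 (by omega)

/-- From 2 ^ `logExp m` < 2 log m follows `logExp m` < 1 + log (log m) / log 2, and 1 / log 2 < 2.
-/
theorem logExp_le_three_mul (m : ℕ) : (logExp m : ℝ) ≤ 3 * max 1 (Real.log (Real.log m)) := by
  have h1 := le_max_left 1 (Real.log (Real.log m))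
  by_cases h : logExp m = 0
  · rw [h, Nat.cast_zero]
    linarith
  have h2 := two_pow_logExp_lt h
  have hlog : 0 < Real.log m := by
    have : (0 : ℝ) < 2 ^ logExp m := by positivity
    linarith
  have h3 := Real.log_lt_log (by positivity) h2
  rw [Real.log_pow, Real.log_mul (by norm_num) hlog.ne'] at h3
  have h4 := le_max_right 1 (Real.log (Real.log m))
  have h5 := Real.log_two_gt_d9
  nlinarith

end Bounds

/-- The addresses need room of order (m + 2) ^ 3; as m + 2 ≥ 3, the exponent 8 absorbs the
constants. -/
theorem big_pow {m : ℕ} (hm : 1 ≤ m) : Big m (m + 2) ((m + 2) ^ 8) := by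
  refine ⟨rfl, hm, ?_⟩
  have h1 : 3 ^ 5 ≤ (m + 2) ^ 5 := Nat.pow_le_pow_left (by omega) 5
  have h2 : 1 ≤ (m + 2) ^ 3 := Nat.one_le_pow _ _ (by omega)
  calc 8 * ((m + 2) * (m + 2) * (m + 2)) + 8 = 8 * (m + 2) ^ 3 + 8 := by ring
    _ ≤ 3 ^ 5 * (m + 2) ^ 3 := by omega
    _ ≤ (m + 2) ^ 5 * (m + 2) ^ 3 := Nat.mul_le_mul_right _ h1
    _ = _ := by ring

end NoiseOracle

end

theorem mainTheorem3 (N : NoiseOracle.Noise) :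
    ∃ (A : NoiseOracle.Oracle) (c : ℕ) (C : ℝ), ∀ (m : ℕ) (ε : ℝ), 1 ≤ m → 0 < ε →
      ∀ σ : NoiseOracle.Strategy m,
        (∀ t : ℕ,
          ∫⁻ ω, ((A.accessTime ((m + 2) ^ c) ε σ t ω : ℕ∞) : ℝ≥0∞) ∂NoiseOracle.randomnessLaw
            ≤ ENNReal.ofReal (C * max 1 (Real.log (Real.log m)))) ∧
        (∀ t : ℕ,
          NoiseOracle.randomnessLaw.map (A.transcript ((m + 2) ^ c) ε σ t) =
            (NoiseOracle.noiseLaw N m ε).map (fun z => NoiseOracle.tableTranscript σ z t)) := by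
  -- 5396 = 4070 + 3 · 442, from `lintegral_timeBound_le` and `logExp_le_three_mul`.
  refine ⟨NoiseOracle.oracle N, 8, 5396, fun m ε hm hε σ => ⟨fun t => ?_, fun t =>
    NoiseOracle.map_transcript σ (NoiseOracle.big_pow hm) hε t⟩⟩
  refine (NoiseOracle.lintegral_accessTime_le σ (NoiseOracle.big_pow hm) hε t
    (NoiseOracle.measurable_timeBound m)).trans ((NoiseOracle.lintegral_timeBound_le hm).trans ?_)
  rw [← ENNReal.ofReal_natCast]
  refine ENNReal.ofReal_le_ofReal ?_
  have h1 := NoiseOracle.logExp_le_three_mul m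
  have h2 := le_max_left 1 (Real.log (Real.log m))
  push_cast
  linarith
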